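/- **Setting.** Let $\pi_0\in(0,1)$, $\pi_1=1-\pi_0$, $f_0=\mathbf 1_{(0,1)}$, and let $f_1$ be a probability density on $\mathbb R$ that is decreasing and continuous on $(0,1)$. Let $(\theta_i,X_i)$, $i\ge 1$, be i.i.d. with $\theta_i\sim\mathrm{Bern}(\pi_1)$ and $X_i\mid\theta_i\sim f_{\theta_i}$. Put $f=\pi_0f_0+\pi_1f_1$ and assume that for $X\sim f$ the local false discovery rate $W=\pi_0f_0(X)/f(X)$ has a probability density $g$ which is positive on $(0,1)$ and vanishes outside $(0,1)$. A decision rule $\delta^n=(\delta_1,\dots,\delta_n)$ is a Markov kernel from $\mathbb R^n$ (the observations $X^n=(X_1,\dots,X_n)$) to $\{0,1\}^n$. Its error rates are $$\mathrm{FDR}(\delta^n)=\mathbb E\left[\frac{\sum_i\delta_i(1-\theta_i)}{1\vee\sum_i\delta_i}\right],\qquad \mathrm{FNR}(\delta^n)=\mathbb E\left[\frac{\sum_i(1-\delta_i)\theta_i}{1\vee\sum_i(1-\delta_i)}\right].$$ Let $\mathsf{FNR}^*_n(\alpha)=\inf\{\mathrm{FNR}(\delta^n):\mathrm{FDR}(\delta^n)\le\alpha\}$,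 the infimum being over all decision rules, and $\mathsf{FNR}^*(\alpha)=\lim_{n\to\infty}\mathsf{FNR}^*_n(\alpha)$. **Procedure.** Let $\hat f$ be the Grenander estimator, i.e. the left-hand slope of the least concave majorant on $[0,1]$ of the empirical distribution function of $X_1,\dots,X_n$. Put $\widehat W_i=\frac{\pi_0f_0(X_i)}{\hat f(X_i)}\wedge 1$ and $$\widehat A(y)=\frac{\sum_i\widehat W_i\mathbf 1\{\widehat W_i\le y\}}{1\vee\sum_i\mathbf 1\{\widehat W_i\le y\}},\qquad \widehat B(y)=\frac{\sum_i(1-\widehat W_i)\mathbf 1\{\widehat W_i>y\}}{1\vee\sum_i\mathbf 1\{\widehat W_i>y\}},$$ $$\widehat{b^*}(\alpha)=\inf\{\widehat B(y):y\in[0,1],\ \widehat A(y)\le\alpha\},\qquad \widehat{y^*}(\alpha)=\max\{y\in\{0,\widehat W_1,\dots,\widehat W_n\}:\widehat A(y)\le\alpha\}.$$ Let $0=s_1<s_2<\dots<s_m=1$ be the knots (the end points $0,1$ and the interior points at which the slope changes) of the greatest convex minorant of $\widehat{b^*}$ on $[0,1]$. For $\alpha\in[0,1)$ let $k_0$ be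 the unique index with $\alpha\in[s_{k_0},s_{k_0+1})$; for $\alpha=1$ let $k_0=m-1$. Put $\hat p=(s_{k_0+1}-\alpha)/(s_{k_0+1}-s_{k_0})$. The procedure $\delta^n=\delta^n(\alpha)$ takes, given the data, $\delta_i=\mathbf 1\{\widehat W_i\le\widehat{y^*}(s_{k_0})\}$ for all $i$ with probability $\hat p$, and $\delta_i=\mathbf 1\{\widehat W_i\le\widehat{y^*}(s_{k_0+1})\}$ for all $i$ with probability $1-\hat p$. **Proposition.** For all $n$ and all $\alpha\in[0,1]$, $\delta^n(\alpha)$ is a decision rule (it agrees almost surely with a Markov kernel); the limit $\mathsf{FNR}^*(\alpha)$ exists for every $\alpha\in[0,1]$; and $$\limsup_{n\to\infty}\ \sup_{\alpha\in[0,1]}\bigl(\mathrm{FDR}(\delta^n(\alpha))-\alpha\bigr)\le 0,\qquad \lim_{n\to\infty}\ \sup_{\alpha\in[0,1]}\bigl|\mathrm{FNR}(\delta^n(\alpha))-\mathsf{FNR}^*(\alpha)\bigr|=0.$$ -/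

import Mathlib

open MeasureTheory ProbabilityTheory Filter Topology Set
open scoped ENNReal

noncomputable section

namespace TwoGroup

/-! ### The two-group random mixture model -/

/-- The null density: the uniform density on `(0,1)`. -/
def unifPdf : ℝ → ℝ := (Ioo (0 : ℝ) 1).indicator (fun _ => 1)

/-- The measure on `ℝ` with Lebesgue density `f`. -/
def densLaw (f : ℝ → ℝ) : Measure ℝ :=
  (volume : Measure ℝ).withDensity (fun x => ENNReal.ofReal (f x))

/-- The marginal density `f = π₀ f₀ + π₁ f₁`, with `π₁ = 1 - π₀`. -/
def mixPdf (π₀ : ℝ) (f₀ f₁ : ℝ → ℝ) (x : ℝ) : ℝ := π₀ * f₀ x + (1 - π₀) * f₁ x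

/-- The local false discovery rate `π₀ f₀ / f`. -/
def lfdr (π₀ : ℝ) (f₀ f₁ : ℝ → ℝ) (x : ℝ) : ℝ := π₀ * f₀ x / mixPdf π₀ f₀ f₁ x

/-- Joint law of one pair `(θ, X)`: `θ ∼ Bern(1 - π₀)` (`true` is non-null), `X ∣ θ ∼ f_θ`. -/
def pairLaw (π₀ : ℝ) (f₀ f₁ : ℝ → ℝ) : Measure (Bool × ℝ) :=
  ENNReal.ofReal π₀ • (Measure.dirac false).prod (densLaw f₀) +
    ENNReal.ofReal (1 - π₀) • (Measure.dirac true).prod (densLaw f₁)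

/-- Joint law of the i.i.d. pairs `(θ₁, X₁), …, (θₙ, Xₙ)`. -/
def modelLaw (π₀ : ℝ) (f₀ f₁ : ℝ → ℝ) (n : ℕ) : Measure (Fin n → Bool × ℝ) :=
  Measure.pi (fun _ => pairLaw π₀ f₀ f₁)

/-- Marginal law of the observations `X₁, …, Xₙ`, which are i.i.d. with density `f`. -/
def obsLaw (π₀ : ℝ) (f₀ f₁ : ℝ → ℝ) (n : ℕ) : Measure (Fin n → ℝ) :=
  Measure.pi (fun _ => densLaw (mixPdf π₀ f₀ f₁))

/-! ### False discoveries and false non-discoveries -/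

/-- False discovery proportion, for labels `θ` and decisions `d` (`true` is a rejection). -/
def fdp {n : ℕ} (θ d : Fin n → Bool) : ℝ :=
  (∑ i, if d i = true ∧ θ i = false then (1 : ℝ) else 0) /
    max 1 (∑ i, if d i = true then (1 : ℝ) else 0)

/-- False non-discovery proportion. -/
def fnp {n : ℕ} (θ d : Fin n → Bool) : ℝ :=
  (∑ i, if d i = false ∧ θ i = true then (1 : ℝ) else 0) /
    max 1 (∑ i, if d i = false then (1 : ℝ) else 0)

/-- False discovery rate of the randomized rule that, given the observations `x`, draws the
decisions from `δ x`. -/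
def FDR (π₀ : ℝ) (f₀ f₁ : ℝ → ℝ) {n : ℕ} (δ : (Fin n → ℝ) → Measure (Fin n → Bool)) : ℝ :=
  ∫ ω, (∫ d, fdp (fun i => (ω i).1) d ∂(δ (fun i => (ω i).2))) ∂(modelLaw π₀ f₀ f₁ n)

/-- False non-discovery rate of a randomized rule. -/
def FNR (π₀ : ℝ) (f₀ f₁ : ℝ → ℝ) {n : ℕ} (δ : (Fin n → ℝ) → Measure (Fin n → Bool)) : ℝ :=
  ∫ ω, (∫ d, fnp (fun i => (ω i).1) d ∂(δ (fun i => (ω i).2))) ∂(modelLaw π₀ f₀ f₁ n)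

/-- `FNR*ₙ(α)`: the smallest FNR over all decision rules (Markov kernels from the observations to
the decisions) whose FDR is at most `α`. -/
def fnrStarN (π₀ : ℝ) (f₀ f₁ : ℝ → ℝ) (n : ℕ) (α : ℝ) : ℝ :=
  sInf {r | ∃ κ : Kernel (Fin n → ℝ) (Fin n → Bool), IsMarkovKernel κ ∧
    FDR π₀ f₀ f₁ (fun x => κ x) ≤ α ∧ r = FNR π₀ f₀ f₁ (fun x => κ x)}

/-- `FNR*(α) = lim FNR*ₙ(α)`. -/
def fnrStar (π₀ : ℝ) (f₀ f₁ : ℝ → ℝ) (α : ℝ) : ℝ :=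
  limUnder atTop (fun n : ℕ => fnrStarN π₀ f₀ f₁ n α)

/-! ### Convex minorants, concave majorants, and the Grenander estimator -/

/-- Greatest convex minorant on `[0,1]`. -/
def gcm (h : ℝ → ℝ) (t : ℝ) : ℝ :=
  sSup {r | ∃ C : ℝ → ℝ, ConvexOn ℝ (Icc 0 1) C ∧ (∀ s ∈ Icc (0 : ℝ) 1, C s ≤ h s) ∧ r = C t}

/-- Least concave majorant on `[0,1]`. -/
def concMaj (h : ℝ → ℝ) (t : ℝ) : ℝ :=
  sInf {r | ∃ C : ℝ → ℝ, ConcaveOn ℝ (Icc 0 1) C ∧ (∀ s ∈ Icc (0 : ℝ) 1, h s ≤ C s) ∧ r = C t}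

/-- Empirical cumulative distribution function. -/
def ecdf {n : ℕ} (x : Fin n → ℝ) (t : ℝ) : ℝ := (∑ i, if x i ≤ t then (1 : ℝ) else 0) / n

/-- Grenander estimator: the (left-hand) slope of the least concave majorant of the empirical
cumulative distribution function. -/
def grenander {n : ℕ} (x : Fin n → ℝ) (t : ℝ) : ℝ := derivWithin (concMaj (ecdf x)) (Iic t) t

/-! ### The data-driven procedure -/

/-- Estimated local false discovery rates. -/
def wHat (π₀ : ℝ) (f₀ : ℝ → ℝ) {n : ℕ} (x : Fin n → ℝ) (i : Fin n) : ℝ :=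
  min (π₀ * f₀ (x i) / grenander x (x i)) 1

/-- `Â(y)`, for given estimated local false discovery rates `w`. -/
def aHat {n : ℕ} (w : Fin n → ℝ) (y : ℝ) : ℝ :=
  (∑ i, if w i ≤ y then w i else 0) / max 1 (∑ i, if w i ≤ y then (1 : ℝ) else 0)

/-- `B̂(y)`. -/
def bHat {n : ℕ} (w : Fin n → ℝ) (y : ℝ) : ℝ :=
  (∑ i, if y < w i then 1 - w i else 0) / max 1 (∑ i, if y < w i then (1 : ℝ) else 0)

/-- The estimate of `b*(α)`: the infimum of `B̂(y)` over `y ∈ [0,1]` with `Â(y) ≤ α`. -/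
def bStarHat {n : ℕ} (w : Fin n → ℝ) (α : ℝ) : ℝ :=
  sInf {r | ∃ y ∈ Icc (0 : ℝ) 1, aHat w y ≤ α ∧ r = bHat w y}

/-- The estimated cutoff: the largest `y ∈ {0, Ŵ₁, …, Ŵₙ}` with `Â(y) ≤ α` (a finite set). -/
def yStarHat {n : ℕ} (w : Fin n → ℝ) (α : ℝ) : ℝ :=
  sSup {y | (y = 0 ∨ ∃ i, y = w i) ∧ aHat w y ≤ α}

/-- Knots on `[0,1]` of a piecewise linear function: the end points and the interior points at
which the slope changes. -/
def knots (C : ℝ → ℝ) : Set ℝ :=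
  {s | s = 0 ∨ s = 1 ∨ (s ∈ Ioo (0 : ℝ) 1 ∧ ¬ DifferentiableAt ℝ C s)}

/-- The left end of the knot interval that contains `α`: the last knot `≤ α`
(for `α = 1`, the last knot before `1`). -/
def knotLeft (C : ℝ → ℝ) (α : ℝ) : ℝ := sSup {s | s ∈ knots C ∧ s ≤ α ∧ s < 1}

/-- The right end of the knot interval that contains `α`: the first knot `> α`
(for `α = 1`, the knot `1`). -/
def knotRight (C : ℝ → ℝ) (α : ℝ) : ℝ := sInf {s | s ∈ knots C ∧ (α < s ∨ s = 1)}

/-- Decisions of the rule that rejects when the estimated local false discovery rate is at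
most `y`. -/
def thresholdRule {n : ℕ} (w : Fin n → ℝ) (y : ℝ) (i : Fin n) : Bool := decide (w i ≤ y)

/-- The data-driven procedure, for estimated local false discovery rates `w`: with `s ≤ α ≤ s'`
the consecutive knots around `α` of the greatest convex minorant of the estimate of `b*`, use the
cutoff `ŷ*(s)` with probability `p̂ = (s' - α) / (s' - s)` and the cutoff `ŷ*(s')` otherwise. -/
def adaptiveLaw {n : ℕ} (w : Fin n → ℝ) (α : ℝ) : Measure (Fin n → Bool) :=
  let C := gcm (bStarHat w)
  let s := knotLeft C α
  let s' := knotRight C α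
  let p := (s' - α) / (s' - s)
  ENNReal.ofReal p • Measure.dirac (thresholdRule w (yStarHat w s)) +
    ENNReal.ofReal (1 - p) • Measure.dirac (thresholdRule w (yStarHat w s'))

/-- The data-driven procedure with the Grenander estimator, as a function of the data `x`. -/
def adaptiveRule (π₀ : ℝ) (f₀ : ℝ → ℝ) (n : ℕ) (α : ℝ) (x : Fin n → ℝ) :
    Measure (Fin n → Bool) :=
  adaptiveLaw (wHat π₀ f₀ x) α

end TwoGroup

end

namespace TwoGroup

/-! ### Greatest convex minorants -/

/-! Given the observations, label i is null with probability W(x i), where W is the local false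
discovery rate. The error proportions are linear in the labels, so FDR and FNR are expectations of
`postFdp` and `postFnp`, which involve only the values W(x i) and the decisions.

A sample of such values is encoded in one function, the mean of (y - w)⁺ (`avgPos`). Its limit is φ,
with derivative G, the distribution function of W(X). `Near` says that the two are uniformly close;
Chebyshev on a finite grid gives this outside an event of vanishing probability (`exists_bad_sets`).
Off that event all estimates are deterministic. The event depends neither on the level nor on the
rule, hence the uniformity in the level.

Optimality. Since w ≥ y - (y - w)⁺, rejecting k hypotheses costs at least as much as the threshold y
with G y = k / n. So (postFdp, postFnp) lies, up to ε, above the curve (`curveA`, `curveB`) and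
hence above its convex lower boundary C = `curveC` (`C_postFdp_le`). Averaging cannot lead below a
convex curve, so no rule of level α has FNR much below C α.

Attainment. The distribution function F of the observations is concave, so the least concave
majorant of the empirical distribution function is as close to F as that function itself. Its slopes
are then squeezed between slopes of chords of F, so the estimated rates are consistent in mean
(`mean_wHat_near`) and inherit `Near`. Consequently the minorant of `bStarHat` is at most C + ε
(`gcm_bStarHat_le`). That minorant meets the step function at its knots and is affine between them,
so randomizing between neighbouring knots realizes it exactly (`gcm_eq_interp`). Convergence of
knots or cutoffs is never needed: the upper bound for the FNR is this one-sided comparison, and the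
lower bound is the optimality inequality applied to the procedure's own decisions. Both bounds
together identify the limit FNR* with C. -/

theorem _root_.ConvexOn.three_point {C : ℝ → ℝ} {S : Set ℝ} (hC : ConvexOn ℝ S C) {a b c : ℝ}
    (ha : a ∈ S) (hc : c ∈ S) (hab : a ≤ b) (hbc : b ≤ c) :
    (c - a) * C b ≤ (c - b) * C a + (b - a) * C c := by
  rcases hab.eq_or_lt with rfl | hab
  · linarith
  rcases hbc.eq_or_lt with rfl | hbc
  · linarith
  have h := hC.slope_mono_adjacent ha hc hab hbc
  rw [div_le_div_iff₀ (by linarith) (by linarith)] at h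
  nlinarith

theorem convexOn_affine (S : Set ℝ) (hS : Convex ℝ S) (a m p : ℝ) :
    ConvexOn ℝ S (fun t => a + m * (t - p)) := by
  refine ⟨hS, fun x _ y _ u v _ _ huv => le_of_eq ?_⟩
  obtain rfl : v = 1 - u := by linarith
  simp only [smul_eq_mul]
  ring

/-- A constant below h makes the family of convex minorants nonempty; over an empty family `sSup`
would return 0. -/
theorem gcm_le {h : ℝ → ℝ} (hb : ∃ m, ∀ s ∈ Icc (0 : ℝ) 1, m ≤ h s) {t : ℝ}
    (ht : t ∈ Icc (0 : ℝ) 1) : gcm h t ≤ h t := by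
  obtain ⟨m, hm⟩ := hb
  refine csSup_le ⟨m, fun _ => m, convexOn_const m (convex_Icc 0 1), hm, rfl⟩ ?_
  rintro r ⟨C, -, hC, rfl⟩
  exact hC t ht

theorem le_gcm {h D : ℝ → ℝ} (hD : ConvexOn ℝ (Icc 0 1) D) (hDh : ∀ s ∈ Icc (0 : ℝ) 1, D s ≤ h s)
    {t : ℝ} (ht : t ∈ Icc (0 : ℝ) 1) : D t ≤ gcm h t := by
  refine le_csSup ⟨h t, ?_⟩ ⟨D, hD, hDh, rfl⟩
  rintro r ⟨C, -, hC, rfl⟩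
  exact hC t ht

theorem convexOn_gcm {h : ℝ → ℝ} (hb : ∃ m, ∀ s ∈ Icc (0 : ℝ) 1, m ≤ h s) :
    ConvexOn ℝ (Icc 0 1) (gcm h) := by
  refine ⟨convex_Icc 0 1, fun x hx y hy u v hu hv huv => ?_⟩
  obtain ⟨m, hm⟩ := hb
  refine csSup_le ⟨m, fun _ => m, convexOn_const m (convex_Icc 0 1), hm, rfl⟩ ?_
  rintro r ⟨D, hD, hDh, rfl⟩
  refine (hD.2 hx hy hu hv huv).trans ?_
  simp only [smul_eq_mul]
  have h1 := le_gcm hD hDh hx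
  have h2 := le_gcm hD hDh hy
  gcongr

/-- The constant h 1 is a convex minorant, so the minorant is nowhere below its value at 1, and a
convex function with this property decreases. -/
theorem antitoneOn_gcm {h : ℝ → ℝ} (hh : AntitoneOn h (Icc 0 1)) :
    AntitoneOn (gcm h) (Icc 0 1) := by
  have hb : ∃ m, ∀ s ∈ Icc (0 : ℝ) 1, m ≤ h s :=
    ⟨h 1, fun s hs => hh hs (right_mem_Icc.2 zero_le_one) hs.2⟩
  intro s hs t ht hst
  have h1 : h 1 ≤ gcm h s := le_gcm (convexOn_const (h 1) (convex_Icc 0 1))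
    (fun s hs => hh hs (right_mem_Icc.2 zero_le_one) hs.2) hs
  have h2 := gcm_le hb (right_mem_Icc.2 (zero_le_one' ℝ))
  have h3 := (convexOn_gcm hb).three_point hs (right_mem_Icc.2 zero_le_one) hst ht.2
  rcases hs.2.eq_or_lt with rfl | hs1
  · rw [le_antisymm ht.2 hst]
  · have : (t - s) * gcm h 1 ≤ (t - s) * gcm h s :=
      mul_le_mul_of_nonneg_left (h2.trans h1) (by linarith)
    exact le_of_mul_le_mul_left (by linarith : (1 - s) * gcm h t ≤ (1 - s) * gcm h s) (by linarith)

/-- Lets the Grenander estimator and the knots of the procedure share one theory, that of minorants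
of antitone step functions. -/
theorem concMaj_eq_neg_gcm (e : ℝ → ℝ) (t : ℝ) : concMaj e t = -gcm (fun s => -e s) t := by
  unfold concMaj gcm
  rw [← Real.sInf_neg]
  congr 1
  ext r
  constructor
  · rintro ⟨C, hC, hCe, rfl⟩
    exact ⟨-C, hC.neg, fun s hs => neg_le_neg (hCe s hs), by simp⟩
  · rintro ⟨C, hC, hCe, hr⟩
    exact ⟨-C, hC.neg, fun s hs => by simpa using neg_le_neg (hCe s hs), by simp [← hr]⟩

/-- If the chord of the greatest convex minorant over `[p, q]` stays below the function, then the
minorant agrees with its chord there. -/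
theorem gcm_eq_chord {h : ℝ → ℝ} (hb : ∃ m, ∀ s ∈ Icc (0 : ℝ) 1, m ≤ h s) {p q m : ℝ}
    (hp : 0 ≤ p) (hpq : p < q) (hq : q ≤ 1) (hm : gcm h q = gcm h p + m * (q - p))
    (hch : ∀ t ∈ Icc p q, gcm h p + m * (t - p) ≤ h t) :
    ∀ t ∈ Icc p q, gcm h t = gcm h p + m * (t - p) := by
  have hC := convexOn_gcm hb
  have hpI : p ∈ Icc (0 : ℝ) 1 := ⟨hp, by linarith⟩
  have hqI : q ∈ Icc (0 : ℝ) 1 := ⟨by linarith, hq⟩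
  have hqp : 0 < q - p := by linarith
  -- The whole line through the chord is a convex minorant of h: outside [p, q] it lies below the
  -- convex function `gcm h`.
  have hle : ∀ t ∈ Icc (0 : ℝ) 1, gcm h p + m * (t - p) ≤ h t := by
    intro t ht
    rcases lt_or_ge t p with h1 | h1
    · refine le_trans ?_ (gcm_le hb ht)
      have := hC.three_point ht hqI h1.le hpq.le
      rw [hm] at this
      refine le_of_mul_le_mul_left (?_ : (q - p) * _ ≤ (q - p) * _) hqp
      linarith
    rcases lt_or_ge q t with h2 | h2
    · refine le_trans ?_ (gcm_le hb ht)
      have := hC.three_point hpI ht hpq.le h2.le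
      rw [hm] at this
      refine le_of_mul_le_mul_left (?_ : (q - p) * _ ≤ (q - p) * _) hqp
      linarith
    · exact hch t ⟨h1, h2⟩
  intro t ht
  have htI : t ∈ Icc (0 : ℝ) 1 := ⟨hp.trans ht.1, ht.2.trans hq⟩
  refine le_antisymm ?_ (le_gcm (convexOn_affine _ (convex_Icc 0 1) _ m p) hle htI)
  have := hC.three_point hpI hqI ht.1 ht.2
  rw [hm] at this
  refine le_of_mul_le_mul_left (?_ : (q - p) * _ ≤ (q - p) * _) hqp
  linarith

/-- `C` is affine on `[p, q]`. -/
def AffineOnIcc (C : ℝ → ℝ) (p q : ℝ) : Prop := ∃ m, ∀ t ∈ Icc p q, C t = C p + m * (t - p)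

theorem AffineOnIcc.differentiableAt {C : ℝ → ℝ} {p q s : ℝ} (h : AffineOnIcc C p q)
    (hs : s ∈ Ioo p q) : DifferentiableAt ℝ C s := by
  obtain ⟨m, hm⟩ := h
  have : (fun t => C p + m * (t - p)) =ᶠ[𝓝 s] C := by
    filter_upwards [Ioo_mem_nhds hs.1 hs.2] with t ht
    exact (hm t ⟨ht.1.le, ht.2.le⟩).symm
  exact (this.differentiableAt_iff).1 (by fun_prop)

theorem AffineOnIcc.hasDerivWithinAt_Iic {C : ℝ → ℝ} {p q m s : ℝ}
    (hm : ∀ t ∈ Icc p q, C t = C p + m * (t - p)) (hs : s ∈ Ioc p q) :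
    HasDerivWithinAt C m (Iic s) s := by
  have h1 : HasDerivWithinAt (fun t => C p + m * (t - p)) m (Iic s) s := by
    simpa using ((((hasDerivAt_id s).sub_const p).const_mul m).const_add (C p)).hasDerivWithinAt
  refine h1.congr_of_eventuallyEq ?_ (hm s ⟨hs.1.le, hs.2⟩)
  filter_upwards [self_mem_nhdsWithin, mem_nhdsWithin_of_mem_nhds (Ioi_mem_nhds hs.1)] with t h1 h2
  exact hm t ⟨le_of_lt h2, le_trans h1 hs.2⟩

theorem AffineOnIcc.hasDerivWithinAt_Ici {C : ℝ → ℝ} {p q m s : ℝ}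
    (hm : ∀ t ∈ Icc p q, C t = C p + m * (t - p)) (hs : s ∈ Ico p q) :
    HasDerivWithinAt C m (Ici s) s := by
  have h1 : HasDerivWithinAt (fun t => C p + m * (t - p)) m (Ici s) s := by
    simpa using ((((hasDerivAt_id s).sub_const p).const_mul m).const_add (C p)).hasDerivWithinAt
  refine h1.congr_of_eventuallyEq ?_ (hm s ⟨hs.1, hs.2.le⟩)
  filter_upwards [self_mem_nhdsWithin, mem_nhdsWithin_of_mem_nhds (Iio_mem_nhds hs.2)] with t h1 h2
  exact hm t ⟨le_trans hs.1 h1, le_of_lt h2⟩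

/-- Differentiability at q forces the slopes of the two pieces to agree. -/
theorem AffineOnIcc.trans {C : ℝ → ℝ} {p q r : ℝ} (h₁ : AffineOnIcc C p q) (h₂ : AffineOnIcc C q r)
    (hpq : p < q) (hqr : q < r) (hd : DifferentiableAt ℝ C q) : AffineOnIcc C p r := by
  obtain ⟨m, hm⟩ := h₁
  obtain ⟨m', hm'⟩ := h₂
  have e1 := (AffineOnIcc.hasDerivWithinAt_Iic hm ⟨hpq, le_rfl⟩).derivWithin
    (uniqueDiffWithinAt_Iic q)
  have e2 := (AffineOnIcc.hasDerivWithinAt_Ici hm' ⟨le_rfl, hqr⟩).derivWithin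
    (uniqueDiffWithinAt_Ici q)
  rw [hd.derivWithin (uniqueDiffWithinAt_Iic q)] at e1
  rw [hd.derivWithin (uniqueDiffWithinAt_Ici q)] at e2
  obtain rfl : m = m' := e1.symm.trans e2
  refine ⟨m, fun t ht => ?_⟩
  rcases le_total t q with h | h
  · exact hm t ⟨ht.1, h⟩
  · rw [hm' t ⟨h, ht.2⟩, hm q ⟨hpq.le, le_rfl⟩]
    ring

theorem AffineOnIcc.value {C : ℝ → ℝ} {p q t : ℝ} (h : AffineOnIcc C p q) (hpq : p < q)
    (ht : t ∈ Icc p q) :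
    C t = (q - t) / (q - p) * C p + (1 - (q - t) / (q - p)) * C q := by
  obtain ⟨m, hm⟩ := h
  have : q - p ≠ 0 := by linarith
  rw [hm t ht, hm q ⟨hpq.le, le_rfl⟩]
  field_simp
  ring

/-! ### Antitone step functions -/

/-- `h` is an antitone right-continuous step function on `[0,1]`, with jumps in `P`. -/
structure IsStep (P : Finset ℝ) (h : ℝ → ℝ) : Prop where
  zero_mem : 0 ∈ P
  one_mem : 1 ∈ P
  subset : ∀ p ∈ P, p ∈ Icc (0 : ℝ) 1
  anti : AntitoneOn h (Icc 0 1)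
  step : ∀ t ∈ Icc (0 : ℝ) 1, ∃ p ∈ P, p ≤ t ∧ h p = h t

namespace IsStep

variable {P : Finset ℝ} {h : ℝ → ℝ}

theorem bdd (H : IsStep P h) : ∃ m, ∀ s ∈ Icc (0 : ℝ) 1, m ≤ h s :=
  ⟨h 1, fun _ hs => H.anti hs (right_mem_Icc.2 zero_le_one) hs.2⟩

theorem const_of_gap (H : IsStep P h) {p q : ℝ} (hp : 0 ≤ p) (hq : q ≤ 1)
    (hgap : ∀ r ∈ P, r ≤ p ∨ q ≤ r) {t : ℝ} (ht : t ∈ Ico p q) : h t = h p := by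
  have htI : t ∈ Icc (0 : ℝ) 1 := ⟨hp.trans ht.1, ht.2.le.trans hq⟩
  have hpI : p ∈ Icc (0 : ℝ) 1 := ⟨hp, ht.1.trans htI.2⟩
  obtain ⟨r, hr, hrt, hre⟩ := H.step t htI
  refine le_antisymm (H.anti hpI htI ht.1) ?_
  rw [← hre]
  refine H.anti (H.subset r hr) hpI ((hgap r hr).resolve_right fun h' => ?_)
  exact absurd (h'.trans hrt) (not_le.2 ht.2)

theorem exists_next (H : IsStep P h) {t : ℝ} (ht1 : t < 1) :
    ∃ q ∈ P, t < q ∧ ∀ r ∈ P, r ≤ t ∨ q ≤ r := by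
  have hne : (P.filter (t < ·)).Nonempty := ⟨1, by simp [H.one_mem, ht1]⟩
  refine ⟨(P.filter (t < ·)).min' hne, ?_, ?_, fun r hr => ?_⟩
  · exact (Finset.mem_filter.1 (Finset.min'_mem _ hne)).1
  · exact (Finset.mem_filter.1 (Finset.min'_mem _ hne)).2
  · by_cases h' : r ≤ t
    · exact Or.inl h'
    · exact Or.inr (Finset.min'_le _ _ (Finset.mem_filter.2 ⟨hr, not_le.1 h'⟩))

theorem exists_prev (H : IsStep P h) {t : ℝ} (ht0 : 0 < t) :
    ∃ q ∈ P, q < t ∧ ∀ r ∈ P, r ≤ q ∨ t ≤ r := by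
  have hne : (P.filter (· < t)).Nonempty := ⟨0, by simp [H.zero_mem, ht0]⟩
  refine ⟨(P.filter (· < t)).max' hne, ?_, ?_, fun r hr => ?_⟩
  · exact (Finset.mem_filter.1 (Finset.max'_mem _ hne)).1
  · exact (Finset.mem_filter.1 (Finset.max'_mem _ hne)).2
  · by_cases h' : t ≤ r
    · exact Or.inr h'
    · exact Or.inl (Finset.le_max' (P.filter (· < t)) r (Finset.mem_filter.2 ⟨hr, not_le.1 h'⟩))

/-- On a gap between jumps h keeps the value h p, while the chord of the minorant starts at most at
h p and decreases. So the chord stays below h and `gcm_eq_chord` applies. -/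
theorem affine_of_gap (H : IsStep P h) {p q : ℝ} (hp : 0 ≤ p) (hpq : p < q) (hq : q ≤ 1)
    (hgap : ∀ r ∈ P, r ≤ p ∨ q ≤ r) : AffineOnIcc (gcm h) p q := by
  have hpI : p ∈ Icc (0 : ℝ) 1 := ⟨hp, by linarith⟩
  have hqI : q ∈ Icc (0 : ℝ) 1 := ⟨by linarith, hq⟩
  have hm : gcm h q = gcm h p + (gcm h q - gcm h p) / (q - p) * (q - p) := by
    have : q - p ≠ 0 := by linarith
    field_simp
    ring
  refine ⟨(gcm h q - gcm h p) / (q - p), gcm_eq_chord H.bdd hp hpq hq hm fun t ht => ?_⟩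
  rcases ht.2.eq_or_lt with rfl | htq
  · rw [← hm]
    exact gcm_le H.bdd hqI
  · rw [H.const_of_gap hp hq hgap ⟨ht.1, htq⟩]
    refine le_trans ?_ (gcm_le H.bdd hpI)
    have h1 := antitoneOn_gcm H.anti hpI hqI hpq.le
    have h2 : (gcm h q - gcm h p) / (q - p) ≤ 0 :=
      div_nonpos_of_nonpos_of_nonneg (by linarith) (by linarith)
    nlinarith [ht.1]

theorem differentiableAt_of_notMem (H : IsStep P h) {t : ℝ} (ht : t ∈ Ioo (0 : ℝ) 1) (htP : t ∉ P) :
    DifferentiableAt ℝ (gcm h) t := by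
  obtain ⟨q, hqP, hq, hgq⟩ := H.exists_next ht.2
  obtain ⟨p, hpP, hp, hgp⟩ := H.exists_prev ht.1
  refine (H.affine_of_gap (H.subset p hpP).1 (hp.trans hq) (H.subset q hqP).2
    fun r hr => ?_).differentiableAt ⟨hp, hq⟩
  rcases hgp r hr with h1 | h1
  · exact Or.inl h1
  rcases hgq r hr with h2 | h2
  · exact absurd (le_antisymm h2 h1 ▸ hr) htP
  · exact Or.inr h2

theorem knots_subset (H : IsStep P h) : knots (gcm h) ⊆ P := by
  rintro s (rfl | rfl | ⟨hs, hd⟩)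
  · exact H.zero_mem
  · exact H.one_mem
  · by_contra hsP
    exact hd (H.differentiableAt_of_notMem hs hsP)

theorem finite_knots (H : IsStep P h) : (knots (gcm h)).Finite :=
  P.finite_toSet.subset H.knots_subset

theorem gcm_zero (H : IsStep P h) : gcm h 0 = h 0 := by
  have h0 : (0 : ℝ) ∈ Icc (0 : ℝ) 1 := left_mem_Icc.2 zero_le_one
  have h1 : (1 : ℝ) ∈ Icc (0 : ℝ) 1 := right_mem_Icc.2 zero_le_one
  refine le_antisymm (gcm_le H.bdd h0) ?_
  obtain ⟨q, hqP, hq, hgq⟩ := H.exists_next zero_lt_one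
  have h01 := H.anti h0 h1 zero_le_one
  -- Because h is constant up to the first jump q, the line from (0, h 0) to (q, h 1) is a minorant;
  -- beyond q it is below h 1.
  have := le_gcm (h := h) (convexOn_affine _ (convex_Icc 0 1) (h 0) (-((h 0 - h 1) / q)) 0)
    (fun s hs => ?_) h0
  · simpa using this
  · rcases lt_or_ge s q with hsq | hsq
    · rw [H.const_of_gap le_rfl (H.subset q hqP).2 hgq ⟨hs.1, hsq⟩]
      have : 0 ≤ (h 0 - h 1) / q * s := mul_nonneg (div_nonneg (by linarith) hq.le) hs.1
      linarith
    · refine le_trans ?_ (H.anti hs h1 hs.2)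
      have : (h 0 - h 1) / q * q ≤ (h 0 - h 1) / q * s :=
        mul_le_mul_of_nonneg_left hsq (div_nonneg (by linarith) hq.le)
      rw [div_mul_cancel₀ _ hq.ne'] at this
      linarith

theorem gcm_one (H : IsStep P h) : gcm h 1 = h 1 := by
  have h1 : (1 : ℝ) ∈ Icc (0 : ℝ) 1 := right_mem_Icc.2 zero_le_one
  exact le_antisymm (gcm_le H.bdd h1) (le_gcm (convexOn_const (h 1) (convex_Icc 0 1))
    (fun s hs => H.anti hs h1 hs.2) h1)

/-- If the minorant were strictly below h at s, then by continuity it would be below h s at some p <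
s. A chord from p to a point r before the next jump would then stay below h, because h ≥ h s on [p,
r]. The minorant would be affine around s, and s no knot. -/
theorem gcm_knot (H : IsStep P h) {s : ℝ} (hs : s ∈ knots (gcm h)) : gcm h s = h s := by
  rcases hs with rfl | rfl | ⟨hs, hd⟩
  · exact H.gcm_zero
  · exact H.gcm_one
  by_contra hne
  have hsI : s ∈ Icc (0 : ℝ) 1 := ⟨hs.1.le, hs.2.le⟩
  have hlt : gcm h s < h s := lt_of_le_of_ne (gcm_le H.bdd hsI) hne
  have hcont : ContinuousAt (gcm h) s :=
    ((convexOn_gcm H.bdd).continuousOn_interior).continuousAt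
      (by rw [interior_Icc]; exact Ioo_mem_nhds hs.1 hs.2)
  obtain ⟨q, hqP, hq, hgq⟩ := H.exists_next hs.2
  obtain ⟨p, hps, hp⟩ : ∃ p ∈ Ioo 0 s, gcm h p < h s := by
    have h1 : ∀ᶠ t in 𝓝[<] s, gcm h t < h s :=
      (hcont.eventually (gt_mem_nhds hlt)).filter_mono nhdsWithin_le_nhds
    have h2 : ∀ᶠ t in 𝓝[<] s, t ∈ Ioo 0 s := Ioo_mem_nhdsLT hs.1
    obtain ⟨p, hp1, hp2⟩ := (h1.and h2).exists
    exact ⟨p, hp2, hp1⟩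
  obtain ⟨r, hsr, hrq⟩ := exists_between hq
  have hr1 : r ≤ 1 := hrq.le.trans (H.subset q hqP).2
  have hpr : p < r := hps.2.trans hsr
  have hpI : p ∈ Icc (0 : ℝ) 1 := ⟨hps.1.le, by linarith⟩
  have hrI : r ∈ Icc (0 : ℝ) 1 := ⟨by linarith [hps.1], hr1⟩
  have hm : gcm h r = gcm h p + (gcm h r - gcm h p) / (r - p) * (r - p) := by
    have : r - p ≠ 0 := by linarith
    field_simp
    ring
  refine hd (AffineOnIcc.differentiableAt
    ⟨_, gcm_eq_chord H.bdd hps.1.le hpr hr1 hm fun t ht => ?_⟩ ⟨hps.2, hsr⟩)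
  have hsl : (gcm h r - gcm h p) / (r - p) * (t - p) ≤ 0 :=
    mul_nonpos_of_nonpos_of_nonneg (div_nonpos_of_nonpos_of_nonneg
      (by linarith [antitoneOn_gcm H.anti hpI hrI hpr.le]) (by linarith)) (by linarith [ht.1])
  have hts : h s ≤ h t := by
    rcases le_total t s with h' | h'
    · exact H.anti ⟨hpI.1.trans ht.1, h'.trans hsI.2⟩ hsI h'
    · exact (H.const_of_gap hsI.1 (H.subset q hqP).2 hgq ⟨h', ht.2.trans_lt hrq⟩).ge
  linarith

/-- Take the last jump point q up to which the minorant is affine from s. If q < s', then q is not a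
knot, and the next gap can be glued on. -/
theorem affine_of_no_knot (H : IsStep P h) {s s' : ℝ} (hs : 0 ≤ s) (hss : s < s') (hs' : s' ∈ P)
    (hk : ∀ k ∈ knots (gcm h), k ≤ s ∨ s' ≤ k) : AffineOnIcc (gcm h) s s' := by
  classical
  have hs1 := (H.subset s' hs').2
  set Q := P.filter (fun q => s < q ∧ q ≤ s' ∧ AffineOnIcc (gcm h) s q) with hQ
  have hne : Q.Nonempty := by
    obtain ⟨q, hqP, hq, hg⟩ := H.exists_next (hss.trans_le hs1)
    refine ⟨q, Finset.mem_filter.2 ⟨hqP, hq, (hg s' hs').resolve_left (not_le.2 hss), ?_⟩⟩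
    exact H.affine_of_gap hs hq (H.subset q hqP).2 hg
  obtain ⟨hqP, hsq, hqs', haff⟩ := Finset.mem_filter.1 (Q.max'_mem hne)
  set q := Q.max' hne with hqdef
  rcases hqs'.eq_or_lt with heq | hlt
  · rwa [← heq]
  exfalso
  obtain ⟨r, hrP, hr, hg⟩ := H.exists_next (hlt.trans_le hs1)
  have hd : DifferentiableAt ℝ (gcm h) q := by
    by_contra hd
    rcases hk q (Or.inr (Or.inr ⟨⟨hs.trans_lt hsq, hlt.trans_le hs1⟩, hd⟩)) with h1 | h1 <;> linarith
  have := haff.trans (H.affine_of_gap (hs.trans hsq.le) hr (H.subset r hrP).2 hg) hsq hr hd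
  have hrQ : r ∈ Q := Finset.mem_filter.2
    ⟨hrP, hsq.trans hr, (hg s' hs').resolve_left (not_le.2 hlt), this⟩
  exact absurd (Q.le_max' r hrQ) (not_le.2 hr)

theorem knotLeft_spec (H : IsStep P h) {α : ℝ} (hα : α ∈ Icc (0 : ℝ) 1) :
    knotLeft (gcm h) α ∈ knots (gcm h) ∧ knotLeft (gcm h) α ≤ α ∧ knotLeft (gcm h) α < 1 := by
  have hne : {s | s ∈ knots (gcm h) ∧ s ≤ α ∧ s < 1}.Nonempty :=
    ⟨0, Or.inl rfl, hα.1, zero_lt_one⟩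
  exact hne.csSup_mem (H.finite_knots.subset fun s hs => hs.1)

theorem knotRight_spec (H : IsStep P h) (α : ℝ) :
    knotRight (gcm h) α ∈ knots (gcm h) ∧ (α < knotRight (gcm h) α ∨ knotRight (gcm h) α = 1) := by
  have hne : {s | s ∈ knots (gcm h) ∧ (α < s ∨ s = 1)}.Nonempty :=
    ⟨1, Or.inr (Or.inl rfl), Or.inr rfl⟩
  exact hne.csInf_mem (H.finite_knots.subset fun s hs => hs.1)

theorem le_knotLeft (H : IsStep P h) {α k : ℝ} (hk : k ∈ knots (gcm h)) (h1 : k ≤ α) (h2 : k < 1) :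
    k ≤ knotLeft (gcm h) α :=
  le_csSup ((H.finite_knots.subset fun _ hs => hs.1).bddAbove) ⟨hk, h1, h2⟩

theorem knotRight_le (H : IsStep P h) {α k : ℝ} (hk : k ∈ knots (gcm h)) (h1 : α < k ∨ k = 1) :
    knotRight (gcm h) α ≤ k :=
  csInf_le ((H.finite_knots.subset fun _ hs => hs.1).bddBelow) ⟨hk, h1⟩

theorem le_knotRight (H : IsStep P h) {α : ℝ} (hα : α ∈ Icc (0 : ℝ) 1) :
    α ≤ knotRight (gcm h) α := by
  rcases (H.knotRight_spec α).2 with h1 | h1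
  · exact h1.le
  · rw [h1]
    exact hα.2

theorem knotLeft_lt_knotRight (H : IsStep P h) {α : ℝ} (hα : α ∈ Icc (0 : ℝ) 1) :
    knotLeft (gcm h) α < knotRight (gcm h) α := by
  obtain ⟨-, h1, h2⟩ := H.knotLeft_spec hα
  rcases (H.knotRight_spec α).2 with h3 | h3
  · exact h1.trans_lt h3
  · rwa [h3]

theorem affine_knots (H : IsStep P h) {α : ℝ} (hα : α ∈ Icc (0 : ℝ) 1) :
    AffineOnIcc (gcm h) (knotLeft (gcm h) α) (knotRight (gcm h) α) := by
  refine H.affine_of_no_knot (H.subset _ (H.knots_subset (H.knotLeft_spec hα).1)).1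
    (H.knotLeft_lt_knotRight hα) (H.knots_subset (H.knotRight_spec α).1) fun k hk => ?_
  rcases lt_or_ge α k with h1 | h1
  · exact Or.inr (H.knotRight_le hk (Or.inl h1))
  rcases (H.subset k (H.knots_subset hk)).2.eq_or_lt with h2 | h2
  · exact Or.inr (H.knotRight_le hk (Or.inr h2))
  · exact Or.inl (H.le_knotLeft hk h1 h2)

/-- The weight on the left knot is exactly the randomization probability of the procedure, so mixing
the two cutoffs realizes the minorant. -/
theorem gcm_eq_interp (H : IsStep P h) {α : ℝ} (hα : α ∈ Icc (0 : ℝ) 1) :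
    gcm h α = (knotRight (gcm h) α - α) / (knotRight (gcm h) α - knotLeft (gcm h) α) *
        h (knotLeft (gcm h) α) +
      (1 - (knotRight (gcm h) α - α) / (knotRight (gcm h) α - knotLeft (gcm h) α)) *
        h (knotRight (gcm h) α) := by
  rw [(H.affine_knots hα).value (H.knotLeft_lt_knotRight hα)
    ⟨(H.knotLeft_spec hα).2.1, H.le_knotRight hα⟩, H.gcm_knot (H.knotLeft_spec hα).1,
    H.gcm_knot (H.knotRight_spec α).1]

/-- The interior knots are the jump points at which the step function lies strictly below all of
its chords. -/
theorem mem_knots_iff (H : IsStep P h) {s : ℝ} (hsP : s ∈ P) :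
    s ∈ knots (gcm h) ↔ s = 0 ∨ s = 1 ∨ ∀ r ∈ P, ∀ r' ∈ P, r < s → s < r' →
      (r' - r) * h s < (r' - s) * h r + (s - r) * h r' := by
  have hsI := H.subset s hsP
  by_cases h0 : s = 0
  · simp [knots, h0]
  by_cases h1 : s = 1
  · simp [knots, h1]
  have hs : s ∈ Ioo (0 : ℝ) 1 :=
    ⟨lt_of_le_of_ne hsI.1 (Ne.symm h0), lt_of_le_of_ne hsI.2 h1⟩
  have hC := convexOn_gcm H.bdd
  simp only [h0, h1, false_or]
  constructor
  · intro hk r hr r' hr' hrs hsr'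
    obtain ⟨-, hd⟩ := (hk.resolve_left h0).resolve_left h1
    by_contra hcon
    have hrI := H.subset r hr
    have hrI' := H.subset r' hr'
    have e1 := mul_le_mul_of_nonneg_left (gcm_le H.bdd hrI) (by linarith : 0 ≤ r' - s)
    have e2 := mul_le_mul_of_nonneg_left (gcm_le H.bdd hrI') (by linarith : 0 ≤ s - r)
    rw [← H.gcm_knot hk] at hcon
    have e3 := hC.three_point hrI hrI' hrs.le hsr'.le
    -- A chord through points above the minorant that is not above it at s must touch it there; a
    -- convex function touching its chord at an interior point is affine along it.
    have e4 : (r' - r) * gcm h s = (r' - s) * gcm h r + (s - r) * gcm h r' := by linarith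
    have hrr : 0 < r' - r := by linarith
    refine hd (AffineOnIcc.differentiableAt
      ⟨(gcm h r' - gcm h r) / (r' - r), fun t ht => ?_⟩ ⟨hrs, hsr'⟩)
    have htI : t ∈ Icc (0 : ℝ) 1 := ⟨hrI.1.trans ht.1, ht.2.trans hrI'.2⟩
    have key : (r' - r) * gcm h t = (r' - r) * gcm h r + (gcm h r' - gcm h r) * (t - r) := by
      refine le_antisymm ?_ ?_
      · linarith [hC.three_point hrI hrI' ht.1 ht.2]
      · rcases le_total t s with h' | h'
        · have e5 := hC.three_point htI hrI' h' hsr'.le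
          refine le_of_mul_le_mul_left (?_ : (r' - s) * _ ≤ (r' - s) * _) (by linarith)
          have e6 := mul_le_mul_of_nonneg_left e5 hrr.le
          have e7 : (r' - r) * ((r' - t) * gcm h s) =
            (r' - t) * ((r' - s) * gcm h r + (s - r) * gcm h r') := by rw [← e4]; ring
          linarith
        · have e5 := hC.three_point hrI htI hrs.le h'
          refine le_of_mul_le_mul_left (?_ : (s - r) * _ ≤ (s - r) * _) (by linarith)
          have e6 := mul_le_mul_of_nonneg_left e5 hrr.le
          have e7 : (r' - r) * ((t - r) * gcm h s) =
            (t - r) * ((r' - s) * gcm h r + (s - r) * gcm h r') := by rw [← e4]; ring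
          linarith
    field_simp
    linarith
  · intro hcond
    by_contra hk
    -- For a non-knot s, the two surrounding knots violate the strict inequality: their chord is the
    -- minorant itself, hence at most h s.
    have hL := H.knotLeft_spec hsI
    have hR := H.knotRight_spec s
    have hls : knotLeft (gcm h) s < s := lt_of_le_of_ne hL.2.1 fun h' => hk (h' ▸ hL.1)
    have hsr : s < knotRight (gcm h) s := hR.2.elim id fun h' => h' ▸ hs.2
    have e := hcond _ (H.knots_subset hL.1) _ (H.knots_subset hR.1) hls hsr
    have e2 := H.gcm_eq_interp hsI
    have e3 := gcm_le H.bdd hsI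
    have hne : knotRight (gcm h) s - knotLeft (gcm h) s ≠ 0 := by linarith
    have e4 : (knotRight (gcm h) s - knotLeft (gcm h) s) * gcm h s =
        (knotRight (gcm h) s - s) * h (knotLeft (gcm h) s) +
          (s - knotLeft (gcm h) s) * h (knotRight (gcm h) s) := by
      rw [e2]
      field_simp
      ring
    have := mul_le_mul_of_nonneg_left e3
      (by linarith : 0 ≤ knotRight (gcm h) s - knotLeft (gcm h) s)
    linarith

end IsStep

end TwoGroup

/-! ### Left-hand slopes of the minorant of a step function -/

namespace TwoGroup

namespace IsStep

variable {P : Finset ℝ} {h : ℝ → ℝ}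

/-- The last knot before `t`. -/
noncomputable def _root_.TwoGroup.knotBefore (C : ℝ → ℝ) (t : ℝ) : ℝ := sSup {s | s ∈ knots C ∧ s < t}

/-- The first knot from `t` on. -/
noncomputable def _root_.TwoGroup.knotFrom (C : ℝ → ℝ) (t : ℝ) : ℝ := sInf {s | s ∈ knots C ∧ t ≤ s}

/-- The strict inequality in `knotBefore` selects the affine piece to the left of t even if t is a
knot. The slope formula serves measurability; the touching point and the supporting line serve
positivity and consistency of the Grenander estimator. -/
theorem left_slope (H : IsStep P h) {t : ℝ} (ht : t ∈ Ioc (0 : ℝ) 1) :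
    ∃ m, m = (h (knotFrom (gcm h) t) - h (knotBefore (gcm h) t)) /
        (knotFrom (gcm h) t - knotBefore (gcm h) t) ∧
      HasDerivWithinAt (gcm h) m (Iic t) t ∧
      (∃ s ∈ Ico 0 t, gcm h s = gcm h t + m * (s - t)) ∧
      ∀ r ∈ Icc (0 : ℝ) 1, gcm h t + m * (r - t) ≤ gcm h r := by
  obtain ⟨hs1, hs2⟩ : knotBefore (gcm h) t ∈ {s | s ∈ knots (gcm h) ∧ s < t} :=
    Set.Nonempty.csSup_mem ⟨0, Or.inl rfl, ht.1⟩ (H.finite_knots.subset fun s hs => hs.1)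
  obtain ⟨hs3, hs4⟩ : knotFrom (gcm h) t ∈ {s | s ∈ knots (gcm h) ∧ t ≤ s} :=
    Set.Nonempty.csInf_mem ⟨1, Or.inr (Or.inl rfl), ht.2⟩
      (H.finite_knots.subset fun s hs => hs.1)
  have hk : ∀ k ∈ knots (gcm h), k ≤ knotBefore (gcm h) t ∨ knotFrom (gcm h) t ≤ k := by
    intro k hk
    rcases lt_or_ge k t with h1 | h1
    · exact Or.inl (le_csSup ((H.finite_knots.subset fun _ hs => hs.1).bddAbove) ⟨hk, h1⟩)
    · exact Or.inr (csInf_le ((H.finite_knots.subset fun _ hs => hs.1).bddBelow) ⟨hk, h1⟩)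
  have e1 := H.gcm_knot hs1
  have e2 := H.gcm_knot hs3
  have hsI := H.subset _ (H.knots_subset hs1)
  have hsI' := H.subset _ (H.knots_subset hs3)
  set s := knotBefore (gcm h) t
  set s' := knotFrom (gcm h) t
  have hss : s < s' := hs2.trans_le hs4
  obtain ⟨m, hm⟩ := H.affine_of_no_knot hsI.1 hss (H.knots_subset hs3) hk
  have em := hm s' ⟨hss.le, le_rfl⟩
  have et := hm t ⟨hs2.le, hs4⟩
  refine ⟨m, ?_, AffineOnIcc.hasDerivWithinAt_Iic hm ⟨hs2, hs4⟩, ⟨s, ⟨hsI.1, hs2⟩, ?_⟩, ?_⟩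
  · rw [← e1, ← e2, em, add_sub_cancel_left, mul_div_assoc, div_self (by linarith), mul_one]
  · rw [et]
    ring
  · intro r hr
    have hC := convexOn_gcm H.bdd
    have hd : 0 < s' - s := by linarith
    refine le_of_mul_le_mul_left (?_ : (s' - s) * _ ≤ (s' - s) * _) hd
    rw [et]
    rcases lt_or_ge r s with h1 | h1
    · have := hC.three_point hr hsI' h1.le hss.le
      rw [em] at this
      linarith
    rcases lt_or_ge s' r with h2 | h2
    · have := hC.three_point hsI hr hss.le h2.le
      rw [em] at this
      linarith
    · rw [hm r ⟨h1, h2⟩]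
      linarith

end IsStep

/-! ### Empirical averages for estimated local false discovery rates -/

section Empirical

variable {n : ℕ}

/-- The empirical mean of `(y - w)⁺`. -/
noncomputable def avgPos (w : Fin n → ℝ) (y : ℝ) : ℝ := (∑ i, max (y - w i) 0) / n

theorem count_nonneg (p : Fin n → Prop) [DecidablePred p] :
    (0 : ℝ) ≤ ∑ i, if p i then (1 : ℝ) else 0 :=
  Finset.sum_nonneg fun i _ => by split_ifs <;> norm_num

theorem count_eq_zero_or_one_le (p : Fin n → Prop) [DecidablePred p] :
    (∀ i, ¬ p i) ∨ (1 : ℝ) ≤ ∑ i, if p i then (1 : ℝ) else 0 := by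
  by_cases h : ∃ i, p i
  · right
    obtain ⟨i, hi⟩ := h
    refine le_trans ?_ (Finset.single_le_sum (f := fun i => if p i then (1 : ℝ) else 0)
      (fun i _ => by positivity) (Finset.mem_univ i))
    simp [hi]
  · exact Or.inl (not_exists.1 h)

theorem aHat_nonneg {w : Fin n → ℝ} (hw : ∀ i, 0 ≤ w i) (y : ℝ) : 0 ≤ aHat w y :=
  div_nonneg (Finset.sum_nonneg fun i _ => by split_ifs; exacts [hw i, le_rfl]) (by positivity)

theorem aHat_le (w : Fin n → ℝ) {y : ℝ} (hy : 0 ≤ y) : aHat w y ≤ y := by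
  unfold aHat
  rw [div_le_iff₀ (by positivity)]
  refine le_trans ?_ (mul_le_mul_of_nonneg_left (le_max_right _ _) hy)
  rw [Finset.mul_sum]
  refine Finset.sum_le_sum fun i _ => ?_
  split_ifs with h
  · linarith
  · simp

theorem bHat_nonneg {w : Fin n → ℝ} (hw : ∀ i, w i ≤ 1) (y : ℝ) : 0 ≤ bHat w y :=
  div_nonneg (Finset.sum_nonneg fun i _ => by split_ifs; exacts [by linarith [hw i], le_rfl])
    (by positivity)

theorem bHat_le (w : Fin n → ℝ) {y : ℝ} (hy : y ≤ 1) : bHat w y ≤ 1 - y := by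
  unfold bHat
  rw [div_le_iff₀ (by positivity)]
  refine le_trans ?_ (mul_le_mul_of_nonneg_left (le_max_right _ _) (by linarith))
  rw [Finset.mul_sum]
  refine Finset.sum_le_sum fun i _ => ?_
  split_ifs with h
  · linarith
  · simp

/-- Raising the cutoff adds terms larger than y to an average of terms at most y. -/
theorem aHat_mono {w : Fin n → ℝ} (hw : ∀ i, 0 ≤ w i) : Monotone (aHat w) := by
  intro y y' hyy
  rcases count_eq_zero_or_one_le (fun i => w i ≤ y) with h0 | h1
  · refine le_trans (le_of_eq ?_) (aHat_nonneg hw y')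
    simp [aHat, h0]
  have hc : ∑ i, (if w i ≤ y then (1 : ℝ) else 0) ≤ ∑ i, (if w i ≤ y' then (1 : ℝ) else 0) :=
    Finset.sum_le_sum fun i _ => by
      by_cases h : w i ≤ y
      · simp [h, h.trans hyy]
      · simp only [h, if_false]
        positivity
  have hS : ∑ i, (if w i ≤ y then w i else 0) ≤ y * ∑ i, (if w i ≤ y then (1 : ℝ) else 0) := by
    rw [Finset.mul_sum]
    exact Finset.sum_le_sum fun i _ => by split_ifs with h <;> simp [h]
  have hR : y * (∑ i, (if w i ≤ y' then (1 : ℝ) else 0) - ∑ i, (if w i ≤ y then (1 : ℝ) else 0)) ≤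
      ∑ i, (if w i ≤ y' then w i else 0) - ∑ i, (if w i ≤ y then w i else 0) := by
    rw [← Finset.sum_sub_distrib, ← Finset.sum_sub_distrib, Finset.mul_sum]
    refine Finset.sum_le_sum fun i _ => ?_
    by_cases h : w i ≤ y
    · simp [h, h.trans hyy]
    · by_cases h' : w i ≤ y'
      · simpa [h, h'] using (not_le.1 h).le
      · simp [h, h']
  unfold aHat
  rw [max_eq_right h1, max_eq_right (h1.trans hc)]
  set c := ∑ i, (if w i ≤ y then (1 : ℝ) else 0)
  set c' := ∑ i, (if w i ≤ y' then (1 : ℝ) else 0)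
  rw [div_le_div_iff₀ (by linarith) (by linarith)]
  nlinarith [mul_le_mul_of_nonneg_left hR (by linarith : 0 ≤ c),
    mul_le_mul_of_nonneg_left hS (by linarith : 0 ≤ c' - c)]

/-- Raising the cutoff to y' removes terms that are at least 1 - y' from an average whose remaining
terms are smaller. -/
theorem bHat_anti {w : Fin n → ℝ} (hw : ∀ i, w i ≤ 1) : Antitone (bHat w) := by
  intro y y' hyy
  rcases count_eq_zero_or_one_le (fun i => y' < w i) with h0 | h1
  · refine le_trans (le_of_eq ?_) (bHat_nonneg hw y)
    simp [bHat, h0]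
  have hc : ∑ i, (if y' < w i then (1 : ℝ) else 0) ≤ ∑ i, (if y < w i then (1 : ℝ) else 0) :=
    Finset.sum_le_sum fun i _ => by
      by_cases h : y' < w i
      · simp [h, hyy.trans_lt h]
      · simp only [h, if_false]
        positivity
  have hS : ∑ i, (if y' < w i then 1 - w i else 0) ≤
      (1 - y') * ∑ i, (if y' < w i then (1 : ℝ) else 0) := by
    rw [Finset.mul_sum]
    exact Finset.sum_le_sum fun i _ => by
      split_ifs with h
      · linarith
      · simp
  have hR : (1 - y') * (∑ i, (if y < w i then (1 : ℝ) else 0) -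
        ∑ i, (if y' < w i then (1 : ℝ) else 0)) ≤
      ∑ i, (if y < w i then 1 - w i else 0) - ∑ i, (if y' < w i then 1 - w i else 0) := by
    rw [← Finset.sum_sub_distrib, ← Finset.sum_sub_distrib, Finset.mul_sum]
    refine Finset.sum_le_sum fun i _ => ?_
    by_cases h : y' < w i
    · simp [h, hyy.trans_lt h]
    · by_cases h' : y < w i
      · simp only [h, h', if_true, if_false, sub_zero, mul_one]
        linarith [not_lt.1 h]
      · simp [h, h']
  unfold bHat
  rw [max_eq_right h1, max_eq_right (h1.trans hc)]
  set c := ∑ i, (if y' < w i then (1 : ℝ) else 0)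
  set c' := ∑ i, (if y < w i then (1 : ℝ) else 0)
  rw [div_le_div_iff₀ (by linarith) (by linarith)]
  nlinarith [mul_le_mul_of_nonneg_left hR (by linarith : 0 ≤ c),
    mul_le_mul_of_nonneg_left hS (by linarith : 0 ≤ c' - c)]

/-! ### The estimated cutoff and the step function `bStarHat` -/

variable {w : Fin n → ℝ}

theorem yStarHat_spec (w : Fin n → ℝ) {u : ℝ} (hu : 0 ≤ u) :
    (yStarHat w u = 0 ∨ ∃ i, yStarHat w u = w i) ∧ aHat w (yStarHat w u) ≤ u := by
  have hfin : {y | (y = 0 ∨ ∃ i, y = w i) ∧ aHat w y ≤ u}.Finite := by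
    refine ((finite_singleton (0 : ℝ)).union (finite_range w)).subset ?_
    rintro y ⟨rfl | ⟨i, rfl⟩, -⟩
    · exact Or.inl rfl
    · exact Or.inr ⟨i, rfl⟩
  -- The point 0 is always a candidate, so the finite supremum is attained.
  have hne : {y | (y = 0 ∨ ∃ i, y = w i) ∧ aHat w y ≤ u}.Nonempty :=
    ⟨0, Or.inl rfl, (aHat_le w le_rfl).trans hu⟩
  exact hne.csSup_mem hfin

theorem le_yStarHat (w : Fin n → ℝ) {u : ℝ} {i : Fin n} (hi : aHat w (w i) ≤ u) :
    w i ≤ yStarHat w u := by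
  have hfin : {y | (y = 0 ∨ ∃ i, y = w i) ∧ aHat w y ≤ u}.Finite := by
    refine ((finite_singleton (0 : ℝ)).union (finite_range w)).subset ?_
    rintro y ⟨rfl | ⟨i, rfl⟩, -⟩
    · exact Or.inl rfl
    · exact Or.inr ⟨i, rfl⟩
  exact le_csSup hfin.bddAbove ⟨Or.inr ⟨i, rfl⟩, hi⟩

theorem yStarHat_mem (hw : ∀ i, w i ∈ Icc (0 : ℝ) 1) {u : ℝ} (hu : 0 ≤ u) :
    yStarHat w u ∈ Icc (0 : ℝ) 1 := by
  rcases (yStarHat_spec w hu).1 with h | ⟨i, h⟩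
  · rw [h]
    simp
  · rw [h]
    exact hw i

theorem bStarHat_le (hw : ∀ i, w i ∈ Icc (0 : ℝ) 1) {u y : ℝ} (hy : y ∈ Icc (0 : ℝ) 1)
    (h : aHat w y ≤ u) : bStarHat w u ≤ bHat w y := by
  refine csInf_le ⟨0, ?_⟩ ⟨y, hy, h, rfl⟩
  rintro r ⟨z, -, -, rfl⟩
  exact bHat_nonneg (fun i => (hw i).2) z

/-- A feasible y above the estimated cutoff rejects nothing more: any w i ≤ y is itself a feasible
candidate by `aHat_mono`, hence at most the cutoff. Below the cutoff `bHat` is only larger. -/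
theorem bStarHat_eq (hw : ∀ i, w i ∈ Icc (0 : ℝ) 1) {u : ℝ} (hu : 0 ≤ u) :
    bStarHat w u = bHat w (yStarHat w u) := by
  refine le_antisymm (bStarHat_le hw (yStarHat_mem hw hu) (yStarHat_spec w hu).2) ?_
  refine le_csInf ⟨_, _, yStarHat_mem hw hu, (yStarHat_spec w hu).2, rfl⟩ ?_
  rintro r ⟨y, hy, hyu, rfl⟩
  rcases le_or_gt y (yStarHat w u) with h | h
  · exact bHat_anti (fun i => (hw i).2) h
  · have : ∀ i, y < w i ↔ yStarHat w u < w i := by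
      refine fun i => ⟨fun h' => h.trans h', fun h' => ?_⟩
      by_contra hc
      refine absurd (le_yStarHat w (u := u) (i := i) (le_trans ?_ hyu)) (not_le.2 h')
      exact aHat_mono (fun i => (hw i).1) (not_lt.1 hc)
    simp only [bHat, this, le_refl]

theorem bStarHat_anti (hw : ∀ i, w i ∈ Icc (0 : ℝ) 1) : AntitoneOn (bStarHat w) (Icc 0 1) := by
  intro u hu v hv huv
  rw [bStarHat_eq hw hu.1]
  exact bStarHat_le hw (yStarHat_mem hw hu.1) ((yStarHat_spec w hu.1).2.trans huv)

/-- The candidate jump points of `bStarHat w`. -/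
noncomputable def aPts (w : Fin n → ℝ) : Fin n ⊕ Bool → ℝ :=
  Sum.elim (fun i => aHat w (w i)) (fun b => if b then 1 else 0)

/-- The candidate jump points of the empirical distribution function on `[0,1]`. -/
noncomputable def xPts (x : Fin n → ℝ) : Fin n ⊕ Bool → ℝ := Sum.elim x (fun b => if b then 1 else 0)

/-- The cutoff chosen at level t is already feasible at the level `aHat` attains there, so the
function is constant from that level up to t. -/
theorem isStep_bStarHat (hw : ∀ i, w i ∈ Icc (0 : ℝ) 1) :
    IsStep (Finset.univ.image (aPts w)) (bStarHat w) where
  zero_mem := Finset.mem_image.2 ⟨Sum.inr false, Finset.mem_univ _, rfl⟩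
  one_mem := Finset.mem_image.2 ⟨Sum.inr true, Finset.mem_univ _, rfl⟩
  subset := by
    intro p hp
    obtain ⟨i | b, -, rfl⟩ := Finset.mem_image.1 hp
    · exact ⟨aHat_nonneg (fun i => (hw i).1) _, (aHat_le w (hw i).1).trans (hw i).2⟩
    · cases b <;> simp [aPts]
  anti := bStarHat_anti hw
  step := by
    intro t ht
    have h1 := yStarHat_spec w ht.1
    have h0 : 0 ≤ aHat w (yStarHat w t) := aHat_nonneg (fun i => (hw i).1) _
    refine ⟨aHat w (yStarHat w t), ?_, h1.2, le_antisymm ?_ ?_⟩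
    · rcases h1.1 with h | ⟨i, h⟩
      · refine Finset.mem_image.2 ⟨Sum.inr false, Finset.mem_univ _, ?_⟩
        rw [h]
        exact le_antisymm (aHat_nonneg (fun i => (hw i).1) _) (aHat_le w le_rfl)
      · refine Finset.mem_image.2 ⟨Sum.inl i, Finset.mem_univ _, ?_⟩
        rw [h]
        rfl
    · rw [bStarHat_eq hw ht.1]
      exact bStarHat_le hw (yStarHat_mem hw ht.1) le_rfl
    · exact bStarHat_anti hw ⟨h0, h1.2.trans ht.2⟩ ht h1.2

theorem ecdf_mono (x : Fin n → ℝ) : Monotone (ecdf x) := by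
  intro s t hst
  unfold ecdf
  gcongr with i
  by_cases h : x i ≤ s
  · simp [h, h.trans hst]
  · simp only [h, if_false]
    positivity

theorem isStep_ecdf {x : Fin n → ℝ} (hx : ∀ i, x i ∈ Ioo (0 : ℝ) 1) :
    IsStep (Finset.univ.image (xPts x)) (fun s => -ecdf x s) where
  zero_mem := Finset.mem_image.2 ⟨Sum.inr false, Finset.mem_univ _, rfl⟩
  one_mem := Finset.mem_image.2 ⟨Sum.inr true, Finset.mem_univ _, rfl⟩
  subset := by
    intro p hp
    obtain ⟨i | b, -, rfl⟩ := Finset.mem_image.1 hp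
    · exact ⟨(hx i).1.le, (hx i).2.le⟩
    · cases b <;> simp [xPts]
  anti := fun s _ t _ hst => neg_le_neg (ecdf_mono x hst)
  step := by
    intro t ht
    set Q := (Finset.univ.image (xPts x)).filter (· ≤ t) with hQ
    have hne : Q.Nonempty := ⟨0, Finset.mem_filter.2
      ⟨Finset.mem_image.2 ⟨Sum.inr false, Finset.mem_univ _, rfl⟩, ht.1⟩⟩
    obtain ⟨h1, h2⟩ := Finset.mem_filter.1 (Q.max'_mem hne)
    refine ⟨Q.max' hne, h1, h2, ?_⟩
    have : ∀ i, x i ≤ Q.max' hne ↔ x i ≤ t := fun i => ⟨fun h => h.trans h2, fun h =>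
      Q.le_max' _ (Finset.mem_filter.2 ⟨Finset.mem_image.2 ⟨Sum.inl i, Finset.mem_univ _, rfl⟩, h⟩)⟩
    simp only [ecdf, this]

end Empirical

/-! ### The Grenander estimator -/

section Grenander

variable {n : ℕ} {x : Fin n → ℝ}

/-- Greatest convex minorant of the negative empirical distribution function. -/
noncomputable def negMaj (x : Fin n → ℝ) : ℝ → ℝ := gcm (fun s => -ecdf x s)

theorem grenander_spec (hx : ∀ i, x i ∈ Ioo (0 : ℝ) 1) {t : ℝ} (ht : t ∈ Ioc (0 : ℝ) 1) :
    grenander x t = (ecdf x (knotFrom (negMaj x) t) - ecdf x (knotBefore (negMaj x) t)) /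
        (knotFrom (negMaj x) t - knotBefore (negMaj x) t) ∧
      (∃ s ∈ Ico 0 t, negMaj x s = negMaj x t - grenander x t * (s - t)) ∧
      ∀ r ∈ Icc (0 : ℝ) 1, negMaj x t - grenander x t * (r - t) ≤ negMaj x r := by
  obtain ⟨m, h1, h2, ⟨s, hs, h3⟩, h4⟩ := (isStep_ecdf hx).left_slope ht
  have hg : grenander x t = -m := by
    have : concMaj (ecdf x) = fun t => -negMaj x t := by
      funext t
      exact concMaj_eq_neg_gcm _ t
    rw [grenander, this]
    exact h2.neg.derivWithin (uniqueDiffWithinAt_Iic t)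
  refine ⟨?_, ⟨s, hs, ?_⟩, fun r hr => ?_⟩
  · rw [hg, h1, ← neg_div]
    congr 1
    simp only [negMaj]
    ring
  · rw [hg]
    unfold negMaj
    rw [h3]
    ring
  · rw [hg]
    have := h4 r hr
    unfold negMaj
    linarith

theorem grenander_anti (hx : ∀ i, x i ∈ Ioo (0 : ℝ) 1) {s t : ℝ} (hs : s ∈ Ioc (0 : ℝ) 1)
    (ht : t ∈ Ioc (0 : ℝ) 1) (hst : s ≤ t) : grenander x t ≤ grenander x s := by
  rcases hst.eq_or_lt with rfl | hst
  · exact le_rfl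
  have h1 := (grenander_spec hx hs).2.2 t ⟨ht.1.le, ht.2⟩
  have h2 := (grenander_spec hx ht).2.2 s ⟨hs.1.le, hs.2⟩
  refine le_of_mul_le_mul_left (?_ : (t - s) * _ ≤ (t - s) * _) (by linarith)
  linarith

theorem ecdf_le_one (x : Fin n → ℝ) (t : ℝ) : ecdf x t ≤ 1 := by
  unfold ecdf
  refine div_le_one_of_le₀ ?_ (by positivity)
  refine (Finset.sum_le_sum (g := fun _ => (1 : ℝ)) fun i _ => ?_).trans (by simp)
  split_ifs <;> norm_num

theorem ecdf_nonneg (x : Fin n → ℝ) (t : ℝ) : 0 ≤ ecdf x t :=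
  div_nonneg (count_nonneg _) (by positivity)

/-- Positivity holds at data points and makes division by the estimator harmless. If the majorant is
below 1 at t, it still has to rise to 1, and the supporting line at t has positive slope; otherwise
it must have risen just before t. -/
theorem grenander_pos (hx : ∀ i, x i ∈ Ioo (0 : ℝ) 1) (i : Fin n) : 0 < grenander x (x i) := by
  have hn : 0 < n := i.pos
  have hn' : (0 : ℝ) < n := by exact_mod_cast hn
  have hti := hx i
  set t := x i
  have htI : t ∈ Icc (0 : ℝ) 1 := ⟨hti.1.le, hti.2.le⟩
  have H := isStep_ecdf hx
  obtain ⟨-, ⟨s, hs, h3⟩, h4⟩ := grenander_spec hx (t := t) ⟨hti.1, hti.2.le⟩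
  have hlb : -1 ≤ negMaj x t := le_gcm (convexOn_const (-1) (convex_Icc 0 1))
    (fun s _ => neg_le_neg (ecdf_le_one x s)) htI
  have h1I : (1 : ℝ) ∈ Icc (0 : ℝ) 1 := right_mem_Icc.2 zero_le_one
  rcases hlb.eq_or_lt with heq | hlt
  -- The majorant equals 1 at t. To the left of t the observation x i = t is not yet counted, so the
  -- empirical distribution function is at most 1 - 1/n there. Hence this hinge function is a convex
  -- minorant; it exceeds -1 left of t, which makes the left slope positive.
  · have hconv : ConvexOn ℝ (Icc 0 1) (fun s : ℝ => -1 + max (1 / n * (t - s)) 0) := by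
      have h1 : ConvexOn ℝ (Icc (0 : ℝ) 1) (fun s => 1 / n * (t - s)) := by
        have := convexOn_affine (Icc 0 1) (convex_Icc 0 1) 0 (-(1 / n)) t
        refine this.congr fun s _ => ?_
        ring
      have := (h1.sup (convexOn_const 0 (convex_Icc 0 1))).add_const (-1)
      refine this.congr fun s _ => ?_
      simp only [Pi.add_apply, Pi.sup_apply]
      ring
    have hmin : ∀ s ∈ Icc (0 : ℝ) 1, -1 + max (1 / n * (t - s)) 0 ≤ -ecdf x s := by
      intro s hs
      rcases le_or_gt t s with h | h
      · rw [max_eq_right (mul_nonpos_of_nonneg_of_nonpos (by positivity) (by linarith))]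
        linarith [ecdf_le_one x s]
      · have e : ecdf x s + 1 / n ≤ 1 := by
          unfold ecdf
          rw [← add_div]
          refine div_le_one_of_le₀ ?_ hn'.le
          have : ∑ j, (if x j ≤ s then (1 : ℝ) else 0) + ∑ j, (if j = i then (1 : ℝ) else 0) ≤
              ∑ j : Fin n, (1 : ℝ) := by
            rw [← Finset.sum_add_distrib]
            refine Finset.sum_le_sum fun j _ => ?_
            by_cases hj : j = i
            · subst hj
              have h' : ¬ x j ≤ s := not_le.2 h
              simp [h']
            · simp only [hj, if_false, add_zero]
              split_ifs <;> norm_num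
          simpa using this
        have e2 : 1 / n * (t - s) ≤ 1 / (n : ℝ) :=
          mul_le_of_le_one_right (by positivity) (by linarith [hs.1, htI.2])
        have e3 : max (1 / n * (t - s)) 0 ≤ 1 / (n : ℝ) := max_le e2 (by positivity)
        linarith
    have h5 := le_gcm hconv hmin (t := s) ⟨hs.1, hs.2.le.trans htI.2⟩
    change _ ≤ negMaj x s at h5
    rw [h3, ← heq] at h5
    have h6 : 0 < 1 / (n : ℝ) * (t - s) := mul_pos (by positivity) (by linarith [hs.2])
    have h7 := le_max_left (1 / (n : ℝ) * (t - s)) 0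
    have h8 : 0 < grenander x t * (t - s) := by linarith
    exact pos_of_mul_pos_left h8 (by linarith [hs.2])
  · have h5 := h4 1 h1I
    have h6 : negMaj x 1 = -1 := by
      rw [negMaj, H.gcm_one]
      have : ∀ j, x j ≤ 1 := fun j => (hx j).2.le
      simp [ecdf, this, hn'.ne']
    rw [h6] at h5
    have h8 : 0 < grenander x t * (1 - t) := by linarith
    exact pos_of_mul_pos_left h8 (by linarith [hti.2])

theorem unifPdf_of_mem {t : ℝ} (ht : t ∈ Ioo (0 : ℝ) 1) : unifPdf t = 1 := by
  simp [unifPdf, ht]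

theorem wHat_eq {π₀ : ℝ} (hx : ∀ i, x i ∈ Ioo (0 : ℝ) 1) (i : Fin n) :
    wHat π₀ unifPdf x i = min (π₀ / grenander x (x i)) 1 := by
  rw [wHat, unifPdf_of_mem (hx i), mul_one]

theorem wHat_mem {π₀ : ℝ} (hπ : 0 < π₀) (hx : ∀ i, x i ∈ Ioo (0 : ℝ) 1) (i : Fin n) :
    wHat π₀ unifPdf x i ∈ Icc (0 : ℝ) 1 := by
  rw [wHat_eq hx]
  exact ⟨le_min (div_nonneg hπ.le (grenander_pos hx i).le) zero_le_one, min_le_right _ _⟩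

theorem wHat_mono {π₀ : ℝ} (hπ : 0 < π₀) (hx : ∀ i, x i ∈ Ioo (0 : ℝ) 1) {i j : Fin n}
    (hij : x i ≤ x j) : wHat π₀ unifPdf x i ≤ wHat π₀ unifPdf x j := by
  rw [wHat_eq hx, wHat_eq hx]
  refine min_le_min_right _ (div_le_div_of_nonneg_left hπ.le (grenander_pos hx j) ?_)
  exact grenander_anti hx ⟨(hx i).1, (hx i).2.le⟩ ⟨(hx j).1, (hx j).2.le⟩ hij

end Grenander

end TwoGroup

namespace TwoGroup

/-! ### Measurability of the procedure -/

section Measurability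

variable {Ω : Type*} [MeasurableSpace Ω]

/-- Split the space according to the finite set T of active indices; on each piece this is a
supremum over a fixed finite family. -/
theorem measurable_sSup_of_finite {ι : Type*} [Fintype ι] {f : ι → Ω → ℝ}
    (hf : ∀ j, Measurable (f j)) {R : ι → Ω → Prop} (hR : ∀ j, MeasurableSet {ω | R j ω}) :
    Measurable fun ω => sSup {s | ∃ j, R j ω ∧ s = f j ω} := by
  classical
  have hF : ∀ T : Finset ι, Measurable fun ω => ⨆ j : T, f j ω := fun T =>
    Measurable.iSup fun j => hf j
  have hT : ∀ T : Finset ι, MeasurableSet {ω | ∀ j, R j ω ↔ j ∈ T} := fun T => by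
    rw [ofPred_forall]
    refine MeasurableSet.iInter fun j => ?_
    by_cases hj : j ∈ T
    · simpa [hj] using hR j
    · simpa [hj, compl_ofPred] using (hR j).compl
  intro A hA
  have : (fun ω => sSup {s | ∃ j, R j ω ∧ s = f j ω}) ⁻¹' A =
      ⋃ T : Finset ι, {ω | ∀ j, R j ω ↔ j ∈ T} ∩ (fun ω => ⨆ j : T, f j ω) ⁻¹' A := by
    have key : ∀ (T : Finset ι) (ω : Ω), (∀ j, R j ω ↔ j ∈ T) →
        sSup {s | ∃ j, R j ω ∧ s = f j ω} = ⨆ j : T, f j ω := by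
      intro T ω h
      rw [iSup]
      congr 1
      ext s
      simp only [mem_ofPred_eq, h, mem_range, Subtype.exists]
      constructor
      · rintro ⟨j, hj, rfl⟩
        exact ⟨j, hj, rfl⟩
      · rintro ⟨j, hj, rfl⟩
        exact ⟨j, hj, rfl⟩
    ext ω
    simp only [mem_preimage, mem_iUnion, mem_inter_iff, mem_ofPred_eq]
    constructor
    · intro h
      refine ⟨Finset.univ.filter (fun j => R j ω), by simp, ?_⟩
      rwa [← key _ ω (by simp)]
    · rintro ⟨T, h1, h2⟩
      rwa [key T ω h1]
  rw [this]
  exact MeasurableSet.iUnion fun T => (hT T).inter (hF T hA)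

/-! ### Knots of random step functions -/

section StepFamily

variable {ι : Type*} [Fintype ι] {f : ι → Ω → ℝ} {h : Ω → ℝ → ℝ}

/-- `mem_knots_iff` reduces being a knot, a statement about the derivative of a supremum, to
finitely many inequalities between measurable functions. -/
theorem measurableSet_mem_knots [DecidableEq ℝ] (hf : ∀ j, Measurable (f j))
    (hh : ∀ j, Measurable fun ω => h ω (f j ω))
    (H : ∀ ω, IsStep (Finset.univ.image fun j => f j ω) (h ω)) (j : ι) :
    MeasurableSet {ω | f j ω ∈ knots (gcm (h ω))} := by
  have : {ω | f j ω ∈ knots (gcm (h ω))} = {ω | f j ω = 0} ∪ ({ω | f j ω = 1} ∪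
      ⋂ r, ⋂ r', ({ω | f r ω < f j ω}ᶜ ∪ ({ω | f j ω < f r' ω}ᶜ ∪
        {ω | (f r' ω - f r ω) * h ω (f j ω) <
          (f r' ω - f j ω) * h ω (f r ω) + (f j ω - f r ω) * h ω (f r' ω)}))) := by
    ext ω
    rw [mem_ofPred_eq, (H ω).mem_knots_iff (Finset.mem_image_of_mem _ (Finset.mem_univ j))]
    simp only [Finset.mem_image, Finset.mem_univ, true_and, forall_exists_index,
      forall_apply_eq_imp_iff, mem_union, mem_iInter, mem_ofPred_eq, mem_compl_iff,
      ← imp_iff_not_or]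
  rw [this]
  refine (measurableSet_eq_fun (hf j) measurable_const).union
    ((measurableSet_eq_fun (hf j) measurable_const).union
      (MeasurableSet.iInter fun r => MeasurableSet.iInter fun r' => ?_))
  refine (measurableSet_lt (hf r) (hf j)).compl.union
    ((measurableSet_lt (hf j) (hf r')).compl.union (measurableSet_lt ?_ ?_))
  · exact ((hf r').sub (hf r)).mul (hh j)
  · exact (((hf r').sub (hf j)).mul (hh r)).add (((hf j).sub (hf r)).mul (hh r'))

theorem measurable_sSup_knots [DecidableEq ℝ] (hf : ∀ j, Measurable (f j))
    (hh : ∀ j, Measurable fun ω => h ω (f j ω))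
    (H : ∀ ω, IsStep (Finset.univ.image fun j => f j ω) (h ω)) {Q : Ω → ℝ → Prop}
    (hQ : ∀ j, MeasurableSet {ω | Q ω (f j ω)}) :
    Measurable fun ω => sSup {s | s ∈ knots (gcm (h ω)) ∧ Q ω s} := by
  convert measurable_sSup_of_finite hf
    (R := fun j ω => f j ω ∈ knots (gcm (h ω)) ∧ Q ω (f j ω))
    (fun j => (measurableSet_mem_knots hf hh H j).inter (hQ j)) using 3 with ω
  ext s
  constructor
  · rintro ⟨h1, h2⟩
    obtain ⟨j, -, rfl⟩ := Finset.mem_image.1 ((H ω).knots_subset h1)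
    exact ⟨j, ⟨h1, h2⟩, rfl⟩
  · rintro ⟨j, h1, rfl⟩
    exact h1

theorem measurable_sInf_knots [DecidableEq ℝ] (hf : ∀ j, Measurable (f j))
    (hh : ∀ j, Measurable fun ω => h ω (f j ω))
    (H : ∀ ω, IsStep (Finset.univ.image fun j => f j ω) (h ω)) {Q : Ω → ℝ → Prop}
    (hQ : ∀ j, MeasurableSet {ω | Q ω (f j ω)}) :
    Measurable fun ω => sInf {s | s ∈ knots (gcm (h ω)) ∧ Q ω s} := by
  convert (measurable_sSup_of_finite (fun j => (hf j).neg)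
    (R := fun j ω => f j ω ∈ knots (gcm (h ω)) ∧ Q ω (f j ω))
    (fun j => (measurableSet_mem_knots hf hh H j).inter (hQ j))).neg using 2 with ω
  change _ = -sSup _
  rw [← Real.sInf_neg]
  congr 1
  ext s
  constructor
  · rintro ⟨h1, h2⟩
    obtain ⟨j, -, rfl⟩ := Finset.mem_image.1 ((H ω).knots_subset h1)
    exact ⟨j, ⟨h1, h2⟩, rfl⟩
  · rintro ⟨j, h1, h2⟩
    obtain rfl : s = f j ω := neg_injective h2
    exact h1

end StepFamily

variable {n : ℕ}

theorem measurable_count {p : Fin n → Ω → Prop} [∀ i ω, Decidable (p i ω)]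
    (hp : ∀ i, MeasurableSet {ω | p i ω}) {v : Fin n → Ω → ℝ} (hv : ∀ i, Measurable (v i)) :
    Measurable fun ω => ∑ i, if p i ω then v i ω else 0 :=
  Finset.measurable_sum _ fun i _ => Measurable.ite (hp i) (hv i) measurable_const

variable {w : Ω → Fin n → ℝ} {u : Ω → ℝ}

theorem measurable_ecdf (hw : ∀ i, Measurable fun ω => w ω i) (hu : Measurable u) :
    Measurable fun ω => ecdf (w ω) (u ω) :=
  (measurable_count (fun i => measurableSet_le (hw i) hu) fun _ => measurable_const).div_const _

theorem measurable_aHat (hw : ∀ i, Measurable fun ω => w ω i) (hu : Measurable u) :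
    Measurable fun ω => aHat (w ω) (u ω) :=
  (measurable_count (fun i => measurableSet_le (hw i) hu) hw).div
    (measurable_const.max
      (measurable_count (fun i => measurableSet_le (hw i) hu) fun _ => measurable_const))

theorem measurable_bHat (hw : ∀ i, Measurable fun ω => w ω i) (hu : Measurable u) :
    Measurable fun ω => bHat (w ω) (u ω) :=
  (measurable_count (fun i => measurableSet_lt hu (hw i))
    fun i => measurable_const.sub (hw i)).div
    (measurable_const.max
      (measurable_count (fun i => measurableSet_lt hu (hw i)) fun _ => measurable_const))

theorem measurable_yStarHat (hw : ∀ i, Measurable fun ω => w ω i) (hu : Measurable u) :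
    Measurable fun ω => yStarHat (w ω) (u ω) := by
  have hf : ∀ j : Option (Fin n), Measurable fun ω => j.elim 0 (w ω) := by
    rintro (_ | i)
    · exact measurable_const
    · exact hw i
  convert measurable_sSup_of_finite hf
    (R := fun j ω => aHat (w ω) (j.elim 0 (w ω)) ≤ u ω)
    (fun j => measurableSet_le (measurable_aHat hw (hf j)) hu) using 2 with ω
  change sSup _ = sSup _
  congr 1
  ext y
  constructor
  · rintro ⟨rfl | ⟨i, rfl⟩, h⟩
    · exact ⟨none, h, rfl⟩
    · exact ⟨some i, h, rfl⟩
  · rintro ⟨_ | i, h, rfl⟩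
    · exact ⟨Or.inl rfl, h⟩
    · exact ⟨Or.inr ⟨i, rfl⟩, h⟩

theorem measurable_thresholdRule (hw : ∀ i, Measurable fun ω => w ω i) (hu : Measurable u) :
    Measurable fun ω => thresholdRule (w ω) (u ω) := by
  refine measurable_pi_iff.2 fun i => ?_
  have : (fun ω => thresholdRule (w ω) (u ω) i) = fun ω => if w ω i ≤ u ω then true else false := by
    funext ω
    simp [thresholdRule]
  rw [this]
  exact Measurable.ite (measurableSet_le (hw i) hu) measurable_const measurable_const

theorem measurable_aPts (hw : ∀ i, Measurable fun ω => w ω i) (j : Fin n ⊕ Bool) :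
    Measurable fun ω => aPts (w ω) j := by
  rcases j with i | b
  · exact measurable_aHat hw (hw i)
  · exact measurable_const

theorem measurable_bStarHat (hw : ∀ i, Measurable fun ω => w ω i)
    (hwI : ∀ ω i, w ω i ∈ Icc (0 : ℝ) 1) (hu : Measurable u) (hu0 : ∀ ω, 0 ≤ u ω) :
    Measurable fun ω => bStarHat (w ω) (u ω) := by
  have : (fun ω => bStarHat (w ω) (u ω)) = fun ω => bHat (w ω) (yStarHat (w ω) (u ω)) :=
    funext fun ω => bStarHat_eq (hwI ω) (hu0 ω)
  rw [this]
  exact measurable_bHat hw (measurable_yStarHat hw hu)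

theorem measurable_knotLeft (hw : ∀ i, Measurable fun ω => w ω i)
    (hwI : ∀ ω i, w ω i ∈ Icc (0 : ℝ) 1) (α : ℝ) :
    Measurable fun ω => knotLeft (gcm (bStarHat (w ω))) α := by
  have hf := measurable_aPts hw
  have H := fun ω => isStep_bStarHat (hwI ω)
  refine measurable_sSup_knots hf (fun j => measurable_bStarHat hw hwI (hf j) fun ω =>
    ((H ω).subset _ (Finset.mem_image_of_mem _ (Finset.mem_univ j))).1) H
    (Q := fun _ s => s ≤ α ∧ s < 1) fun j => ?_
  exact (measurableSet_le (hf j) measurable_const).inter (measurableSet_lt (hf j) measurable_const)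

theorem measurable_knotRight (hw : ∀ i, Measurable fun ω => w ω i)
    (hwI : ∀ ω i, w ω i ∈ Icc (0 : ℝ) 1) (α : ℝ) :
    Measurable fun ω => knotRight (gcm (bStarHat (w ω))) α := by
  have hf := measurable_aPts hw
  have H := fun ω => isStep_bStarHat (hwI ω)
  refine measurable_sInf_knots hf (fun j => measurable_bStarHat hw hwI (hf j) fun ω =>
    ((H ω).subset _ (Finset.mem_image_of_mem _ (Finset.mem_univ j))).1) H
    (Q := fun _ s => α < s ∨ s = 1) fun j => ?_
  exact (measurableSet_lt measurable_const (hf j)).union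
    (measurableSet_eq_fun (hf j) measurable_const)

theorem measurable_adaptiveLaw (hw : ∀ i, Measurable fun ω => w ω i)
    (hwI : ∀ ω i, w ω i ∈ Icc (0 : ℝ) 1) (α : ℝ) : Measurable fun ω => adaptiveLaw (w ω) α := by
  have h1 := measurable_knotLeft hw hwI α
  have h2 := measurable_knotRight hw hwI α
  have hp : Measurable fun ω => (knotRight (gcm (bStarHat (w ω))) α - α) /
      (knotRight (gcm (bStarHat (w ω))) α - knotLeft (gcm (bStarHat (w ω))) α) :=
    (h2.sub_const α).div (h2.sub h1)
  refine Measure.measurable_of_measurable_coe _ fun s hs => ?_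
  simp only [adaptiveLaw, Measure.add_apply, Measure.smul_apply, smul_eq_mul,
    Measure.dirac_apply' _ hs]
  have hind : ∀ {v : Ω → ℝ}, Measurable v → Measurable fun ω =>
      s.indicator (1 : (Fin n → Bool) → ℝ≥0∞) (thresholdRule (w ω) (v ω)) := fun hv =>
    (measurable_one.indicator hs).comp (measurable_thresholdRule hw hv)
  exact (hp.ennreal_ofReal.mul (hind (measurable_yStarHat hw h1))).add
    ((hp.const_sub 1).ennreal_ofReal.mul (hind (measurable_yStarHat hw h2)))

theorem measurable_xPts {x : Ω → Fin n → ℝ} (hx : ∀ i, Measurable fun ω => x ω i)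
    (j : Fin n ⊕ Bool) : Measurable fun ω => xPts (x ω) j := by
  rcases j with i | b
  · exact hx i
  · exact measurable_const

/-- The derivative in the Grenander estimator is replaced by the slope between the two neighbouring
knots, which are measurable. -/
theorem measurable_wHat {x : Ω → Fin n → ℝ} (hx : ∀ i, Measurable fun ω => x ω i)
    (hxI : ∀ ω i, x ω i ∈ Ioo (0 : ℝ) 1) (π₀ : ℝ) (i : Fin n) :
    Measurable fun ω => wHat π₀ unifPdf (x ω) i := by
  have hf := measurable_xPts hx
  have H := fun ω => isStep_ecdf (hxI ω)
  have hh : ∀ j, Measurable fun ω => -ecdf (x ω) (xPts (x ω) j) := fun j =>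
    (measurable_ecdf hx (hf j)).neg
  have h1 : Measurable fun ω => knotBefore (negMaj (x ω)) (x ω i) :=
    measurable_sSup_knots hf hh H (Q := fun ω s => s < x ω i) fun j => measurableSet_lt (hf j) (hx i)
  have h2 : Measurable fun ω => knotFrom (negMaj (x ω)) (x ω i) :=
    measurable_sInf_knots hf hh H (Q := fun ω s => x ω i ≤ s) fun j => measurableSet_le (hx i) (hf j)
  have : (fun ω => wHat π₀ unifPdf (x ω) i) = fun ω => min (π₀ /
      ((ecdf (x ω) (knotFrom (negMaj (x ω)) (x ω i)) -
        ecdf (x ω) (knotBefore (negMaj (x ω)) (x ω i))) /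
        (knotFrom (negMaj (x ω)) (x ω i) - knotBefore (negMaj (x ω)) (x ω i)))) 1 := by
    funext ω
    rw [wHat_eq (hxI ω), (grenander_spec (hxI ω) ⟨(hxI ω i).1, (hxI ω i).2.le⟩).1]
  rw [this]
  exact (measurable_const.div (((measurable_ecdf hx h2).sub (measurable_ecdf hx h1)).div
    (h2.sub h1))).min measurable_const

end Measurability

/-- The adaptive rule has mass one. -/
theorem isProbabilityMeasure_adaptiveLaw {n : ℕ} {w : Fin n → ℝ} (hw : ∀ i, w i ∈ Icc (0 : ℝ) 1)
    {α : ℝ} (hα : α ∈ Icc (0 : ℝ) 1) : IsProbabilityMeasure (adaptiveLaw w α) := by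
  have H := isStep_bStarHat hw
  have h1 := (H.knotLeft_spec hα).2.1
  have h2 := H.le_knotRight hα
  have h3 := H.knotLeft_lt_knotRight hα
  refine ⟨?_⟩
  simp only [adaptiveLaw, Measure.add_apply, Measure.smul_apply, smul_eq_mul, measure_univ, mul_one]
  rw [← ENNReal.ofReal_add (div_nonneg (by linarith) (by linarith)), add_sub_cancel,
    ENNReal.ofReal_one]
  rw [sub_nonneg]
  exact div_le_one_of_le₀ (by linarith) (by linarith)

/-- Move points outside of `(0,1)` to `1/2`. -/
noncomputable def clampUnit {n : ℕ} (x : Fin n → ℝ) (i : Fin n) : ℝ :=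
  open Classical in if x i ∈ Ioo (0 : ℝ) 1 then x i else 1 / 2

theorem clampUnit_mem {n : ℕ} (x : Fin n → ℝ) (i : Fin n) : clampUnit x i ∈ Ioo (0 : ℝ) 1 := by
  unfold clampUnit
  split_ifs with h
  · exact h
  · norm_num

theorem clampUnit_of_mem {n : ℕ} {x : Fin n → ℝ} (hx : ∀ i, x i ∈ Ioo (0 : ℝ) 1) :
    clampUnit x = x := by
  funext i
  simp only [clampUnit, hx i, if_true]

theorem measurable_clampUnit {n : ℕ} (i : Fin n) : Measurable fun x : Fin n → ℝ => clampUnit x i :=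
  Measurable.ite (measurableSet_Ioo.preimage (measurable_pi_apply i)) (measurable_pi_apply i)
    measurable_const

/-- The data-driven procedure as a Markov kernel, for observations in `(0,1)`. -/
noncomputable def adaptiveKernel (π₀ : ℝ) (n : ℕ) (α : ℝ) (hπ : 0 < π₀) :
    Kernel (Fin n → ℝ) (Fin n → Bool) where
  toFun x := adaptiveRule π₀ unifPdf n α (clampUnit x)
  measurable' := measurable_adaptiveLaw
    (fun i => measurable_wHat measurable_clampUnit clampUnit_mem π₀ i)
    (fun x => wHat_mem hπ (clampUnit_mem x)) α

theorem adaptiveKernel_apply {π₀ : ℝ} (hπ : 0 < π₀) {n : ℕ} (α : ℝ) {x : Fin n → ℝ}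
    (hx : ∀ i, x i ∈ Ioo (0 : ℝ) 1) :
    adaptiveKernel π₀ n α hπ x = adaptiveRule π₀ unifPdf n α x := by
  change adaptiveRule π₀ unifPdf n α (clampUnit x) = _
  rw [clampUnit_of_mem hx]

theorem isMarkovKernel_adaptiveKernel {π₀ : ℝ} (hπ : 0 < π₀) (n : ℕ) {α : ℝ}
    (hα : α ∈ Icc (0 : ℝ) 1) : IsMarkovKernel (adaptiveKernel π₀ n α hπ) :=
  ⟨fun x => isProbabilityMeasure_adaptiveLaw (wHat_mem hπ (clampUnit_mem x)) hα⟩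

end TwoGroup

namespace TwoGroup

/-! ### The limiting trade-off curve -/

/-- `G` is the distribution function of a law on `(0,1)` and `φ` its primitive. -/
structure IsCurve (φ G : ℝ → ℝ) : Prop where
  mono : Monotone G
  cont : Continuous G
  zero : ∀ y ≤ 0, G y = 0
  one : G 1 = 1
  bound : ∀ y, G y ≤ 1
  pos : ∀ y, 0 < y → 0 < G y
  lt_one : ∀ y, y < 1 → G y < 1
  phi_zero : φ 0 = 0
  slope_le : ∀ y γ, 0 ≤ γ → γ * G y ≤ φ (y + γ) - φ y
  le_slope : ∀ y γ, 0 ≤ γ → φ (y + γ) - φ y ≤ γ * G (y + γ)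

/-- Limit of `aHat`. -/
noncomputable def curveA (φ G : ℝ → ℝ) (y : ℝ) : ℝ := (y * G y - φ y) / G y

/-- Limit of `bHat`. -/
noncomputable def curveB (φ G : ℝ → ℝ) (y : ℝ) : ℝ := (φ 1 - φ y - (1 - y) * G y) / (1 - G y)

/-- Limit of `bStarHat`. -/
noncomputable def curveBStar (φ G : ℝ → ℝ) (u : ℝ) : ℝ :=
  sInf {r | ∃ y ∈ Icc (0 : ℝ) 1, curveA φ G y ≤ u ∧ r = curveB φ G y}

/-- The optimal trade-off between the error rates. -/
noncomputable def curveC (φ G : ℝ → ℝ) : ℝ → ℝ := gcm (curveBStar φ G)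

namespace IsCurve

variable {φ G : ℝ → ℝ}

theorem nonneg (hc : IsCurve φ G) (y : ℝ) : 0 ≤ G y := by
  rcases le_or_gt y 0 with h | h
  · exact (hc.zero y h).ge
  · exact (hc.pos y h).le

theorem le_one (hc : IsCurve φ G) {y : ℝ} (hy : y ≤ 1) : G y ≤ 1 := hc.one ▸ hc.mono hy

theorem H_nonneg (hc : IsCurve φ G) {y : ℝ} (hy : 0 ≤ y) : 0 ≤ y * G y - φ y := by
  have := hc.le_slope 0 y hy
  rw [zero_add, hc.phi_zero] at this
  linarith

theorem phi_nonneg (hc : IsCurve φ G) {y : ℝ} (hy : 0 ≤ y) : 0 ≤ φ y := by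
  have := hc.slope_le 0 y hy
  rw [zero_add, hc.phi_zero, hc.zero 0 le_rfl] at this
  linarith

theorem K_nonneg (hc : IsCurve φ G) {y : ℝ} (hy : y ≤ 1) : 0 ≤ φ 1 - φ y - (1 - y) * G y := by
  have := hc.slope_le y (1 - y) (by linarith)
  rw [add_sub_cancel] at this
  linarith

theorem K_le (hc : IsCurve φ G) {y : ℝ} (hy : y ≤ 1) :
    φ 1 - φ y - (1 - y) * G y ≤ (1 - y) * (1 - G y) := by
  have := hc.le_slope y (1 - y) (by linarith)
  rw [add_sub_cancel, hc.one] at this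
  linarith

theorem A_nonneg (hc : IsCurve φ G) {y : ℝ} (hy : 0 ≤ y) : 0 ≤ curveA φ G y :=
  div_nonneg (hc.H_nonneg hy) (hc.nonneg y)

theorem A_le (hc : IsCurve φ G) {y : ℝ} (hy : 0 ≤ y) : curveA φ G y ≤ y :=
  div_le_of_le_mul₀ (hc.nonneg y) hy (by linarith [hc.phi_nonneg hy])

theorem B_nonneg (hc : IsCurve φ G) {y : ℝ} (hy : y ≤ 1) : 0 ≤ curveB φ G y :=
  div_nonneg (hc.K_nonneg hy) (by linarith [hc.le_one hy])

theorem B_le (hc : IsCurve φ G) {y : ℝ} (hy : y ≤ 1) : curveB φ G y ≤ 1 - y :=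
  div_le_of_le_mul₀ (by linarith [hc.le_one hy]) (by linarith) (hc.K_le hy)

theorem A_mul (hc : IsCurve φ G) {y : ℝ} (hy : 0 < y) : curveA φ G y * G y = y * G y - φ y :=
  div_mul_cancel₀ _ (hc.pos y hy).ne'

theorem B_mul (hc : IsCurve φ G) {y : ℝ} (hy : y < 1) :
    curveB φ G y * (1 - G y) = φ 1 - φ y - (1 - y) * G y :=
  div_mul_cancel₀ _ (by linarith [hc.lt_one y hy])

theorem bStar_le (hc : IsCurve φ G) {u y : ℝ} (hy : y ∈ Icc (0 : ℝ) 1) (h : curveA φ G y ≤ u) :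
    curveBStar φ G u ≤ curveB φ G y := by
  refine csInf_le ⟨0, ?_⟩ ⟨y, hy, h, rfl⟩
  rintro r ⟨z, hz, -, rfl⟩
  exact hc.B_nonneg hz.2

theorem le_bStar (hc : IsCurve φ G) {u m : ℝ} (hu : 0 ≤ u)
    (h : ∀ y ∈ Icc (0 : ℝ) 1, curveA φ G y ≤ u → m ≤ curveB φ G y) : m ≤ curveBStar φ G u := by
  refine le_csInf ⟨_, 0, left_mem_Icc.2 zero_le_one, (hc.A_le le_rfl).trans hu, rfl⟩ ?_
  rintro r ⟨y, hy, hyu, rfl⟩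
  exact h y hy hyu

theorem bStar_anti (hc : IsCurve φ G) : AntitoneOn (curveBStar φ G) (Icc 0 1) :=
  fun _ hu _ _ huv => hc.le_bStar hu.1 fun _ hy h => hc.bStar_le hy (h.trans huv)

theorem bStar_nonneg (hc : IsCurve φ G) {u : ℝ} (hu : 0 ≤ u) : 0 ≤ curveBStar φ G u :=
  hc.le_bStar hu fun _ hy _ => hc.B_nonneg hy.2

theorem bStar_bdd (hc : IsCurve φ G) : ∃ m, ∀ s ∈ Icc (0 : ℝ) 1, m ≤ curveBStar φ G s :=
  ⟨0, fun _ hs => hc.bStar_nonneg hs.1⟩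

theorem convexOn_C (hc : IsCurve φ G) : ConvexOn ℝ (Icc 0 1) (curveC φ G) :=
  convexOn_gcm hc.bStar_bdd

theorem anti_C (hc : IsCurve φ G) : AntitoneOn (curveC φ G) (Icc 0 1) :=
  antitoneOn_gcm hc.bStar_anti

theorem C_nonneg (hc : IsCurve φ G) {u : ℝ} (hu : u ∈ Icc (0 : ℝ) 1) : 0 ≤ curveC φ G u :=
  le_gcm (convexOn_const 0 (convex_Icc 0 1)) (fun _ hs => hc.bStar_nonneg hs.1) hu

theorem C_le_B (hc : IsCurve φ G) {u y : ℝ} (hu : u ∈ Icc (0 : ℝ) 1) (hy : y ∈ Icc (0 : ℝ) 1)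
    (h : curveA φ G y ≤ u) : curveC φ G u ≤ curveB φ G y :=
  (gcm_le hc.bStar_bdd hu).trans (hc.bStar_le hy h)

theorem B_zero (hc : IsCurve φ G) : curveB φ G 0 = φ 1 := by
  simp [curveB, hc.phi_zero, hc.zero 0 le_rfl]

theorem C_le (hc : IsCurve φ G) {u : ℝ} (hu : u ∈ Icc (0 : ℝ) 1) : curveC φ G u ≤ φ 1 :=
  (hc.C_le_B hu (left_mem_Icc.2 zero_le_one) ((hc.A_le le_rfl).trans hu.1)).trans hc.B_zero.le

theorem C_one (hc : IsCurve φ G) : curveC φ G 1 = 0 := by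
  have h1 : (1 : ℝ) ∈ Icc (0 : ℝ) 1 := right_mem_Icc.2 zero_le_one
  refine le_antisymm ?_ (hc.C_nonneg h1)
  refine (hc.C_le_B h1 h1 (hc.A_le zero_le_one)).trans ?_
  simpa using hc.B_le le_rfl

/-- The quantity is the integral of G y - G over [0, y], and G z < G y for z near 0 by continuity.
Thus `curveA` vanishes only in the limit y → 0. -/
theorem H_pos (hc : IsCurve φ G) {y : ℝ} (hy : 0 < y) : 0 < y * G y - φ y := by
  have h1 : ∀ᶠ z in 𝓝[>] (0 : ℝ), G z < G y := by
    have := (hc.cont.tendsto 0).eventually (gt_mem_nhds (by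
      rw [hc.zero 0 le_rfl]
      exact hc.pos y hy))
    exact this.filter_mono nhdsWithin_le_nhds
  obtain ⟨z, hz, hz0, hzy⟩ := (h1.and (Ioo_mem_nhdsGT hy)).exists
  have h2 := hc.le_slope 0 z hz0.le
  have h3 := hc.le_slope z (y - z) (by linarith)
  rw [zero_add, hc.phi_zero] at h2
  rw [add_sub_cancel] at h3
  have := mul_lt_mul_of_pos_left hz hz0
  linarith

theorem H_mono (hc : IsCurve φ G) {y z : ℝ} (hy : 0 ≤ y) (hyz : y ≤ z) :
    y * G y - φ y ≤ z * G z - φ z := by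
  have := hc.le_slope y (z - y) (by linarith)
  rw [add_sub_cancel] at this
  have := mul_le_mul_of_nonneg_left (hc.mono hyz) hy
  linarith

/-- A small level forces a small y, since y G y - φ y is increasing, positive and at most `curveA`;
for small y the value of `curveB` is close to φ 1. -/
theorem bStar_near_zero (hc : IsCurve φ G) {ε : ℝ} (hε : 0 < ε) :
    ∃ u₀ > 0, ∀ u ∈ Icc (0 : ℝ) u₀, φ 1 - ε ≤ curveBStar φ G u := by
  have hcont : ∀ᶠ y in 𝓝[>] (0 : ℝ), G y < ε / 2 := by
    have := (hc.cont.tendsto 0).eventually (gt_mem_nhds (by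
      rw [hc.zero 0 le_rfl]
      exact half_pos hε))
    exact this.filter_mono nhdsWithin_le_nhds
  obtain ⟨y₀, hG, hy0, hy1⟩ := (hcont.and (Ioo_mem_nhdsGT (zero_lt_one' ℝ))).exists
  have hH := hc.H_pos hy0
  refine ⟨(y₀ * G y₀ - φ y₀) / 2, half_pos hH, fun u hu => hc.le_bStar hu.1 fun y hy hyu => ?_⟩
  rcases le_or_gt y y₀ with h | h
  · have hGy : G y < ε / 2 := (hc.mono h).trans_lt hG
    have hφ : φ y ≤ y * G y := by linarith [hc.H_nonneg hy.1]
    have h1 : y * G y ≤ G y := mul_le_of_le_one_left (hc.nonneg y) hy.2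
    have hK : φ 1 - ε ≤ φ 1 - φ y - (1 - y) * G y := by linarith [hφ, h1, hc.nonneg y]
    refine hK.trans ((le_div_iff₀ ?_).2 ?_)
    · linarith [hc.lt_one y (h.trans_lt hy1)]
    · exact mul_le_of_le_one_right (hc.K_nonneg hy.2) (by linarith [hc.nonneg y])
  · exfalso
    have h2 := hc.H_mono hy0.le h.le
    have h3 : y * G y - φ y ≤ curveA φ G y :=
      (hc.A_mul (hy0.trans h)).symm.le.trans
        (mul_le_of_le_one_right (hc.A_nonneg hy.1) (hc.le_one hy.2))
    linarith [hu.2]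

/-- Right-continuity at 0, where a convex function could jump down. A line starting at φ 1 - ε/2 and
steep enough to be negative past u₀ is a convex minorant. -/
theorem C_near_zero (hc : IsCurve φ G) {ε : ℝ} (hε : 0 < ε) :
    ∃ η > 0, ∀ u ∈ Icc (0 : ℝ) 1, u ≤ η → φ 1 - ε ≤ curveC φ G u := by
  obtain ⟨u₀, hu₀, h⟩ := hc.bStar_near_zero (half_pos hε)
  have hφ := hc.phi_nonneg zero_le_one
  set m := φ 1 / u₀ with hm
  have hm0 : 0 ≤ m := div_nonneg hφ hu₀.le
  refine ⟨ε / 2 / (m + 1), by positivity, fun u hu huη => ?_⟩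
  have := le_gcm (h := curveBStar φ G)
    (convexOn_affine _ (convex_Icc 0 1) (φ 1 - ε / 2) (-m) 0) (fun s hs => ?_) hu
  · refine le_trans ?_ this
    rw [le_div_iff₀ (by linarith)] at huη
    linarith [hu.1]
  · rcases le_or_gt s u₀ with h1 | h1
    · have h3 := h s ⟨hs.1, h1⟩
      have h4 := mul_nonneg hm0 hs.1
      linarith
    · have h3 := hc.bStar_nonneg hs.1
      have h4 := mul_le_mul_of_nonneg_left h1.le hm0
      rw [hm, div_mul_cancel₀ _ hu₀.ne', ← hm] at h4
      linarith

theorem C_zero (hc : IsCurve φ G) : curveC φ G 0 = φ 1 := by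
  have h0 : (0 : ℝ) ∈ Icc (0 : ℝ) 1 := left_mem_Icc.2 zero_le_one
  refine le_antisymm (hc.C_le h0) (le_of_forall_pos_sub_le fun ε hε => ?_)
  obtain ⟨η, hη, h⟩ := hc.C_near_zero hε
  exact h 0 h0 hη.le

/-- A convex decreasing function drops most at the left end: C s - C t ≤ C 0 - C (t - s). Continuity
at 0 therefore gives a uniform modulus. -/
theorem C_modulus (hc : IsCurve φ G) {ε : ℝ} (hε : 0 < ε) :
    ∃ η > 0, ∀ s ∈ Icc (0 : ℝ) 1, ∀ t ∈ Icc (0 : ℝ) 1, t ≤ s + η →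
      curveC φ G s ≤ curveC φ G t + ε := by
  obtain ⟨η, hη, h⟩ := hc.C_near_zero hε
  refine ⟨η, hη, fun s hs t ht hst => ?_⟩
  rcases le_or_gt t s with hts | hts
  · linarith [hc.anti_C ht hs hts]
  have h0 : (0 : ℝ) ∈ Icc (0 : ℝ) 1 := left_mem_Icc.2 zero_le_one
  have hd : t - s ∈ Icc (0 : ℝ) 1 := ⟨by linarith, by linarith [hs.1, ht.2]⟩
  have h1 := h (t - s) hd (by linarith)
  rw [← hc.C_zero] at h1
  have h2 := hc.convexOn_C.three_point h0 ht hs.1 hts.le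
  have h3 := hc.convexOn_C.three_point h0 ht hd.1 (by linarith [hs.1] : t - s ≤ t)
  have h4 : t * (curveC φ G s + curveC φ G (t - s)) ≤ t * (curveC φ G 0 + curveC φ G t) := by
    linarith
  have := le_of_mul_le_mul_left h4 (by linarith [hs.1])
  linarith

end IsCurve

/-! ### Empirical versions of the trade-off curve -/

section Empirical

variable {n : ℕ} {w : Fin n → ℝ}

/-- The same two inequalities as the fields of `IsCurve`: the pair (`avgPos`, `ecdf`) is treated
like (φ, G). -/
theorem avgPos_slope (w : Fin n → ℝ) (y : ℝ) {γ : ℝ} (hγ : 0 ≤ γ) :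
    γ * ecdf w y ≤ avgPos w (y + γ) - avgPos w y ∧
      avgPos w (y + γ) - avgPos w y ≤ γ * ecdf w (y + γ) := by
  unfold avgPos ecdf
  rw [← sub_div, ← Finset.sum_sub_distrib, ← mul_div_assoc, ← mul_div_assoc, Finset.mul_sum,
    Finset.mul_sum]
  constructor
  · gcongr with i
    split_ifs with h
    · rw [max_eq_left (by linarith), max_eq_left (by linarith)]
      linarith
    · rw [mul_zero, sub_nonneg]
      exact max_le_max_right _ (by linarith)
  · gcongr with i
    split_ifs with h
    · rw [max_eq_left (by linarith : 0 ≤ y + γ - w i)]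
      linarith [le_max_left (y - w i) 0]
    · rw [max_eq_right (by linarith), max_eq_right (by linarith)]
      simp

/-- In this product form the identity also holds when nothing is rejected, both sides being 0. -/
theorem aHat_mul_ecdf (hn : 0 < n) (w : Fin n → ℝ) (y : ℝ) :
    aHat w y * ecdf w y = y * ecdf w y - avgPos w y := by
  have hn' : (n : ℝ) ≠ 0 := by exact_mod_cast hn.ne'
  have hS : ∑ i, (if w i ≤ y then w i else 0) =
      y * ∑ i, (if w i ≤ y then (1 : ℝ) else 0) - ∑ i, max (y - w i) 0 := by
    rw [Finset.mul_sum, ← Finset.sum_sub_distrib]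
    refine Finset.sum_congr rfl fun i _ => ?_
    split_ifs with h
    · rw [max_eq_left (by linarith)]
      ring
    · rw [max_eq_right (by linarith)]
      ring
  have hA : aHat w y * ∑ i, (if w i ≤ y then (1 : ℝ) else 0) =
      ∑ i, (if w i ≤ y then w i else 0) := by
    rcases count_eq_zero_or_one_le (fun i => w i ≤ y) with h | h
    · simp [h]
    · rw [aHat, max_eq_right h, div_mul_cancel₀ _ (by linarith)]
  unfold ecdf avgPos
  rw [← mul_div_assoc, hA, hS, sub_div, mul_div_assoc]

theorem bHat_mul_ecdf (hn : 0 < n) (hw : ∀ i, w i ≤ 1) (y : ℝ) :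
    bHat w y * (1 - ecdf w y) = avgPos w 1 - avgPos w y - (1 - y) * ecdf w y := by
  have hn' : (n : ℝ) ≠ 0 := by exact_mod_cast hn.ne'
  have h1 : 1 - ecdf w y = (∑ i, if y < w i then (1 : ℝ) else 0) / n := by
    unfold ecdf
    rw [eq_div_iff hn', sub_mul, div_mul_cancel₀ _ hn', sub_eq_iff_eq_add,
      ← Finset.sum_add_distrib, one_mul]
    have : ∀ i : Fin n, (if y < w i then (1 : ℝ) else 0) + (if w i ≤ y then (1 : ℝ) else 0) = 1 := by
      intro i
      by_cases h : w i ≤ y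
      · simp [h, not_lt.2 h]
      · simp [h, not_le.1 h]
    simp [this]
  have hS : ∑ i, (if y < w i then 1 - w i else 0) =
      ∑ i, max (1 - w i) 0 - ∑ i, max (y - w i) 0 -
        (1 - y) * ∑ i, (if w i ≤ y then (1 : ℝ) else 0) := by
    rw [Finset.mul_sum, ← Finset.sum_sub_distrib, ← Finset.sum_sub_distrib]
    refine Finset.sum_congr rfl fun i _ => ?_
    rw [max_eq_left (by linarith [hw i])]
    by_cases h : w i ≤ y
    · rw [max_eq_left (by linarith)]
      simp only [h, not_lt.2 h, if_true, if_false]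
      ring
    · rw [max_eq_right (by linarith)]
      simp only [h, not_le.1 h, if_true, if_false]
      ring
  have hB : bHat w y * ∑ i, (if y < w i then (1 : ℝ) else 0) =
      ∑ i, (if y < w i then 1 - w i else 0) := by
    rcases count_eq_zero_or_one_le (fun i => y < w i) with h | h
    · simp [h]
    · rw [bHat, max_eq_right h, div_mul_cancel₀ _ (by linarith)]
  rw [h1, ← mul_div_assoc, hB, hS]
  unfold ecdf avgPos
  rw [sub_div, sub_div, mul_div_assoc]

variable {φ G : ℝ → ℝ}

/-- The empirical law of `w` is uniformly within `δ` of the limit. -/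
def Near (φ : ℝ → ℝ) (δ : ℝ) (w : Fin n → ℝ) : Prop := ∀ y, |avgPos w y - φ y| ≤ δ

theorem Near.mono {δ δ' : ℝ} (h : Near φ δ w) (hδ : δ ≤ δ') : Near φ δ' w :=
  fun y => (h y).trans hδ

/-- Closeness of convex functions passes to derivatives when the limiting derivative is continuous:
compare difference quotients over a window of length γ. -/
theorem IsCurve.ecdf_near (hc : IsCurve φ G) {ε : ℝ} (hε : 0 < ε) :
    ∃ δ > 0, ∀ (n : ℕ) (w : Fin n → ℝ), Near φ δ w →
      ∀ y ∈ Icc (0 : ℝ) 1, |ecdf w y - G y| ≤ ε := by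
  have huc := (isCompact_Icc (a := (-1 : ℝ)) (b := 2)).uniformContinuousOn_of_continuous
    hc.cont.continuousOn
  rw [Metric.uniformContinuousOn_iff] at huc
  obtain ⟨γ', hγ', hG⟩ := huc (ε / 2) (half_pos hε)
  set γ := min (γ' / 2) 1 with hγd
  have hγ : 0 < γ := lt_min (half_pos hγ') one_pos
  have hγ1 : γ ≤ 1 := min_le_right _ _
  have hγγ : γ < γ' := (min_le_left _ _).trans_lt (half_lt_self hγ')
  -- Two errors γε/4 divided by γ give ε/2; the other ε/2 is the oscillation of G over the window.
  refine ⟨γ * ε / 4, by positivity, fun n w hw y hy => ?_⟩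
  have e1 := abs_le.1 (hw y)
  have e2 := abs_le.1 (hw (y + γ))
  have e3 := abs_le.1 (hw (y - γ))
  have hyI : y ∈ Icc (-1 : ℝ) 2 := ⟨by linarith [hy.1], by linarith [hy.2]⟩
  have g1 := hG (y + γ) ⟨by linarith [hy.1], by linarith [hy.2]⟩ y hyI
    (by rw [Real.dist_eq, add_sub_cancel_left, abs_of_pos hγ]; exact hγγ)
  have g2 := hG (y - γ) ⟨by linarith [hy.1], by linarith [hy.2]⟩ y hyI
    (by rw [Real.dist_eq, sub_sub_cancel_left, abs_neg, abs_of_pos hγ]; exact hγγ)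
  rw [Real.dist_eq] at g1 g2
  have g1' := (abs_lt.1 g1).2
  have g2' := (abs_lt.1 g2).1
  have s1 := (avgPos_slope w y hγ.le).1
  have s2 := (avgPos_slope w (y - γ) hγ.le).2
  have s3 := hc.le_slope y γ hγ.le
  have s4 := hc.slope_le (y - γ) γ hγ.le
  rw [sub_add_cancel] at s2 s4
  rw [abs_le]
  constructor
  · refine le_of_mul_le_mul_left (?_ : γ * _ ≤ γ * _) hγ
    have := mul_le_mul_of_nonneg_left g2'.le hγ.le
    linarith
  · refine le_of_mul_le_mul_left (?_ : γ * _ ≤ γ * _) hγ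
    have := mul_le_mul_of_nonneg_left g1'.le hγ.le
    linarith

/-- Away from the end points the denominators are bounded below by g, and at most five errors of
size εg/6 occur. Near an end point the trivial bounds `aHat` ≤ y and `bHat` ≤ 1 - y suffice, as only
upper bounds are claimed. -/
theorem IsCurve.hat_near (hc : IsCurve φ G) {ε : ℝ} (hε : 0 < ε) :
    ∃ δ > 0, ∀ (n : ℕ) (w : Fin n → ℝ), 0 < n → (∀ i, w i ∈ Icc (0 : ℝ) 1) → Near φ δ w →
      ∀ y ∈ Icc (0 : ℝ) 1, aHat w y ≤ curveA φ G y + ε ∧ bHat w y ≤ curveB φ G y + ε := by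
  wlog hε1 : ε ≤ 1 generalizing ε
  · obtain ⟨δ, hδ, h⟩ := this one_pos le_rfl
    refine ⟨δ, hδ, fun n w hn hw hN y hy => ?_⟩
    have := h n w hn hw hN y hy
    constructor <;> linarith
  have hg := hc.pos ε hε
  have hg' : 0 < 1 - G (1 - ε) := by linarith [hc.lt_one (1 - ε) (by linarith)]
  set g := min (G ε) (1 - G (1 - ε)) with hgd
  have hg0 : 0 < g := lt_min hg hg'
  have hg1 : g ≤ 1 := (min_le_left _ _).trans (hc.le_one hε1)
  obtain ⟨δ, hδ, hE⟩ := hc.ecdf_near (ε := ε * g / 6) (by positivity)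
  refine ⟨min δ (ε * g / 6), lt_min hδ (by positivity), fun n w hn hw hN y hy => ⟨?_, ?_⟩⟩
  · rcases le_or_gt y ε with h | h
    · linarith [aHat_le w hy.1, hc.A_nonneg hy.1]
    have e1 := abs_le.1 (hE n w (hN.mono (min_le_left _ _)) y hy)
    have e2 := abs_le.1 ((hN y).trans (min_le_right _ _))
    have hGy : g ≤ G y := (min_le_left _ _).trans (hc.mono h.le)
    have hεg : ε * g ≤ g := mul_le_of_le_one_left hg0.le hε1
    have hpos : 0 < ecdf w y := by linarith
    refine le_of_mul_le_mul_right (?_ : _ * ecdf w y ≤ _ * ecdf w y) hpos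
    rw [aHat_mul_ecdf hn]
    have hA0 := hc.A_nonneg hy.1
    have hA1 := (hc.A_le hy.1).trans hy.2
    have hA := hc.A_mul (hε.trans h)
    have m1 := mul_le_mul_of_nonneg_left e1.1 (by linarith : 0 ≤ curveA φ G y + ε)
    have m2 := mul_le_mul_of_nonneg_left hGy hε.le
    have m3 : y * (ecdf w y - G y) ≤ ε * g / 6 := by
      refine (mul_le_mul_of_nonneg_left e1.2 hy.1).trans ?_
      exact mul_le_of_le_one_left (by positivity) hy.2
    have m4 : (curveA φ G y + ε) * (ε * g / 6) ≤ 2 * (ε * g / 6) :=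
      mul_le_mul_of_nonneg_right (by linarith) (by positivity)
    linarith
  · rcases le_or_gt (1 - ε) y with h | h
    · linarith [bHat_le w hy.2, hc.B_nonneg hy.2]
    have hy1 : y < 1 := by linarith
    have e1 := abs_le.1 (hE n w (hN.mono (min_le_left _ _)) y hy)
    have e2 := abs_le.1 ((hN y).trans (min_le_right _ _))
    have e3 := abs_le.1 ((hN 1).trans (min_le_right _ _))
    have hGy : g ≤ 1 - G y := (min_le_right _ _).trans (by linarith [hc.mono h.le])
    have hεg : ε * g ≤ g := mul_le_of_le_one_left hg0.le hε1
    have hpos : 0 < 1 - ecdf w y := by linarith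
    refine le_of_mul_le_mul_right (?_ : _ * (1 - ecdf w y) ≤ _ * (1 - ecdf w y)) hpos
    rw [bHat_mul_ecdf hn (fun i => (hw i).2)]
    have hA0 := hc.B_nonneg hy.2
    have hA1 := hc.B_le hy.2
    have hA := hc.B_mul hy1
    have m1 := mul_le_mul_of_nonneg_left e1.2 (by linarith : 0 ≤ curveB φ G y + ε)
    have m2 := mul_le_mul_of_nonneg_left hGy hε.le
    have m3 : (1 - y) * (G y - ecdf w y) ≤ ε * g / 6 := by
      refine (mul_le_mul_of_nonneg_left (by linarith : G y - ecdf w y ≤ ε * g / 6)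
        (by linarith)).trans ?_
      exact mul_le_of_le_one_left (by positivity) (by linarith [hy.1])
    have m4 : (curveB φ G y + ε) * (ε * g / 6) ≤ 2 * (ε * g / 6) :=
      mul_le_mul_of_nonneg_right (by linarith [hy.1]) (by positivity)
    linarith

/-- The empirical minorant, shifted by η in both directions, is a convex minorant of `curveBStar`
and hence at most C; `C_modulus` undoes the shift. Levels below η are compared with level 0. -/
theorem IsCurve.gcm_bStarHat_le (hc : IsCurve φ G) {ε : ℝ} (hε : 0 < ε) :
    ∃ δ > 0, ∀ (n : ℕ) (w : Fin n → ℝ), 0 < n → (∀ i, w i ∈ Icc (0 : ℝ) 1) → Near φ δ w →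
      ∀ u ∈ Icc (0 : ℝ) 1, gcm (bStarHat w) u ≤ curveC φ G u + ε := by
  obtain ⟨η', hη', hmod⟩ := hc.C_modulus (half_pos hε)
  set η := min η' (ε / 2) with hηd
  have hη : 0 < η := lt_min hη' (half_pos hε)
  have hη2 : η ≤ ε / 2 := min_le_right _ _
  obtain ⟨δ, hδ, hN⟩ := hc.hat_near hη
  refine ⟨δ, hδ, fun n w hn hw hNw => ?_⟩
  have H := isStep_bStarHat hw
  have h1I : (1 : ℝ) ∈ Icc (0 : ℝ) 1 := right_mem_Icc.2 zero_le_one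
  have h0I : (0 : ℝ) ∈ Icc (0 : ℝ) 1 := left_mem_Icc.2 zero_le_one
  have hclamp : ∀ u ∈ Icc (0 : ℝ) 1, min (u + η) 1 ∈ Icc (0 : ℝ) 1 := fun u hu =>
    ⟨le_min (by linarith [hu.1]) zero_le_one, min_le_right _ _⟩
  -- A convex decreasing function composed with the concave truncation min (u + η) 1 is convex.
  have hconv : ConvexOn ℝ (Icc 0 1) (fun u => gcm (bStarHat w) (min (u + η) 1) - η) := by
    refine ⟨convex_Icc 0 1, fun x hx y hy a b ha hb hab => ?_⟩
    have hxy := (convex_Icc (0 : ℝ) 1) hx hy ha hb hab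
    have h2 := (convexOn_gcm H.bdd).2 (hclamp x hx) (hclamp y hy) ha hb hab
    have h3 := antitoneOn_gcm H.anti
      ((convex_Icc (0 : ℝ) 1) (hclamp x hx) (hclamp y hy) ha hb hab) (hclamp _ hxy)
      (by
        simp only [smul_eq_mul]
        have e1 := mul_le_mul_of_nonneg_left (min_le_left (x + η) 1) ha
        have e2 := mul_le_mul_of_nonneg_left (min_le_left (y + η) 1) hb
        have e3 := mul_le_mul_of_nonneg_left (min_le_right (x + η) 1) ha
        have e4 := mul_le_mul_of_nonneg_left (min_le_right (y + η) 1) hb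
        obtain rfl : b = 1 - a := by linarith
        refine le_min ?_ ?_ <;> linarith)
    simp only [smul_eq_mul] at h2 h3 ⊢
    obtain rfl : b = 1 - a := by linarith
    linarith
  have hmin : ∀ u ∈ Icc (0 : ℝ) 1,
      gcm (bStarHat w) (min (u + η) 1) - η ≤ curveBStar φ G u := by
    intro u hu
    refine hc.le_bStar hu.1 fun y hy hyu => ?_
    have h2 := hN n w hn hw hNw y hy
    have h3 : gcm (bStarHat w) (min (u + η) 1) ≤ bHat w y := by
      refine (gcm_le H.bdd (hclamp u hu)).trans (bStarHat_le hw hy (le_min ?_ ?_))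
      · linarith [h2.1]
      · exact (aHat_le w hy.1).trans hy.2
    linarith [h2.2]
  intro v hv
  rcases le_or_gt η v with h | h
  · have hvI : v - η ∈ Icc (0 : ℝ) 1 := ⟨by linarith, by linarith [hv.2]⟩
    have h2 := le_gcm hconv hmin hvI
    simp only [sub_add_cancel, min_eq_left hv.2] at h2
    have h3 := hmod (v - η) hvI v hv (by linarith [min_le_left η' (ε / 2)])
    change _ ≤ curveC φ G (v - η) at h2
    linarith
  · have h2 := antitoneOn_gcm H.anti h0I hv hv.1
    have h3 : gcm (bStarHat w) 0 ≤ bHat w 0 :=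
      (gcm_le H.bdd h0I).trans (bStarHat_le hw h0I (aHat_le w le_rfl))
    have h4 := (hN n w hn hw hNw 0 h0I).2
    rw [hc.B_zero, ← hc.C_zero] at h4
    have h5 := hmod 0 h0I v hv (by linarith [min_le_left η' (ε / 2)])
    linarith

/-- Posterior expected false discovery proportion of the decisions `d`. -/
noncomputable def postFdp (w : Fin n → ℝ) (d : Fin n → Bool) : ℝ :=
  (∑ i, if d i = true then w i else 0) / max 1 (∑ i, if d i = true then (1 : ℝ) else 0)

/-- Posterior expected false non-discovery proportion of the decisions `d`. -/
noncomputable def postFnp (w : Fin n → ℝ) (d : Fin n → Bool) : ℝ :=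
  (∑ i, if d i = false then 1 - w i else 0) / max 1 (∑ i, if d i = false then (1 : ℝ) else 0)

theorem postFdp_thresholdRule (w v : Fin n → ℝ) (y : ℝ) :
    postFdp v (thresholdRule w y) =
      (∑ i, if w i ≤ y then v i else 0) / max 1 (∑ i, if w i ≤ y then (1 : ℝ) else 0) := by
  simp [postFdp, thresholdRule]

theorem postFnp_thresholdRule (w v : Fin n → ℝ) (y : ℝ) :
    postFnp v (thresholdRule w y) =
      (∑ i, if y < w i then 1 - v i else 0) / max 1 (∑ i, if y < w i then (1 : ℝ) else 0) := by
  simp [postFnp, thresholdRule]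

theorem postFdp_mem (hw : ∀ i, w i ∈ Icc (0 : ℝ) 1) (d : Fin n → Bool) :
    postFdp w d ∈ Icc (0 : ℝ) 1 := by
  refine ⟨div_nonneg (Finset.sum_nonneg fun i _ => ?_) (by positivity),
    div_le_one_of_le₀ (le_trans (Finset.sum_le_sum fun i _ => ?_) (le_max_right _ _))
      (by positivity)⟩
  · split_ifs
    exacts [(hw i).1, le_rfl]
  · split_ifs
    exacts [(hw i).2, le_rfl]

theorem postFnp_mem (hw : ∀ i, w i ∈ Icc (0 : ℝ) 1) (d : Fin n → Bool) :
    postFnp w d ∈ Icc (0 : ℝ) 1 := by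
  refine ⟨div_nonneg (Finset.sum_nonneg fun i _ => ?_) (by positivity),
    div_le_one_of_le₀ (le_trans (Finset.sum_le_sum fun i _ => ?_) (le_max_right _ _))
      (by positivity)⟩
  · split_ifs
    exacts [by linarith [(hw i).2], le_rfl]
  · split_ifs
    exacts [by linarith [(hw i).1], le_rfl]

/-- No decisions can beat the limiting trade-off curve by more than `ε`. -/
theorem IsCurve.C_postFdp_le (hc : IsCurve φ G) {ε : ℝ} (hε : 0 < ε) :
    ∃ δ > 0, ∀ (n : ℕ) (w : Fin n → ℝ), 0 < n → (∀ i, w i ∈ Icc (0 : ℝ) 1) → Near φ δ w →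
      ∀ d, curveC φ G (postFdp w d) ≤ postFnp w d + ε := by
  obtain ⟨η', hη', hmod⟩ := hc.C_modulus (half_pos hε)
  set η := min η' (ε / 2) with hηd
  have hη : 0 < η := lt_min hη' (half_pos hε)
  have hη2 : η ≤ ε / 2 := min_le_right _ _
  have hg := hc.pos η hη
  have hg' : 0 < 1 - G (1 - η) := by linarith [hc.lt_one (1 - η) (by linarith)]
  set g := min (G η) (1 - G (1 - η)) with hgd
  have hg0 : 0 < g := lt_min hg hg'
  refine ⟨η * g / 2, by positivity, fun n w hn hw hN d => ?_⟩
  have hn' : (0 : ℝ) < n := by exact_mod_cast hn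
  set k := ∑ i, (if d i = true then (1 : ℝ) else 0) with hk
  set k' := ∑ i, (if d i = false then (1 : ℝ) else 0) with hk'
  have hkk : k + k' = n := by
    rw [hk, hk', ← Finset.sum_add_distrib]
    have : ∀ i, (if d i = true then (1 : ℝ) else 0) + (if d i = false then (1 : ℝ) else 0) = 1 :=
      fun i => by cases d i <;> simp
    simp [this]
  have hk0 : 0 ≤ k := count_nonneg _
  have hk'0 : 0 ≤ k' := count_nonneg _
  -- The competing threshold: the quantile that rejects, in the limit, the same fraction of
  -- hypotheses as d.
  obtain ⟨y, hy, hGy⟩ : k / n ∈ G '' Icc (0 : ℝ) 1 := by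
    refine intermediate_value_Icc zero_le_one hc.cont.continuousOn ?_
    rw [hc.zero 0 le_rfl, hc.one]
    exact ⟨div_nonneg hk0 hn'.le, (div_le_one hn').2 (by linarith)⟩
  have hkG : k = n * G y := by rw [hGy]; field_simp
  have hk'G : k' = n * (1 - G y) := by linarith
  have e1 := abs_le.1 (hN y)
  have e2 := abs_le.1 (hN 1)
  have hsum : ∀ y, ∑ i, max (y - w i) 0 = n * avgPos w y := fun y => by
    rw [avgPos]
    field_simp
  -- Each rejected term satisfies w ≥ y - (y - w)⁺, so no choice of k rejections beats the threshold
  -- y.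
  have hS : n * (y * G y - avgPos w y) ≤ ∑ i, if d i = true then w i else 0 := by
    have : y * k - ∑ i, max (y - w i) 0 ≤ ∑ i, if d i = true then w i else 0 := by
      rw [hk, Finset.mul_sum, ← Finset.sum_sub_distrib]
      refine Finset.sum_le_sum fun i _ => ?_
      split_ifs
      · linarith [le_max_left (y - w i) 0]
      · linarith [le_max_right (y - w i) 0]
    rw [hsum, hkG] at this
    linarith
  -- Dually, each rejected term removes at most 1 - y + (y - w)⁺ from the sum of all 1 - w.
  have hS' : n * (avgPos w 1 - avgPos w y - (1 - y) * G y) ≤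
      ∑ i, if d i = false then 1 - w i else 0 := by
    have : ∑ i, max (1 - w i) 0 - ∑ i, max (y - w i) 0 - (1 - y) * k ≤
        ∑ i, if d i = false then 1 - w i else 0 := by
      rw [hk, Finset.mul_sum, ← Finset.sum_sub_distrib, ← Finset.sum_sub_distrib]
      refine Finset.sum_le_sum fun i _ => ?_
      rw [max_eq_left (by linarith [(hw i).2])]
      cases d i
      · simp
      · simp
        linarith [le_max_left (y - w i) 0]
    rw [hsum, hsum, hkG] at this
    linarith
  have hA : curveA φ G y ≤ postFdp w d + η := by
    rcases le_or_gt y η with h | h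
    · linarith [hc.A_le hy.1, (postFdp_mem hw d).1]
    have hGg : g ≤ G y := (min_le_left _ _).trans (hc.mono h.le)
    have hkpos : 0 < k := by
      rw [hkG]
      exact mul_pos hn' (by linarith)
    have hk1 : 1 ≤ k := by
      rcases count_eq_zero_or_one_le (fun i => d i = true) with h' | h'
      · exact absurd (by simp [hk, h'] : k = 0) hkpos.ne'
      · exact h'
    have hpost : postFdp w d * k = ∑ i, if d i = true then w i else 0 := by
      rw [postFdp, ← hk, max_eq_right hk1, div_mul_cancel₀ _ hkpos.ne']
    rw [← hpost, hkG] at hS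
    have h4 : y * G y - avgPos w y ≤ postFdp w d * G y :=
      le_of_mul_le_mul_left (by linarith : (n : ℝ) * _ ≤ n * _) hn'
    refine le_of_mul_le_mul_right (?_ : _ * G y ≤ _ * G y) (by linarith)
    rw [hc.A_mul (hη.trans h)]
    have := mul_le_mul_of_nonneg_left hGg hη.le
    have : 0 < η * g := by positivity
    linarith
  have hB : curveB φ G y ≤ postFnp w d + η := by
    rcases le_or_gt (1 - η) y with h | h
    · linarith [hc.B_le hy.2, (postFnp_mem hw d).1]
    have hy1 : y < 1 := by linarith
    have hGg : g ≤ 1 - G y := (min_le_right _ _).trans (by linarith [hc.mono h.le])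
    have hkpos : 0 < k' := by
      rw [hk'G]
      exact mul_pos hn' (by linarith)
    have hk1 : 1 ≤ k' := by
      rcases count_eq_zero_or_one_le (fun i => d i = false) with h' | h'
      · exact absurd (by simp [hk', h'] : k' = 0) hkpos.ne'
      · exact h'
    have hpost : postFnp w d * k' = ∑ i, if d i = false then 1 - w i else 0 := by
      rw [postFnp, ← hk', max_eq_right hk1, div_mul_cancel₀ _ hkpos.ne']
    rw [← hpost, hk'G] at hS'
    have h4 : avgPos w 1 - avgPos w y - (1 - y) * G y ≤ postFnp w d * (1 - G y) :=
      le_of_mul_le_mul_left (by linarith : (n : ℝ) * _ ≤ n * _) hn'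
    refine le_of_mul_le_mul_right (?_ : _ * (1 - G y) ≤ _ * (1 - G y)) (by linarith)
    rw [hc.B_mul hy1]
    have := mul_le_mul_of_nonneg_left hGg hη.le
    linarith
  have hAI : curveA φ G y ∈ Icc (0 : ℝ) 1 := ⟨hc.A_nonneg hy.1, (hc.A_le hy.1).trans hy.2⟩
  have h5 := hmod _ (postFdp_mem hw d) _ hAI (by linarith [min_le_left η' (ε / 2)])
  have h6 := hc.C_le_B hAI hy le_rfl
  linarith

end Empirical

end TwoGroup

namespace TwoGroup

/-! ### The two-group model seen through its distribution functions -/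

/-- `W` is the local false discovery rate, `F` the distribution function of the observations,
with density `π₀ / W`, and `G`, `φ` describe the law of `W(X)`. -/
structure IsModel (π₀ : ℝ) (W F φ G : ℝ → ℝ) : Prop extends IsCurve φ G where
  prior_pos : 0 < π₀
  prior_le_one : π₀ ≤ 1
  W_mem : ∀ t, W t ∈ Icc (0 : ℝ) 1
  strict : StrictMonoOn W (Ioo 0 1)
  contW : ContinuousOn W (Ioo 0 1)
  contF : Continuous F
  F_zero : F 0 = 0
  F_one : F 1 = 1
  F_eq : ∀ t ∈ Ioo (0 : ℝ) 1, F t = G (W t)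
  F_slope_ge : ∀ a ∈ Icc (0 : ℝ) 1, ∀ b ∈ Ioo (0 : ℝ) 1, a ≤ b → π₀ * (b - a) ≤ W b * (F b - F a)
  F_slope_le : ∀ a ∈ Ioo (0 : ℝ) 1, ∀ b ∈ Icc (0 : ℝ) 1, a ≤ b → W a * (F b - F a) ≤ π₀ * (b - a)

namespace IsModel

variable {π₀ : ℝ} {W F φ G : ℝ → ℝ}

theorem W_pos (hm : IsModel π₀ W F φ G) {t : ℝ} (ht : t ∈ Ioo (0 : ℝ) 1) : 0 < W t := by
  have h2 : t / 2 ∈ Ioo (0 : ℝ) 1 := ⟨by linarith [ht.1], by linarith [ht.1, ht.2]⟩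
  exact (hm.W_mem _).1.trans_lt (hm.strict h2 ht (by linarith [ht.1]))

theorem concaveOn_F (hm : IsModel π₀ W F φ G) : ConcaveOn ℝ (Icc 0 1) F := by
  refine concaveOn_of_slope_anti_adjacent (convex_Icc 0 1) fun {x y z} hx hz hxy hyz => ?_
  have hy : y ∈ Ioo (0 : ℝ) 1 := ⟨hx.1.trans_lt hxy, hyz.trans_le hz.2⟩
  have hW := hm.W_pos hy
  have h1 := hm.F_slope_ge x hx y hy hxy.le
  have h2 := hm.F_slope_le y hy z hz hyz.le
  calc (F z - F y) / (z - y) ≤ π₀ / W y := by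
        rw [div_le_div_iff₀ (by linarith) hW]
        linarith
    _ ≤ (F y - F x) / (y - x) := by
        rw [div_le_div_iff₀ hW (by linarith)]
        linarith

/-- W is strictly increasing, so counting observations is counting local false discovery rates. -/
theorem ecdf_eq (hm : IsModel π₀ W F φ G) {n : ℕ} {x : Fin n → ℝ}
    (hx : ∀ i, x i ∈ Ioo (0 : ℝ) 1) {t : ℝ} (ht : t ∈ Ioo (0 : ℝ) 1) :
    ecdf x t = ecdf (fun i => W (x i)) (W t) := by
  simp only [ecdf, hm.strict.le_iff_le (hx _) ht]

theorem ecdf_near_F (hm : IsModel π₀ W F φ G) {n : ℕ} {x : Fin n → ℝ} (hn : 0 < n)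
    (hx : ∀ i, x i ∈ Ioo (0 : ℝ) 1) {ε : ℝ} (hε : 0 ≤ ε)
    (h : ∀ y ∈ Icc (0 : ℝ) 1, |ecdf (fun i => W (x i)) y - G y| ≤ ε) {t : ℝ}
    (ht : t ∈ Icc (0 : ℝ) 1) : |ecdf x t - F t| ≤ ε := by
  have hn' : (n : ℝ) ≠ 0 := by exact_mod_cast hn.ne'
  rcases ht.1.eq_or_lt with rfl | h0
  · have : ∀ i, ¬ x i ≤ 0 := fun i => not_le.2 (hx i).1
    simpa [ecdf, this, hm.F_zero] using hε
  rcases ht.2.eq_or_lt with rfl | h1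
  · have : ∀ i, x i ≤ 1 := fun i => (hx i).2.le
    simpa [ecdf, this, hm.F_one, hn'] using hε
  · rw [hm.ecdf_eq hx ⟨h0, h1⟩, hm.F_eq t ⟨h0, h1⟩]
    exact h _ (hm.W_mem t)

/-- Marshall's inequality: since F is concave, -F - ε is itself a convex minorant of the negative
empirical distribution function. -/
theorem negMaj_near (hm : IsModel π₀ W F φ G) {n : ℕ} {x : Fin n → ℝ}
    (hx : ∀ i, x i ∈ Ioo (0 : ℝ) 1) {ε : ℝ}
    (h : ∀ t ∈ Icc (0 : ℝ) 1, |ecdf x t - F t| ≤ ε) {t : ℝ}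
    (ht : t ∈ Icc (0 : ℝ) 1) : |negMaj x t + F t| ≤ ε := by
  have h1 := gcm_le (isStep_ecdf hx).bdd ht
  have h2 := le_gcm (h := fun s => -ecdf x s) (D := fun s => -F s + -ε)
    (hm.concaveOn_F.neg.add_const (-ε)) (fun s hs => by
      have := (abs_le.1 (h s hs)).2
      change -F s + -ε ≤ -ecdf x s
      linarith) ht
  have h3 := (abs_le.1 (h t ht)).1
  change _ ≤ negMaj x t at h2
  change negMaj x t ≤ _ at h1
  rw [abs_le]
  constructor <;> linarith

/-- The estimated local false discovery rates are consistent in mean. -/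
theorem mean_wHat_near (hm : IsModel π₀ W F φ G) {ε : ℝ} (hε : 0 < ε) :
    ∃ δ > 0, ∀ (n : ℕ) (x : Fin n → ℝ), 0 < n → (∀ i, x i ∈ Ioo (0 : ℝ) 1) →
      Near φ δ (fun i => W (x i)) → (∑ i, |wHat π₀ unifPdf x i - W (x i)|) / n ≤ ε := by
  have hπ := hm.prior_pos
  -- Near 0 and 1 slopes are not controlled; there the error is bounded by 1, and these zones carry
  -- mass less than ε/4.
  obtain ⟨η, hη0, hη1, hF0, hF1⟩ : ∃ η, 0 < η ∧ η < 1 / 2 ∧ F η < ε / 8 ∧ 1 - ε / 8 < F (1 - η) := by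
    have h1 : ∀ᶠ t in 𝓝[>] (0 : ℝ), F t < ε / 8 := by
      have := (hm.contF.tendsto 0).eventually (gt_mem_nhds (a := ε / 8) (by
        rw [hm.F_zero]
        positivity))
      exact this.filter_mono nhdsWithin_le_nhds
    have h2 : ∀ᶠ t in 𝓝[>] (0 : ℝ), 1 - ε / 8 < F (1 - t) := by
      have hc : Continuous fun t => F (1 - t) := hm.contF.comp (continuous_const.sub continuous_id)
      have := (hc.tendsto 0).eventually (lt_mem_nhds (a := 1 - ε / 8) (by
        rw [sub_zero, hm.F_one]
        linarith))
      exact this.filter_mono nhdsWithin_le_nhds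
    obtain ⟨η, h3, h4, h5⟩ := (h1.and (h2.and (Ioo_mem_nhdsGT (half_pos (zero_lt_one' ℝ))))).exists
    exact ⟨η, h5.1, h5.2, h3, h4⟩
  have huc := (isCompact_Icc (a := η / 2) (b := 1 - η / 2)).uniformContinuousOn_of_continuous
    (hm.contW.mono fun t ht => ⟨by linarith [ht.1], by linarith [ht.2]⟩)
  rw [Metric.uniformContinuousOn_iff] at huc
  obtain ⟨γ', hγ', hW⟩ := huc (ε / 4) (by positivity)
  set γ := min (γ' / 2) (η / 2) with hγd
  have hγ : 0 < γ := lt_min (half_pos hγ') (half_pos hη0)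
  have hγη : γ ≤ η / 2 := min_le_right _ _
  have hγγ : γ < γ' := (min_le_left _ _).trans_lt (half_lt_self hγ')
  -- κ is the slope error: a sup-distance of κγ/2 at both ends of a window of length γ. The first
  -- bound keeps the estimator above π₀/2, and the second then makes κ at most ε/4 times the
  -- estimator.
  set κ := min (π₀ / 2) (ε * π₀ / 8) with hκd
  have hκ : 0 < κ := lt_min (half_pos hπ) (by positivity)
  have hκ1 : κ ≤ π₀ / 2 := min_le_left _ _
  have hκ2 : κ ≤ ε * π₀ / 8 := min_le_right _ _
  have hκ3 : κ * γ ≤ ε / 8 := by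
    have h1 : κ * γ ≤ κ := mul_le_of_le_one_right hκ.le (by linarith)
    have h2 : ε * π₀ ≤ ε := mul_le_of_le_one_right hε.le hm.prior_le_one
    linarith
  obtain ⟨δ, hδ, hE⟩ := hm.toIsCurve.ecdf_near (ε := κ * γ / 2) (by positivity)
  refine ⟨δ, hδ, fun n x hn hx hN => ?_⟩
  have hn' : (0 : ℝ) < n := by exact_mod_cast hn
  have hF : ∀ t ∈ Icc (0 : ℝ) 1, |ecdf x t - F t| ≤ κ * γ / 2 := fun t ht =>
    hm.ecdf_near_F hn hx (by positivity) (hE n _ hN) ht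
  have hM : ∀ t ∈ Icc (0 : ℝ) 1, |negMaj x t + F t| ≤ κ * γ / 2 := fun t ht =>
    hm.negMaj_near hx hF ht
  -- The supporting line at t squeezes the Grenander slope, up to κ, between the slopes of F over
  -- [t, t + γ] and [t - γ, t]. These compare with π₀ / W at t ± γ, and W is uniformly continuous.
  have hmid : ∀ i, x i ∈ Icc η (1 - η) → |wHat π₀ unifPdf x i - W (x i)| ≤ ε / 2 := by
    intro i hi
    have hg0 := grenander_pos hx i
    rw [wHat_eq hx]
    have hxi := hx i
    set t := x i
    set g := grenander x t
    have hsp := (grenander_spec hx (t := t) ⟨hxi.1, hxi.2.le⟩).2.2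
    have htp : t + γ ∈ Ioo (0 : ℝ) 1 := ⟨by linarith [hi.1], by linarith [hi.2]⟩
    have htm : t - γ ∈ Ioo (0 : ℝ) 1 := ⟨by linarith [hi.1], by linarith [hi.2]⟩
    have tI := Ioo_subset_Icc_self hxi
    have tpI := Ioo_subset_Icc_self htp
    have tmI := Ioo_subset_Icc_self htm
    have m0 := abs_le.1 (hM t tI)
    have m1 := abs_le.1 (hM _ tpI)
    have m2 := abs_le.1 (hM _ tmI)
    have s1 := hsp _ tpI
    have s2 := hsp _ tmI
    have f1 := hm.F_slope_ge t tI _ htp (by linarith)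
    have f2 := hm.F_slope_le _ htm t tI (by linarith)
    have wp := hm.W_mem (t + γ)
    have wm := hm.W_mem (t - γ)
    have c1 := hW (t + γ) ⟨by linarith [hi.1], by linarith [hi.2]⟩ t
      ⟨by linarith [hi.1], by linarith [hi.2]⟩
      (by rw [Real.dist_eq, add_sub_cancel_left, abs_of_pos hγ]; exact hγγ)
    have c2 := hW (t - γ) ⟨by linarith [hi.1], by linarith [hi.2]⟩ t
      ⟨by linarith [hi.1], by linarith [hi.2]⟩
      (by rw [Real.dist_eq, sub_sub_cancel_left, abs_neg, abs_of_pos hγ]; exact hγγ)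
    rw [Real.dist_eq] at c1 c2
    have c1' := (abs_lt.1 c1).2
    have c2' := (abs_lt.1 c2).1
    have g1 : π₀ - κ ≤ g * W (t + γ) := by
      have h1 : F (t + γ) - F t ≤ (g + κ) * γ := by linarith
      have h2 := mul_le_mul_of_nonneg_left h1 wp.1
      have h3 : W (t + γ) * κ ≤ κ := mul_le_of_le_one_left hκ.le wp.2
      refine le_of_mul_le_mul_right (?_ : _ * γ ≤ _ * γ) hγ
      have h4 := mul_le_mul_of_nonneg_right h3 hγ.le
      linarith
    have g2 : g * W (t - γ) ≤ π₀ + κ := by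
      have h1 : (g - κ) * γ ≤ F t - F (t - γ) := by linarith
      have h2 := mul_le_mul_of_nonneg_left h1 wm.1
      have h3 : W (t - γ) * κ ≤ κ := mul_le_of_le_one_left hκ.le wm.2
      refine le_of_mul_le_mul_right (?_ : _ * γ ≤ _ * γ) hγ
      have h4 := mul_le_mul_of_nonneg_right h3 hγ.le
      linarith
    have g3 : π₀ / 2 ≤ g := by
      have : g * W (t + γ) ≤ g := mul_le_of_le_one_right hg0.le wp.2
      linarith
    have hκg : κ ≤ g * (ε / 4) := by
      have := mul_le_mul_of_nonneg_right g3 (by positivity : 0 ≤ ε / 4)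
      linarith
    have hdiv : g * (π₀ / g) = π₀ := mul_div_cancel₀ _ hg0.ne'
    have u1 : min (π₀ / g) 1 ≤ W (t + γ) + ε / 4 := by
      refine (min_le_left _ _).trans (le_of_mul_le_mul_left (?_ : g * _ ≤ g * _) hg0)
      rw [hdiv]
      linarith
    have u2 : W (t - γ) - ε / 4 ≤ min (π₀ / g) 1 := by
      refine le_min (le_of_mul_le_mul_left (?_ : g * _ ≤ g * _) hg0) (by linarith [wm.2])
      rw [hdiv]
      linarith
    rw [abs_le]
    constructor <;> linarith
  have hall : ∀ i, |wHat π₀ unifPdf x i - W (x i)| ≤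
      ε / 2 + (if x i ≤ η then (1 : ℝ) else 0) + (1 - if x i ≤ 1 - η then (1 : ℝ) else 0) := by
    intro i
    have h1 := wHat_mem hπ hx i
    have h2 := hm.W_mem (x i)
    have h3 : |wHat π₀ unifPdf x i - W (x i)| ≤ 1 := by
      rw [abs_le]
      constructor <;> linarith [h1.1, h1.2, h2.1, h2.2]
    by_cases ha : x i ≤ η
    · have hb : x i ≤ 1 - η := by linarith
      simp only [ha, hb, if_true]
      linarith
    by_cases hb : x i ≤ 1 - η
    · simp only [ha, hb, if_true, if_false]
      linarith [hmid i ⟨(not_le.1 ha).le, hb⟩]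
    · simp only [ha, hb, if_false]
      linarith
  have hsum := Finset.sum_le_sum fun i (_ : i ∈ Finset.univ) => hall i
  have e1 := (abs_le.1 (hF η ⟨hη0.le, by linarith⟩)).2
  have e2 := (abs_le.1 (hF (1 - η) ⟨by linarith, by linarith⟩)).1
  have hRHS : (∑ i, (ε / 2 + (if x i ≤ η then (1 : ℝ) else 0) +
      (1 - if x i ≤ 1 - η then (1 : ℝ) else 0))) / n =
        ε / 2 + ecdf x η + (1 - ecdf x (1 - η)) := by
    rw [Finset.sum_add_distrib, Finset.sum_add_distrib, Finset.sum_sub_distrib]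
    simp only [ecdf, Finset.sum_const, Finset.card_univ, Fintype.card_fin, nsmul_eq_mul]
    field_simp
  refine (div_le_div_of_nonneg_right hsum hn'.le).trans (hRHS.le.trans ?_)
  linarith

/-- Since (y - w)⁺ is 1-Lipschitz in w, consistency in mean transfers `Near` from the true rates to
the estimated ones. -/
theorem abs_avgPos_sub_le {n : ℕ} (w v : Fin n → ℝ) (y : ℝ) :
    |avgPos w y - avgPos v y| ≤ (∑ i, |w i - v i|) / n := by
  unfold avgPos
  rw [← sub_div, ← Finset.sum_sub_distrib, abs_div, Nat.abs_cast]
  gcongr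
  refine (Finset.abs_sum_le_sum_abs _ _).trans (Finset.sum_le_sum fun i _ => ?_)
  refine (abs_max_sub_max_le_abs _ _ _).trans (le_of_eq ?_)
  rw [sub_sub_sub_cancel_left, abs_sub_comm]

/-- On threshold sets, the posterior error proportions exceed the estimated ones by little. -/
theorem post_threshold_le (hm : IsModel π₀ W F φ G) {ε : ℝ} (hε : 0 < ε) :
    ∃ δ > 0, ∀ (n : ℕ) (x : Fin n → ℝ), 0 < n → (∀ i, x i ∈ Ioo (0 : ℝ) 1) →
      Near φ δ (fun i => W (x i)) → ∀ y,
        postFdp (fun i => W (x i)) (thresholdRule (wHat π₀ unifPdf x) y) ≤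
          aHat (wHat π₀ unifPdf x) y + ε ∧
        postFnp (fun i => W (x i)) (thresholdRule (wHat π₀ unifPdf x) y) ≤
          bHat (wHat π₀ unifPdf x) y + ε := by
  wlog hε1 : ε < 1 generalizing ε
  · obtain ⟨δ, hδ, h⟩ := this (ε := 1 / 2) (by norm_num) (by norm_num)
    refine ⟨δ, hδ, fun n w hn hw hN y => ?_⟩
    have := h n w hn hw hN y
    constructor <;> linarith
  have hg := hm.pos ε hε
  have hg' : 0 < 1 - G (1 - ε) := by linarith [hm.lt_one (1 - ε) (by linarith)]
  set g := min (G ε) (1 - G (1 - ε)) with hgd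
  have hg0 : 0 < g := lt_min hg hg'
  obtain ⟨δ₁, hδ₁, hE⟩ := hm.toIsCurve.ecdf_near (half_pos hg0)
  obtain ⟨δ₂, hδ₂, hΔ⟩ := hm.mean_wHat_near (ε := ε * (g / 2)) (by positivity)
  refine ⟨min δ₁ δ₂, lt_min hδ₁ hδ₂, fun n x hn hx hN y => ?_⟩
  have hn' : (0 : ℝ) < n := by exact_mod_cast hn
  have hE := hE n _ (hN.mono (min_le_left _ _))
  have hΔ := hΔ n x hn hx (hN.mono (min_le_right _ _))
  rw [div_le_iff₀ hn'] at hΔ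
  have hmono : ∀ i j, W (x i) < W (x j) → wHat π₀ unifPdf x i ≤ wHat π₀ unifPdf x j :=
    fun i j h => wHat_mono hm.prior_pos hx ((hm.strict.lt_iff_lt (hx i) (hx j)).1 h).le
  have hw := wHat_mem hm.prior_pos hx
  set w := wHat π₀ unifPdf x
  rw [postFdp_thresholdRule, postFnp_thresholdRule]
  constructor
  -- Either all rejected rates are at most ε, and the bound is immediate; or some rejected rate
  -- exceeds ε. In that case monotonicity of the estimates forces rejection of every j with W (x j)
  -- ≤ ε, a positive fraction g/2 of the sample, and the total error can be divided by the number of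
  -- rejections.
  · by_cases hall : ∀ i, w i ≤ y → W (x i) ≤ ε
    · have : (∑ i, if w i ≤ y then W (x i) else 0) / max 1 (∑ i, if w i ≤ y then (1 : ℝ) else 0) ≤
          ε := by
        rw [div_le_iff₀ (by positivity)]
        refine le_trans ?_ (mul_le_mul_of_nonneg_left (le_max_right _ _) hε.le)
        rw [Finset.mul_sum]
        refine Finset.sum_le_sum fun i _ => ?_
        split_ifs with h
        · linarith [hall i h]
        · simp
      linarith [aHat_nonneg (fun i => (hw i).1) y]
    push Not at hall
    obtain ⟨i, hiy, hi⟩ := hall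
    have hcount : g / 2 * n ≤ ∑ j, if w j ≤ y then (1 : ℝ) else 0 := by
      have e1 := (abs_le.1 (hE ε ⟨hε.le, hε1.le⟩)).1
      have e2 : g / 2 ≤ ecdf (fun i => W (x i)) ε := by linarith [min_le_left (G ε) (1 - G (1 - ε))]
      rw [ecdf, le_div_iff₀ hn'] at e2
      refine e2.trans (Finset.sum_le_sum fun j _ => ?_)
      by_cases h : W (x j) ≤ ε
      · simp [h, (hmono j i (h.trans_lt hi)).trans hiy]
      · simp only [h, if_false]
        positivity
    unfold aHat
    rw [← sub_le_iff_le_add', ← sub_div, ← Finset.sum_sub_distrib, div_le_iff₀ (by positivity)]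
    calc ∑ j, ((if w j ≤ y then W (x j) else 0) - (if w j ≤ y then w j else 0))
        ≤ ∑ j, |w j - W (x j)| := by
          refine Finset.sum_le_sum fun j _ => ?_
          split_ifs
          · linarith [neg_abs_le (w j - W (x j))]
          · simp
      _ ≤ ε * (g / 2 * n) := by linarith
      _ ≤ _ := mul_le_mul_of_nonneg_left (hcount.trans (le_max_right _ _)) hε.le
  · by_cases hall : ∀ i, y < w i → 1 - W (x i) ≤ ε
    · have : (∑ i, if y < w i then 1 - W (x i) else 0) /
          max 1 (∑ i, if y < w i then (1 : ℝ) else 0) ≤ ε := by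
        rw [div_le_iff₀ (by positivity)]
        refine le_trans ?_ (mul_le_mul_of_nonneg_left (le_max_right _ _) hε.le)
        rw [Finset.mul_sum]
        refine Finset.sum_le_sum fun i _ => ?_
        split_ifs with h
        · linarith [hall i h]
        · simp
      linarith [bHat_nonneg (fun i => (hw i).2) y]
    push Not at hall
    obtain ⟨i, hiy, hi⟩ := hall
    have hcount : g / 2 * n ≤ ∑ j, if y < w j then (1 : ℝ) else 0 := by
      have e1 := (abs_le.1 (hE (1 - ε) ⟨by linarith, by linarith⟩)).2
      have e2 : ecdf (fun i => W (x i)) (1 - ε) ≤ 1 - g / 2 := by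
        linarith [min_le_right (G ε) (1 - G (1 - ε))]
      rw [ecdf, div_le_iff₀ hn'] at e2
      have e3 : ∑ j, (1 - if W (x j) ≤ 1 - ε then (1 : ℝ) else 0) ≤
          ∑ j, if y < w j then (1 : ℝ) else 0 := by
        refine Finset.sum_le_sum fun j _ => ?_
        by_cases h : W (x j) ≤ 1 - ε
        · simp only [h, if_true, sub_self]
          positivity
        · have h' : y < w j := hiy.trans_le (hmono i j (by linarith [not_le.1 h]))
          simp [h, h']
      rw [Finset.sum_sub_distrib] at e3
      simp only [Finset.sum_const, Finset.card_univ, Fintype.card_fin, nsmul_eq_mul, mul_one] at e3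
      linarith
    unfold bHat
    rw [← sub_le_iff_le_add', ← sub_div, ← Finset.sum_sub_distrib, div_le_iff₀ (by positivity)]
    calc ∑ j, ((if y < w j then 1 - W (x j) else 0) - (if y < w j then 1 - w j else 0))
        ≤ ∑ j, |w j - W (x j)| := by
          refine Finset.sum_le_sum fun j _ => ?_
          split_ifs
          · linarith [le_abs_self (w j - W (x j))]
          · simp
      _ ≤ ε * (g / 2 * n) := by linarith
      _ ≤ _ := mul_le_mul_of_nonneg_left (hcount.trans (le_max_right _ _)) hε.le

end IsModel

theorem integral_adaptiveLaw {n : ℕ} {w : Fin n → ℝ} (hw : ∀ i, w i ∈ Icc (0 : ℝ) 1) {α : ℝ}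
    (hα : α ∈ Icc (0 : ℝ) 1) : ∃ p ∈ Icc (0 : ℝ) 1, ∃ s ∈ Icc (0 : ℝ) 1, ∃ s' ∈ Icc (0 : ℝ) 1,
      p * s + (1 - p) * s' = α ∧
      gcm (bStarHat w) α = p * bHat w (yStarHat w s) + (1 - p) * bHat w (yStarHat w s') ∧
      ∀ f : (Fin n → Bool) → ℝ, ∫ d, f d ∂(adaptiveLaw w α) =
        p * f (thresholdRule w (yStarHat w s)) + (1 - p) * f (thresholdRule w (yStarHat w s')) := by
  have H := isStep_bStarHat hw
  have h1 := (H.knotLeft_spec hα).2.1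
  have h2 := H.le_knotRight hα
  have h3 := H.knotLeft_lt_knotRight hα
  have hs := H.subset _ (H.knots_subset (H.knotLeft_spec hα).1)
  have hs' := H.subset _ (H.knots_subset (H.knotRight_spec α).1)
  have h4 := H.gcm_eq_interp hα
  rw [bStarHat_eq hw hs.1, bStarHat_eq hw hs'.1] at h4
  have hp0 : 0 ≤ (knotRight (gcm (bStarHat w)) α - α) /
      (knotRight (gcm (bStarHat w)) α - knotLeft (gcm (bStarHat w)) α) :=
    div_nonneg (by linarith) (by linarith)
  have hp1 : (knotRight (gcm (bStarHat w)) α - α) /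
      (knotRight (gcm (bStarHat w)) α - knotLeft (gcm (bStarHat w)) α) ≤ 1 :=
    div_le_one_of_le₀ (by linarith) (by linarith)
  refine ⟨_, ⟨hp0, hp1⟩, _, hs, _, hs', ?_, h4, fun f => ?_⟩
  · have : knotRight (gcm (bStarHat w)) α - knotLeft (gcm (bStarHat w)) α ≠ 0 := by linarith
    field_simp
    ring
  · have hi : ∀ d : Fin n → Bool, Integrable f (Measure.dirac d) := fun d => Integrable.of_finite
    simp only [adaptiveLaw]
    rw [integral_add_measure ((hi _).smul_measure ENNReal.ofReal_ne_top)
      ((hi _).smul_measure ENNReal.ofReal_ne_top), integral_smul_measure, integral_smul_measure,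
      integral_dirac, integral_dirac, ENNReal.toReal_ofReal hp0,
      ENNReal.toReal_ofReal (by linarith)]
    simp only [smul_eq_mul]

/-- Posterior error rates of the data-driven procedure, uniformly in the level. -/
theorem IsModel.adaptive_near {π₀ : ℝ} {W F φ G : ℝ → ℝ} (hm : IsModel π₀ W F φ G) {ε : ℝ}
    (hε : 0 < ε) : ∃ δ > 0, ∀ (n : ℕ) (x : Fin n → ℝ), 0 < n → (∀ i, x i ∈ Ioo (0 : ℝ) 1) →
      Near φ δ (fun i => W (x i)) → ∀ α ∈ Icc (0 : ℝ) 1,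
        ∫ d, postFdp (fun i => W (x i)) d ∂(adaptiveRule π₀ unifPdf n α x) ≤ α + ε ∧
        |∫ d, postFnp (fun i => W (x i)) d ∂(adaptiveRule π₀ unifPdf n α x) - curveC φ G α| ≤ ε := by
  have hc := hm.toIsCurve
  obtain ⟨η', hη', hmod⟩ := hc.C_modulus (half_pos hε)
  set η := min η' (ε / 2) with hηd
  have hη : 0 < η := lt_min hη' (half_pos hε)
  have hη2 : η ≤ ε / 2 := min_le_right _ _
  obtain ⟨δ₁, hδ₁, h₁⟩ := hm.post_threshold_le hη
  obtain ⟨δ₂, hδ₂, h₂⟩ := hc.C_postFdp_le (half_pos hε)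
  obtain ⟨δ₃, hδ₃, h₃⟩ := hc.gcm_bStarHat_le (half_pos hε)
  obtain ⟨δ₄, hδ₄, h₄⟩ := hm.mean_wHat_near (half_pos hδ₃)
  refine ⟨min (min δ₁ δ₂) (min (δ₃ / 2) δ₄), by positivity, fun n x hn hx hN α hα => ?_⟩
  have h₁ := h₁ n x hn hx (hN.mono ((min_le_left _ _).trans (min_le_left _ _)))
  have h₂ := h₂ n _ hn (fun i => hm.W_mem (x i))
    (hN.mono ((min_le_left _ _).trans (min_le_right _ _)))
  have h₄ := h₄ n x hn hx (hN.mono ((min_le_right _ _).trans (min_le_right _ _)))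
  have hN₃ := hN.mono ((min_le_right _ _).trans (min_le_left _ _))
  have hw := wHat_mem hm.prior_pos hx
  -- The estimated rates satisfy `Near` too: δ₃/2 from the true rates and δ₃/2 from their mean
  -- error.
  have h₃ := h₃ n (wHat π₀ unifPdf x) hn hw (fun y => by
    have e1 := abs_le.1 (hN₃ y)
    have e2 := abs_le.1 (IsModel.abs_avgPos_sub_le (wHat π₀ unifPdf x) (fun i => W (x i)) y)
    rw [abs_le]
    constructor <;> linarith) α hα
  obtain ⟨p, hp, s, hs, s', hs', hα', hgcm, hint⟩ := integral_adaptiveLaw hw hα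
  unfold adaptiveRule
  rw [hint, hint]
  set w := wHat π₀ unifPdf x
  set d := thresholdRule w (yStarHat w s)
  set d' := thresholdRule w (yStarHat w s')
  set v : Fin n → ℝ := fun i => W (x i)
  have hq : 0 ≤ 1 - p := by linarith [hp.2]
  have hv : ∀ i, v i ∈ Icc (0 : ℝ) 1 := fun i => hm.W_mem (x i)
  have a1 := mul_le_mul_of_nonneg_left ((h₁ (yStarHat w s)).1.trans
    (add_le_add_left (yStarHat_spec w hs.1).2 η)) hp.1
  have a2 := mul_le_mul_of_nonneg_left ((h₁ (yStarHat w s')).1.trans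
    (add_le_add_left (yStarHat_spec w hs'.1).2 η)) hq
  have b1 := mul_le_mul_of_nonneg_left (h₁ (yStarHat w s)).2 hp.1
  have b2 := mul_le_mul_of_nonneg_left (h₁ (yStarHat w s')).2 hq
  have c1 := mul_le_mul_of_nonneg_left (h₂ d) hp.1
  have c2 := mul_le_mul_of_nonneg_left (h₂ d') hq
  have hA : p * postFdp v d + (1 - p) * postFdp v d' ≤ α + η := by linarith
  have hAI : p * postFdp v d + (1 - p) * postFdp v d' ∈ Icc (0 : ℝ) 1 :=
    convex_Icc 0 1 (postFdp_mem hv d) (postFdp_mem hv d') hp.1 hq (by ring)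
  -- For the lower bound on the FNR, Jensen is combined with `C_postFdp_le` at both decision vectors
  -- and with the bound α + η on the averaged false discovery proportion. The upper bound uses only
  -- the interpolation identity and `gcm_bStarHat_le`.
  have hconv := hc.convexOn_C.2 (postFdp_mem hv d) (postFdp_mem hv d') hp.1 hq (by ring)
  simp only [smul_eq_mul] at hconv
  have hmod' := hmod α hα _ hAI (hA.trans (by linarith [min_le_left η' (ε / 2)]))
  refine ⟨by linarith, ?_⟩
  rw [abs_le]
  constructor <;> linarith

end TwoGroup

namespace TwoGroup

/-! ### The population version of the model -/

theorem continuous_measureReal_Iic (ν : Measure ℝ) [IsProbabilityMeasure ν] [NullSingletonClass ν] :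
    Continuous fun y => ν.real (Iic y) := by
  have h : ∀ y, ν.real (Iic y) = cdf ν y := fun y => (cdf_eq_real ν y).symm
  simp_rw [h]
  refine continuous_iff_continuousAt.2 fun y => ?_
  rw [(monotone_cdf ν).continuousAt_iff_leftLim_eq_rightLim, (cdf ν).rightLim_eq]
  have h1 := (cdf ν).measure_singleton y
  rw [measure_cdf, measure_singleton] at h1
  refine le_antisymm ((monotone_cdf ν).leftLim_le le_rfl) ?_
  have := ENNReal.ofReal_eq_zero.1 h1.symm
  linarith

section Population

variable {π₀ : ℝ} {f₁ : ℝ → ℝ}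

/-- Law of one observation. -/
noncomputable def margLaw (π₀ : ℝ) (f₁ : ℝ → ℝ) : Measure ℝ := densLaw (mixPdf π₀ unifPdf f₁)

theorem measurable_unifPdf : Measurable unifPdf := measurable_const.indicator measurableSet_Ioo

theorem unifPdf_nonneg (t : ℝ) : 0 ≤ unifPdf t := indicator_nonneg (fun _ _ => zero_le_one) t

theorem densLaw_unifPdf : densLaw unifPdf = (volume : Measure ℝ).restrict (Ioo 0 1) := by
  rw [densLaw, ← withDensity_indicator_one measurableSet_Ioo]
  congr 1
  funext t
  by_cases h : t ∈ Ioo (0 : ℝ) 1 <;> simp [unifPdf, h]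

instance : IsProbabilityMeasure (densLaw unifPdf) := by
  rw [densLaw_unifPdf]
  exact ⟨by simp⟩

theorem isProbabilityMeasure_densLaw (h : ∫⁻ x, ENNReal.ofReal (f₁ x) = 1) :
    IsProbabilityMeasure (densLaw f₁) :=
  ⟨by rw [densLaw, withDensity_apply _ MeasurableSet.univ, setLIntegral_univ, h]⟩

theorem margLaw_eq (hπ : π₀ ∈ Icc (0 : ℝ) 1) (hf : Measurable f₁) (hf0 : ∀ x, 0 ≤ f₁ x) :
    margLaw π₀ f₁ =
      ENNReal.ofReal π₀ • densLaw unifPdf + ENNReal.ofReal (1 - π₀) • densLaw f₁ := by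
  have h : (fun x => ENNReal.ofReal (mixPdf π₀ unifPdf f₁ x)) =
      ENNReal.ofReal π₀ • (fun x => ENNReal.ofReal (unifPdf x)) +
        ENNReal.ofReal (1 - π₀) • (fun x => ENNReal.ofReal (f₁ x)) := by
    funext x
    simp only [mixPdf, Pi.add_apply, Pi.smul_apply, smul_eq_mul]
    rw [ENNReal.ofReal_add (mul_nonneg hπ.1 (unifPdf_nonneg x))
      (mul_nonneg (by linarith [hπ.2]) (hf0 x)), ENNReal.ofReal_mul hπ.1,
      ENNReal.ofReal_mul (by linarith [hπ.2])]
  unfold margLaw densLaw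
  rw [h, withDensity_add_left (measurable_unifPdf.ennreal_ofReal.const_smul _),
    withDensity_smul _ measurable_unifPdf.ennreal_ofReal, withDensity_smul _ hf.ennreal_ofReal]

theorem isProbabilityMeasure_margLaw (hπ : π₀ ∈ Icc (0 : ℝ) 1) (hf : Measurable f₁)
    (hf0 : ∀ x, 0 ≤ f₁ x) (h1 : ∫⁻ x, ENNReal.ofReal (f₁ x) = 1) :
    IsProbabilityMeasure (margLaw π₀ f₁) := by
  have := isProbabilityMeasure_densLaw h1
  refine ⟨?_⟩
  rw [margLaw_eq hπ hf hf0]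
  simp only [Measure.add_apply, Measure.smul_apply, measure_univ, smul_eq_mul, mul_one]
  rw [← ENNReal.ofReal_add hπ.1 (by linarith [hπ.2]), add_sub_cancel, ENNReal.ofReal_one]

theorem mixPdf_of_mem {t : ℝ} (ht : t ∈ Ioo (0 : ℝ) 1) :
    mixPdf π₀ unifPdf f₁ t = π₀ + (1 - π₀) * f₁ t := by
  rw [mixPdf, unifPdf_of_mem ht, mul_one]

theorem lfdr_of_mem {t : ℝ} (ht : t ∈ Ioo (0 : ℝ) 1) :
    lfdr π₀ unifPdf f₁ t = π₀ / mixPdf π₀ unifPdf f₁ t := by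
  rw [lfdr, unifPdf_of_mem ht, mul_one]

theorem lfdr_of_notMem {t : ℝ} (ht : t ∉ Ioo (0 : ℝ) 1) : lfdr π₀ unifPdf f₁ t = 0 := by
  simp [lfdr, unifPdf, ht]

theorem measurable_mixPdf (hf : Measurable f₁) : Measurable (mixPdf π₀ unifPdf f₁) :=
  (measurable_unifPdf.const_mul π₀).add (hf.const_mul (1 - π₀))

theorem measurable_lfdr (hf : Measurable f₁) : Measurable (lfdr π₀ unifPdf f₁) :=
  (measurable_unifPdf.const_mul π₀).div (measurable_mixPdf hf)

theorem lfdr_mem (hπ : π₀ ∈ Icc (0 : ℝ) 1) (hf0 : ∀ x, 0 ≤ f₁ x) (t : ℝ) :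
    lfdr π₀ unifPdf f₁ t ∈ Icc (0 : ℝ) 1 := by
  have h1 := mul_nonneg hπ.1 (unifPdf_nonneg t)
  have h2 := mul_nonneg (by linarith [hπ.2] : 0 ≤ 1 - π₀) (hf0 t)
  exact ⟨div_nonneg h1 (add_nonneg h1 h2),
    div_le_one_of_le₀ (le_add_of_nonneg_right h2) (add_nonneg h1 h2)⟩

/-- Distribution function of the local false discovery rate. -/
noncomputable def lfdrCdf (π₀ : ℝ) (f₁ : ℝ → ℝ) (y : ℝ) : ℝ :=
  (margLaw π₀ f₁).real {t | lfdr π₀ unifPdf f₁ t ≤ y}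

/-- Primitive of the distribution function of the local false discovery rate. -/
noncomputable def lfdrPhi (π₀ : ℝ) (f₁ : ℝ → ℝ) (y : ℝ) : ℝ :=
  ∫ t, max (y - lfdr π₀ unifPdf f₁ t) 0 ∂(margLaw π₀ f₁)

theorem integrable_posPart (hπ : π₀ ∈ Icc (0 : ℝ) 1) (hf : Measurable f₁)
    (hf0 : ∀ x, 0 ≤ f₁ x) (h1 : ∫⁻ x, ENNReal.ofReal (f₁ x) = 1) (y : ℝ) :
    Integrable (fun t => max (y - lfdr π₀ unifPdf f₁ t) 0) (margLaw π₀ f₁) := by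
  have := isProbabilityMeasure_margLaw hπ hf hf0 h1
  refine Integrable.of_bound (C := |y|)
    ((measurable_lfdr hf).const_sub y |>.max measurable_const).aestronglyMeasurable
    (Eventually.of_forall fun t => ?_)
  rw [Real.norm_eq_abs, abs_of_nonneg (le_max_right _ _)]
  refine max_le ?_ (abs_nonneg y)
  linarith [le_abs_self y, (lfdr_mem hπ hf0 t).1]

theorem measureReal_Ioo_ge (hπ : π₀ ∈ Icc (0 : ℝ) 1) (hf : Measurable f₁)
    (hf0 : ∀ x, 0 ≤ f₁ x) (h1 : ∫⁻ x, ENNReal.ofReal (f₁ x) = 1) {a b c : ℝ}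
    (hc : 0 ≤ c) (h : ∀ t ∈ Ioo a b, c ≤ mixPdf π₀ unifPdf f₁ t) :
    c * (b - a) ≤ (margLaw π₀ f₁).real (Ioo a b) := by
  have := isProbabilityMeasure_margLaw hπ hf hf0 h1
  rw [measureReal_def, ← ENNReal.ofReal_le_iff_le_toReal (measure_ne_top _ _), margLaw, densLaw,
    withDensity_apply _ measurableSet_Ioo, ENNReal.ofReal_mul hc, ← Real.volume_Ioo,
    ← setLIntegral_const]
  exact setLIntegral_mono (measurable_mixPdf hf).ennreal_ofReal
    fun t ht => ENNReal.ofReal_le_ofReal (h t ht)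

theorem measureReal_Ioo_le {a b c : ℝ} (hab : a ≤ b)
    (hc : 0 ≤ c) (h : ∀ t ∈ Ioo a b, mixPdf π₀ unifPdf f₁ t ≤ c) :
    (margLaw π₀ f₁).real (Ioo a b) ≤ c * (b - a) := by
  rw [measureReal_def]
  refine ENNReal.toReal_le_of_le_ofReal (mul_nonneg hc (by linarith)) ?_
  rw [margLaw, densLaw, withDensity_apply _ measurableSet_Ioo, ENNReal.ofReal_mul hc,
    ← Real.volume_Ioo, ← setLIntegral_const]
  exact setLIntegral_mono measurable_const fun t ht => ENNReal.ofReal_le_ofReal (h t ht)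

variable {g : ℝ → ℝ}

theorem lfdr_law_null (hW : Measure.map (lfdr π₀ unifPdf f₁) (margLaw π₀ f₁) =
      densLaw ((Ioo (0 : ℝ) 1).indicator g)) {A : Set ℝ} (hA : volume A = 0) :
    Measure.map (lfdr π₀ unifPdf f₁) (margLaw π₀ f₁) A = 0 := by
  rw [hW]
  exact withDensity_absolutelyContinuous _ _ hA

theorem lfdr_law_compl (hW : Measure.map (lfdr π₀ unifPdf f₁) (margLaw π₀ f₁) =
      densLaw ((Ioo (0 : ℝ) 1).indicator g)) :
    Measure.map (lfdr π₀ unifPdf f₁) (margLaw π₀ f₁) (Ioo (0 : ℝ) 1)ᶜ = 0 := by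
  rw [hW, densLaw, withDensity_apply _ measurableSet_Ioo.compl]
  refine setLIntegral_eq_zero measurableSet_Ioo.compl fun t ht => ?_
  simp [indicator_of_notMem ht]

theorem lfdr_law_Ioo_pos (hg : Measurable g) (hg0 : ∀ t ∈ Ioo (0 : ℝ) 1, 0 < g t)
    (hW : Measure.map (lfdr π₀ unifPdf f₁) (margLaw π₀ f₁) =
      densLaw ((Ioo (0 : ℝ) 1).indicator g)) {a b : ℝ} (ha : 0 ≤ a) (hab : a < b) (hb : b ≤ 1) :
    0 < Measure.map (lfdr π₀ unifPdf f₁) (margLaw π₀ f₁) (Ioo a b) := by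
  rw [hW, densLaw, withDensity_apply _ measurableSet_Ioo,
    setLIntegral_pos_iff (hg.indicator measurableSet_Ioo).ennreal_ofReal]
  have : Function.support (fun t => ENNReal.ofReal ((Ioo (0 : ℝ) 1).indicator g t)) ∩ Ioo a b =
      Ioo a b := by
    refine inter_eq_right.2 fun t ht => ?_
    have htI : t ∈ Ioo (0 : ℝ) 1 := ⟨ha.trans_lt ht.1, ht.2.trans_le hb⟩
    rw [Function.mem_support, indicator_of_mem htI]
    exact (ENNReal.ofReal_pos.2 (hg0 t htI)).ne'
  rw [this]
  simpa using hab

/-- Outside (0,1) the local false discovery rate is 0, a value that its law does not charge. So the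
hypothesis on W rules out mass of f₁ outside (0,1). -/
theorem ae_mem_Ioo (hf : Measurable f₁)
    (hW : Measure.map (lfdr π₀ unifPdf f₁) (margLaw π₀ f₁) =
      densLaw ((Ioo (0 : ℝ) 1).indicator g)) :
    ∀ᵐ t ∂(margLaw π₀ f₁), t ∈ Ioo (0 : ℝ) 1 := by
  have h := lfdr_law_compl hW
  rw [Measure.map_apply (measurable_lfdr hf) measurableSet_Ioo.compl] at h
  refine measure_mono_null (fun t ht => ?_) h
  rw [mem_preimage, lfdr_of_notMem ht]
  simp

/-- The hypotheses of the two-group model give the deterministic description of the population. -/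
theorem isModel (hπ : π₀ ∈ Ioo (0 : ℝ) 1) (hf : Measurable f₁) (hf0 : ∀ x, 0 ≤ f₁ x)
    (h1 : ∫⁻ x, ENNReal.ofReal (f₁ x) = 1) (hanti : AntitoneOn f₁ (Ioo 0 1))
    (hcont : ContinuousOn f₁ (Ioo 0 1)) (hg : Measurable g) (hg0 : ∀ t ∈ Ioo (0 : ℝ) 1, 0 < g t)
    (hW : Measure.map (lfdr π₀ unifPdf f₁) (margLaw π₀ f₁) =
      densLaw ((Ioo (0 : ℝ) 1).indicator g)) :
    IsModel π₀ (lfdr π₀ unifPdf f₁) (fun t => (margLaw π₀ f₁).real (Iic t)) (lfdrPhi π₀ f₁)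
      (lfdrCdf π₀ f₁) := by
  have hπI := Ioo_subset_Icc_self hπ
  have hprob := isProbabilityMeasure_margLaw hπI hf hf0 h1
  have hWm := measurable_lfdr (π₀ := π₀) hf
  have hint := integrable_posPart hπI hf hf0 h1
  set μ := margLaw π₀ f₁ with hμ
  set W := lfdr π₀ unifPdf f₁ with hWd
  set ν := Measure.map W μ with hν
  have hprobν : IsProbabilityMeasure ν := Measure.isProbabilityMeasure_map hWm.aemeasurable
  have hatomν : NullSingletonClass ν := ⟨fun y => lfdr_law_null hW (measure_singleton y)⟩
  have hatom : NullSingletonClass μ :=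
    ⟨fun y => withDensity_absolutelyContinuous _ _ (measure_singleton y)⟩
  have hsupp : ∀ᵐ t ∂μ, t ∈ Ioo (0 : ℝ) 1 := ae_mem_Ioo hf hW
  have hGν : ∀ y, lfdrCdf π₀ f₁ y = ν.real (Iic y) := fun y =>
    (map_measureReal_apply hWm measurableSet_Iic).symm
  have hmem := lfdr_mem hπI hf0
  have hπ1 : 0 < 1 - π₀ := by linarith [hπ.2]
  have hfpos : ∀ t ∈ Ioo (0 : ℝ) 1, π₀ ≤ mixPdf π₀ unifPdf f₁ t := fun t ht => by
    rw [mixPdf_of_mem ht]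
    exact le_add_of_nonneg_right (mul_nonneg hπ1.le (hf0 t))
  have hfanti : AntitoneOn (mixPdf π₀ unifPdf f₁) (Ioo 0 1) := fun s hs t ht hst => by
    rw [mixPdf_of_mem hs, mixPdf_of_mem ht]
    have := mul_le_mul_of_nonneg_left (hanti hs ht hst) hπ1.le
    linarith
  have hWf : ∀ t ∈ Ioo (0 : ℝ) 1, W t * mixPdf π₀ unifPdf f₁ t = π₀ := fun t ht => by
    rw [hWd, lfdr_of_mem ht, div_mul_cancel₀ _ (hπ.1.trans_le (hfpos t ht)).ne']
  have hFsub : ∀ a b, a ≤ b → μ.real (Iic b) - μ.real (Iic a) = μ.real (Ioo a b) := by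
    intro a b hab
    rw [← Iic_union_Ioc_eq_Iic hab, measureReal_union (Iic_disjoint_Ioc le_rfl) measurableSet_Ioc,
      add_sub_cancel_left, measureReal_congr Ioo_ae_eq_Ioc]
  -- A flat stretch of W would be an atom of its law, since an interval (s, t) has mass at least π₀
  -- (t - s).
  have hstrict : StrictMonoOn W (Ioo 0 1) := by
    have hm : MonotoneOn W (Ioo 0 1) := fun s hs t ht hst => by
      rw [hWd, lfdr_of_mem hs, lfdr_of_mem ht]
      exact div_le_div_of_nonneg_left hπ.1.le (hπ.1.trans_le (hfpos t ht)) (hfanti hs ht hst)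
    intro s hs t ht hst
    refine lt_of_le_of_ne (hm hs ht hst.le) fun heq => ?_
    have h2 : μ (Ioo s t) = 0 := by
      have h3 : ν {W s} = 0 := measure_singleton _
      rw [hν, Measure.map_apply hWm (measurableSet_singleton _)] at h3
      refine measure_mono_null (fun r hr => ?_) h3
      have hrI : r ∈ Ioo (0 : ℝ) 1 := ⟨hs.1.trans hr.1, hr.2.trans ht.2⟩
      exact le_antisymm ((hm hrI ht hr.2.le).trans heq.ge) (hm hs hrI hr.1.le)
    have h3 := measureReal_Ioo_ge hπI hf hf0 h1 hπ.1.le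
      (fun r hr => hfpos r ⟨hs.1.trans hr.1, hr.2.trans ht.2⟩)
    rw [measureReal_def, ← hμ, h2, ENNReal.toReal_zero] at h3
    have := mul_pos hπ.1 (sub_pos.2 hst)
    linarith
  have hind : ∀ y γ : ℝ, ∫ t, (if W t ≤ y then γ else 0) ∂μ = γ * lfdrCdf π₀ f₁ y := by
    intro y γ
    have : (fun t => if W t ≤ y then γ else 0) = {t | W t ≤ y}.indicator fun _ => γ := by
      funext t
      simp [indicator]
    rw [this, integral_indicator_const _ (measurableSet_le hWm measurable_const), smul_eq_mul,
      mul_comm]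
    rfl
  have hindint : ∀ y γ : ℝ, Integrable (fun t => if W t ≤ y then γ else 0) μ := by
    intro y γ
    have : (fun t => if W t ≤ y then γ else 0) = {t | W t ≤ y}.indicator fun _ => γ := by
      funext t
      simp [indicator]
    rw [this]
    exact (integrable_const γ).indicator (measurableSet_le hWm measurable_const)
  refine
    { mono := fun y z hyz => measureReal_mono fun t (ht : W t ≤ y) => ht.trans hyz
      cont := by
        simp_rw [funext hGν]
        exact continuous_measureReal_Iic ν
      zero := fun y hy => ?_
      one := ?_
      bound := fun y => measureReal_le_one
      pos := fun y hy => ?_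
      lt_one := fun y hy => ?_
      phi_zero := ?_
      slope_le := fun y γ hγ => ?_
      le_slope := fun y γ hγ => ?_
      prior_pos := hπ.1
      prior_le_one := hπ.2.le
      W_mem := hmem
      strict := hstrict
      contW := ?_
      contF := continuous_measureReal_Iic μ
      F_zero := ?_
      F_one := ?_
      F_eq := fun t ht => ?_
      F_slope_ge := fun a ha b hb hab => ?_
      F_slope_le := fun a ha b hb hab => ?_ }
  · rw [hGν, measureReal_def, measure_mono_null (fun t ht => ?_) (lfdr_law_compl hW),
      ENNReal.toReal_zero]
    exact fun h => absurd (h.1.trans_le ht) (not_lt.2 hy)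
  · have : {t | W t ≤ 1} = univ := eq_univ_of_forall fun t => (hmem t).2
    change μ.real {t | W t ≤ 1} = 1
    rw [this, probReal_univ]
  · rw [hGν, measureReal_def]
    refine ENNReal.toReal_pos (ne_of_gt ?_) (measure_ne_top _ _)
    refine (lfdr_law_Ioo_pos hg hg0 hW le_rfl (lt_min hy one_pos) (min_le_right y 1)).trans_le
      (measure_mono fun t ht => ?_)
    exact ht.2.le.trans (min_le_left _ _)
  · rw [hGν]
    have h2 := probReal_add_probReal_compl (μ := ν) (measurableSet_Iic (a := y))
    have h3 : 0 < ν.real (Iic y)ᶜ := by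
      refine ENNReal.toReal_pos (ne_of_gt ?_) (measure_ne_top _ _)
      refine (lfdr_law_Ioo_pos hg hg0 hW (le_max_right y 0) (max_lt hy one_pos) le_rfl).trans_le
        (measure_mono fun t ht => ?_)
      exact not_le.2 ((le_max_left _ _).trans_lt ht.1)
    linarith
  · refine integral_eq_zero_of_ae (Eventually.of_forall fun t => ?_)
    exact max_eq_right (by linarith [(hmem t).1])
  · rw [lfdrPhi, lfdrPhi, ← integral_sub (hint _) (hint _), ← hind]
    refine integral_mono (hindint _ _) ((hint _).sub (hint _)) fun t => ?_
    dsimp only [Pi.sub_apply]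
    split_ifs with h
    · rw [max_eq_left (by linarith), max_eq_left (by linarith)]
      linarith
    · rw [sub_nonneg]
      exact max_le_max_right _ (by linarith)
  · rw [lfdrPhi, lfdrPhi, ← integral_sub (hint _) (hint _), ← hind]
    refine integral_mono ((hint _).sub (hint _)) (hindint _ _) fun t => ?_
    dsimp only [Pi.sub_apply]
    split_ifs with h
    · rw [max_eq_left (by linarith : 0 ≤ y + γ - W t)]
      linarith [le_max_left (y - W t) 0]
    · rw [max_eq_right (by linarith), max_eq_right (by linarith), sub_self]
  · refine ContinuousOn.congr (f := fun t => π₀ / (π₀ + (1 - π₀) * f₁ t)) ?_ fun t ht => ?_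
    · refine continuousOn_const.div (continuousOn_const.add (continuousOn_const.mul hcont))
        fun t ht => ?_
      rw [← mixPdf_of_mem ht]
      exact (hπ.1.trans_le (hfpos t ht)).ne'
    · rw [hWd, lfdr_of_mem ht, mixPdf_of_mem ht]
  · have : μ (Iic 0) = 0 := by
      refine measure_mono_null (fun t ht => ?_) (ae_iff.1 hsupp)
      exact fun h => absurd h.1 (not_lt.2 ht)
    simp [measureReal_def, this]
  · have : μ (Iic 1) = 1 := by
      rw [← measure_univ (μ := μ)]
      refine measure_congr ?_
      filter_upwards [hsupp] with t ht
      exact propext ⟨fun _ => mem_univ t, fun _ => ht.2.le⟩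
    simp [measureReal_def, this]
  · refine measureReal_congr ?_
    filter_upwards [hsupp] with s hs
    exact propext (hstrict.le_iff_le hs ht).symm
  · rw [hFsub a b hab, ← hWf b hb, mul_assoc]
    refine mul_le_mul_of_nonneg_left ?_ (hmem b).1
    exact measureReal_Ioo_ge hπI hf hf0 h1 (hπ.1.le.trans (hfpos b hb)) fun t ht =>
      hfanti ⟨ha.1.trans_lt ht.1, ht.2.trans hb.2⟩ hb ht.2.le
  · rw [hFsub a b hab, ← hWf a ha, mul_assoc]
    refine mul_le_mul_of_nonneg_left ?_ (hmem a).1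
    exact measureReal_Ioo_le hab (hπ.1.le.trans (hfpos a ha)) fun t ht =>
      hfanti ha ⟨ha.1.trans ht.1, ht.2.trans_le hb.2⟩ ht.1.le

end Population

end TwoGroup

namespace TwoGroup

/-! ### Law of large numbers -/

/-- Chebyshev's inequality, with the bound (M/2)² for the variance of a variable with values in [0,
M]. -/
theorem measure_pi_mean_deviation (μ : Measure ℝ) [IsProbabilityMeasure μ] {h : ℝ → ℝ}
    (hh : Measurable h) {M : ℝ} (hM : ∀ t, h t ∈ Icc 0 M) {n : ℕ} (hn : 0 < n) {c : ℝ}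
    (hc : 0 < c) :
    (Measure.pi fun _ : Fin n => μ).real {x | c ≤ |(∑ i, h (x i)) / n - ∫ t, h t ∂μ|} ≤
      (M / 2) ^ 2 / (n * c ^ 2) := by
  have hn' : (0 : ℝ) < n := by exact_mod_cast hn
  have hL : MemLp h 2 μ := MemLp.of_bound hh.aestronglyMeasurable M
    (Eventually.of_forall fun t => by
      rw [Real.norm_eq_abs, abs_of_nonneg (hM t).1]
      exact (hM t).2)
  have hint : Integrable h μ := hL.integrable one_le_two
  have hLi : ∀ i : Fin n, MemLp (fun x : Fin n → ℝ => h (x i)) 2 (Measure.pi fun _ => μ) := fun i =>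
    hL.comp_measurePreserving (measurePreserving_eval (fun _ : Fin n => μ) i)
  have hX : MemLp (∑ i : Fin n, fun x : Fin n → ℝ => h (x i)) 2 (Measure.pi fun _ => μ) :=
    memLp_finsetSum' _ fun i _ => hLi i
  have hE : ∫ x, (∑ i : Fin n, fun x : Fin n → ℝ => h (x i)) x ∂(Measure.pi fun _ => μ) =
      n * ∫ t, h t ∂μ := by
    simp only [Finset.sum_apply]
    rw [integral_finsetSum _ fun i _ => (hLi i).integrable one_le_two]
    have : ∀ i : Fin n, ∫ x : Fin n → ℝ, h (x i) ∂(Measure.pi fun _ => μ) = ∫ t, h t ∂μ := by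
      intro i
      have hmp := measurePreserving_eval (fun _ : Fin n => μ) i
      refine (integral_map hmp.measurable.aemeasurable (f := h) hh.aestronglyMeasurable).symm.trans ?_
      rw [hmp.map_eq]
    simp [this]
  have hV : Var[∑ i : Fin n, fun x : Fin n → ℝ => h (x i); Measure.pi fun _ => μ] ≤
      n * (M / 2) ^ 2 := by
    rw [variance_sum_pi fun _ => hL, Finset.sum_const, Finset.card_univ, Fintype.card_fin,
      nsmul_eq_mul]
    refine mul_le_mul_of_nonneg_left ?_ hn'.le
    have := variance_le_sq_of_bounded (μ := μ) (Eventually.of_forall hM) hh.aemeasurable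
    rwa [sub_zero] at this
  have hcheb := meas_ge_le_variance_div_sq hX (mul_pos hn' hc)
  rw [hE] at hcheb
  have hset : {x : Fin n → ℝ | c ≤ |(∑ i, h (x i)) / n - ∫ t, h t ∂μ|} =
      {x | n * c ≤ |(∑ i : Fin n, fun x : Fin n → ℝ => h (x i)) x - n * ∫ t, h t ∂μ|} := by
    ext x
    simp only [mem_ofPred_eq, Finset.sum_apply]
    have : (∑ i, h (x i)) - n * ∫ t, h t ∂μ = n * ((∑ i, h (x i)) / n - ∫ t, h t ∂μ) := by
      field_simp
    rw [this, abs_mul, abs_of_pos hn', mul_le_mul_iff_right₀ hn']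
  rw [hset]
  refine (ENNReal.toReal_le_of_le_ofReal (div_nonneg (variance_nonneg _ _) (by positivity))
    hcheb).trans ?_
  refine (div_le_div_of_nonneg_right hV (by positivity)).trans (le_of_eq ?_)
  field_simp

/-- On [0,1] both functions increase with slope at most 1, so a grid of mesh 1/m loses at most 1/m.
Below 0 both vanish and above 1 both have slope 1. -/
theorem near_of_grid {φ G : ℝ → ℝ} (hc : IsCurve φ G) {n m : ℕ} (hn : 0 < n) (hm : 0 < m)
    {w : Fin n → ℝ} (hw : ∀ i, w i ∈ Icc (0 : ℝ) 1) {δ : ℝ}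
    (h : ∀ j ∈ Finset.range (m + 1), |avgPos w (j / m) - φ (j / m)| ≤ δ) :
    Near φ (δ + 1 / m) w := by
  have hn' : (n : ℝ) ≠ 0 := by exact_mod_cast hn.ne'
  have hm' : (0 : ℝ) < m := by exact_mod_cast hm
  have hm1 : 0 < 1 / (m : ℝ) := by positivity
  have hmid : ∀ y ∈ Icc (0 : ℝ) 1, |avgPos w y - φ y| ≤ δ + 1 / m := by
    intro y hy
    have hym : 0 ≤ y * m := mul_nonneg hy.1 hm'.le
    have h1 := Nat.floor_le hym
    have h2 := Nat.lt_floor_add_one (y * m)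
    set j := ⌊y * m⌋₊
    have hj : j ∈ Finset.range (m + 1) := by
      rw [Finset.mem_range, Nat.lt_succ_iff]
      have : (j : ℝ) ≤ m := h1.trans (mul_le_of_le_one_left hm'.le hy.2)
      exact_mod_cast this
    have h3 : (j : ℝ) / m ≤ y := (div_le_iff₀ hm').2 h1
    have h4 : y - j / m ≤ 1 / m := by
      rw [sub_le_iff_le_add, ← add_div, le_div_iff₀ hm']
      linarith
    have h5 := abs_le.1 (h j hj)
    have h6 := avgPos_slope w (j / m) (sub_nonneg.2 h3)
    have h7 := hc.slope_le (j / m) (y - j / m) (sub_nonneg.2 h3)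
    have h8 := hc.le_slope (j / m) (y - j / m) (sub_nonneg.2 h3)
    rw [add_sub_cancel] at h6 h7 h8
    have h9 := mul_le_of_le_one_right (sub_nonneg.2 h3) (ecdf_le_one w y)
    have h10 := mul_le_of_le_one_right (sub_nonneg.2 h3) (hc.le_one hy.2)
    have h11 := mul_nonneg (sub_nonneg.2 h3) (ecdf_nonneg w (j / m))
    have h12 := mul_nonneg (sub_nonneg.2 h3) (hc.nonneg (j / m))
    rw [abs_le]
    constructor <;> linarith [h6.1, h6.2]
  intro y
  rcases lt_or_ge y 0 with hy0 | hy0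
  · have h1 : avgPos w y = 0 := by
      rw [avgPos, Finset.sum_eq_zero fun i _ => max_eq_right (by linarith [(hw i).1]), zero_div]
    have h2 : φ y = 0 := by
      have h3 := hc.slope_le y (-y) (by linarith)
      have h4 := hc.le_slope y (-y) (by linarith)
      rw [add_neg_cancel, hc.phi_zero, hc.zero 0 le_rfl] at h4
      rw [add_neg_cancel, hc.phi_zero, hc.zero y hy0.le] at h3
      linarith
    rw [h1, h2, sub_self, abs_zero]
    exact (abs_nonneg _).trans (hmid 0 ⟨le_rfl, zero_le_one⟩)
  rcases le_or_gt y 1 with hy1 | hy1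
  · exact hmid y ⟨hy0, hy1⟩
  · have h1 := hmid 1 ⟨zero_le_one, le_rfl⟩
    have hγ : 0 ≤ y - 1 := by linarith
    have h3 := hc.slope_le 1 (y - 1) hγ
    have h4 := hc.le_slope 1 (y - 1) hγ
    have h5 := avgPos_slope w 1 hγ
    have h6 : ecdf w 1 = 1 := by simp [ecdf, (hw _).2, hn']
    have h7 := mul_le_of_le_one_right hγ (ecdf_le_one w y)
    rw [add_sub_cancel] at h3 h4 h5
    rw [h6, mul_one] at h5
    rw [hc.one, mul_one] at h3
    have h8 := mul_le_of_le_one_right hγ (hc.bound y)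
    have h9 : avgPos w y - φ y = avgPos w 1 - φ 1 := by linarith [h5.1, h5.2]
    rwa [h9]

section Model

variable {π₀ : ℝ} {f₁ : ℝ → ℝ}

/-- With probability tending to one, the local false discovery rates are close to their law. -/
theorem exists_bad_sets (hπ : π₀ ∈ Icc (0 : ℝ) 1) (hf : Measurable f₁) (hf0 : ∀ x, 0 ≤ f₁ x)
    (h1 : ∫⁻ x, ENNReal.ofReal (f₁ x) = 1) {G : ℝ → ℝ} (hc : IsCurve (lfdrPhi π₀ f₁) G) {δ : ℝ}
    (hδ : 0 < δ) : ∃ B : ∀ n : ℕ, Set (Fin n → ℝ), (∀ n, MeasurableSet (B n)) ∧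
      Tendsto (fun n => (obsLaw π₀ unifPdf f₁ n).real (B n)) atTop (𝓝 0) ∧
      ∀ n, 0 < n → ∀ x ∉ B n, Near (lfdrPhi π₀ f₁) δ (fun i => lfdr π₀ unifPdf f₁ (x i)) := by
  have hprob := isProbabilityMeasure_margLaw hπ hf hf0 h1
  obtain ⟨m, hm⟩ := exists_nat_gt (2 / δ)
  have hm0 : (0 : ℝ) < m := lt_trans (by positivity) hm
  have hm0' : 0 < m := by exact_mod_cast hm0
  have hmδ : 1 / (m : ℝ) ≤ δ / 2 := by
    rw [div_lt_iff₀ hδ] at hm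
    rw [div_le_iff₀ hm0]
    linarith
  have hWm := measurable_lfdr (π₀ := π₀) hf
  set W := lfdr π₀ unifPdf f₁
  set φ := lfdrPhi π₀ f₁
  have hhm : ∀ y : ℝ, Measurable fun t => max (y - W t) 0 := fun y =>
    (hWm.const_sub y).max measurable_const
  have hmeas : ∀ n : ℕ, ∀ j : ℕ, MeasurableSet
      {x : Fin n → ℝ | δ / 2 ≤ |(∑ i, max ((j / m : ℝ) - W (x i)) 0) / n - φ (j / m)|} := by
    intro n j
    refine measurableSet_le measurable_const (Measurable.abs ?_)
    refine ((Finset.measurable_sum _ fun i _ => ?_).div_const _).sub_const _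
    exact (hhm _).comp (measurable_pi_apply i)
  -- The exceptional event involves only m + 1 grid points, so a union bound over Chebyshev
  -- estimates suffices.
  refine ⟨fun n => ⋃ j ∈ Finset.range (m + 1),
    {x : Fin n → ℝ | δ / 2 ≤ |(∑ i, max ((j / m : ℝ) - W (x i)) 0) / n - φ (j / m)|},
    fun n => Finset.measurableSet_biUnion _ fun j _ => hmeas n j, ?_, ?_⟩
  · have hlim : Tendsto (fun n : ℕ => ((m + 1 : ℕ) * ((1 / 2) ^ 2 / (δ / 2) ^ 2) : ℝ) / n) atTop
        (𝓝 0) := tendsto_const_div_atTop_nhds_zero_nat _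
    refine squeeze_zero' (Eventually.of_forall fun n => measureReal_nonneg) ?_ hlim
    filter_upwards [eventually_gt_atTop 0] with n hn
    refine (measureReal_biUnion_finset_le _ _).trans ?_
    refine (Finset.sum_le_card_nsmul _ _ ((1 / 2) ^ 2 / (n * (δ / 2) ^ 2)) fun j hj => ?_).trans
      (le_of_eq ?_)
    · have hj1 : (j : ℝ) / m ≤ 1 := by
        rw [div_le_one hm0]
        exact_mod_cast Nat.lt_succ_iff.1 (Finset.mem_range.1 hj)
      refine measure_pi_mean_deviation (margLaw π₀ f₁) (hhm _) (M := 1) (fun t => ?_) hn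
        (half_pos hδ)
      refine ⟨le_max_right _ _, max_le ?_ zero_le_one⟩
      linarith [(lfdr_mem hπ hf0 t).1]
    · rw [Finset.card_range, nsmul_eq_mul]
      field_simp
  · intro n hn x hx
    simp only [mem_iUnion, not_exists, mem_ofPred_eq, not_le] at hx
    refine (near_of_grid hc hn hm0' (fun i => lfdr_mem hπ hf0 (x i)) (δ := δ / 2)
      fun j hj => (hx j hj).le).mono (by linarith)

end Model

end TwoGroup

namespace TwoGroup

/-! ### Error rates as posterior expectations -/

section Posterior

variable {π₀ : ℝ} {f₁ : ℝ → ℝ}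

theorem isProbabilityMeasure_pairLaw (hπ : π₀ ∈ Icc (0 : ℝ) 1)
    (h1 : ∫⁻ x, ENNReal.ofReal (f₁ x) = 1) : IsProbabilityMeasure (pairLaw π₀ unifPdf f₁) := by
  have := isProbabilityMeasure_densLaw h1
  refine ⟨?_⟩
  simp only [pairLaw, Measure.add_apply, Measure.smul_apply, measure_univ, smul_eq_mul, mul_one]
  rw [← ENNReal.ofReal_add hπ.1 (by linarith [hπ.2]), add_sub_cancel, ENNReal.ofReal_one]

theorem map_snd_pairLaw (hπ : π₀ ∈ Icc (0 : ℝ) 1) (hf : Measurable f₁) (hf0 : ∀ x, 0 ≤ f₁ x)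
    (h1 : ∫⁻ x, ENNReal.ofReal (f₁ x) = 1) :
    (pairLaw π₀ unifPdf f₁).map Prod.snd = margLaw π₀ f₁ := by
  have := isProbabilityMeasure_densLaw h1
  rw [pairLaw, Measure.map_add _ _ measurable_snd, Measure.map_smul, Measure.map_smul,
    Measure.map_snd_prod, Measure.map_snd_prod, measure_univ, measure_univ, one_smul, one_smul,
    margLaw_eq hπ hf hf0]

/-- The pairs with label `false`. -/
def nullPairs : Set (Bool × ℝ) := {p | p.1 = false}

/-- Bayes' formula in the form π₀ f₀ = W f, which avoids conditional distributions. -/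
theorem map_snd_pairLaw_restrict (hπ : π₀ ∈ Icc (0 : ℝ) 1) (hf : Measurable f₁)
    (hf0 : ∀ x, 0 ≤ f₁ x) (h1 : ∫⁻ x, ENNReal.ofReal (f₁ x) = 1) :
    ((pairLaw π₀ unifPdf f₁).restrict nullPairs).map Prod.snd =
      (margLaw π₀ f₁).withDensity fun t => ENNReal.ofReal (lfdr π₀ unifPdf f₁ t) := by
  have := isProbabilityMeasure_densLaw h1
  have e1 : ((Measure.dirac false).prod (densLaw unifPdf)).restrict nullPairs =
      (Measure.dirac false).prod (densLaw unifPdf) := by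
    have : nullPairs = {false} ×ˢ univ := by
      ext p
      simp [nullPairs]
    rw [this, ← Measure.prod_restrict, Measure.restrict_univ, MeasureTheory.restrict_dirac]
    simp
  have e2 : ((Measure.dirac true).prod (densLaw f₁)).restrict nullPairs = 0 := by
    have : nullPairs = {false} ×ˢ univ := by
      ext p
      simp [nullPairs]
    rw [this, ← Measure.prod_restrict, Measure.restrict_univ, MeasureTheory.restrict_dirac]
    simp
  have e3 : (margLaw π₀ f₁).withDensity (fun t => ENNReal.ofReal (lfdr π₀ unifPdf f₁ t)) =
      ENNReal.ofReal π₀ • densLaw unifPdf := by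
    unfold margLaw densLaw
    rw [← withDensity_mul _ (measurable_mixPdf hf).ennreal_ofReal
      (measurable_lfdr hf).ennreal_ofReal, ← withDensity_smul _ measurable_unifPdf.ennreal_ofReal]
    congr 1
    funext t
    have h2 := mul_nonneg hπ.1 (unifPdf_nonneg t)
    have h3 := mul_nonneg (by linarith [hπ.2] : 0 ≤ 1 - π₀) (hf0 t)
    have h4 : 0 ≤ mixPdf π₀ unifPdf f₁ t := add_nonneg h2 h3
    simp only [Pi.mul_apply, Pi.smul_apply, smul_eq_mul]
    rw [← ENNReal.ofReal_mul h4, ← ENNReal.ofReal_mul hπ.1]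
    congr 1
    -- Where the mixture density vanishes, so does its nonnegative summand π₀ f₀.
    by_cases h0 : mixPdf π₀ unifPdf f₁ t = 0
    · rw [h0, zero_mul]
      have : π₀ * unifPdf t + (1 - π₀) * f₁ t = 0 := h0
      linarith
    · rw [lfdr, mul_div_cancel₀ _ h0]
  rw [e3, pairLaw, Measure.restrict_add, Measure.restrict_smul, Measure.restrict_smul, e1, e2,
    smul_zero, add_zero, Measure.map_smul, Measure.map_snd_prod, measure_univ, one_smul]

variable {n : ℕ}

/-- The observations among the pairs. -/
def obs (ω : Fin n → Bool × ℝ) (i : Fin n) : ℝ := (ω i).2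

theorem measurable_obs : Measurable (obs (n := n)) :=
  measurable_pi_iff.2 fun i => measurable_snd.comp (measurable_pi_apply i)

theorem map_obs_modelLaw (hπ : π₀ ∈ Icc (0 : ℝ) 1) (hf : Measurable f₁)
    (hf0 : ∀ x, 0 ≤ f₁ x) (h1 : ∫⁻ x, ENNReal.ofReal (f₁ x) = 1) :
    (modelLaw π₀ unifPdf f₁ n).map obs = obsLaw π₀ unifPdf f₁ n := by
  have := isProbabilityMeasure_margLaw hπ hf hf0 h1
  have hms := map_snd_pairLaw hπ hf hf0 h1
  have : SigmaFinite ((pairLaw π₀ unifPdf f₁).map Prod.snd) := by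
    rw [hms]
    infer_instance
  refine (Measure.pi_map_pi (μ := fun _ : Fin n => pairLaw π₀ unifPdf f₁) (f := fun _ => Prod.snd)
    fun _ => measurable_snd.aemeasurable).trans ?_
  rw [hms]
  rfl

/-- On boxes the integrand factorizes over the coordinates, and only factor i carries the density.
-/
theorem withDensity_pi_eval (μ : Measure ℝ) [IsProbabilityMeasure μ] {h : ℝ → ℝ≥0∞}
    (hh : Measurable h) (i : Fin n) [SigmaFinite (μ.withDensity h)] :
    (Measure.pi fun _ : Fin n => μ).withDensity (fun x => h (x i)) =
      Measure.pi fun j => if j = i then μ.withDensity h else μ := by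
  classical
  have hsf : ∀ j, SigmaFinite (if j = i then μ.withDensity h else μ) := fun j => by
    split_ifs <;> infer_instance
  refine (Measure.pi_eq fun s hs => ?_).symm
  rw [withDensity_apply _ (MeasurableSet.univ_pi hs),
    ← lintegral_indicator (MeasurableSet.univ_pi hs)]
  have hX : ∀ j, Measurable ((s j).indicator (if j = i then h else 1)) := fun j =>
    Measurable.indicator (by split_ifs; exacts [hh, measurable_one]) (hs j)
  have e1 : (univ.pi s).indicator (fun x : Fin n → ℝ => h (x i)) =
      fun x => ∏ j, (s j).indicator (if j = i then h else 1) (x j) := by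
    funext x
    by_cases hx : x ∈ univ.pi s
    · rw [indicator_of_mem hx, Finset.prod_eq_single i]
      · rw [indicator_of_mem (hx i (mem_univ i)), if_pos rfl]
      · intro j _ hj
        rw [indicator_of_mem (hx j (mem_univ j)), if_neg hj, Pi.one_apply]
      · simp
    · rw [indicator_of_notMem hx]
      obtain ⟨j, hj⟩ : ∃ j, x j ∉ s j := by
        by_contra hcon
        push Not at hcon
        exact hx fun j _ => hcon j
      exact (Finset.prod_eq_zero (Finset.mem_univ j) (indicator_of_notMem hj _)).symm
  rw [e1]
  have hind := iIndepFun_pi (μ := fun _ : Fin n => μ) fun j => (hX j).aemeasurable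
  rw [lintegral_prod_eq_prod_lintegral_of_indepFun _ _ hind
    fun j => (hX j).comp (measurable_pi_apply j)]
  refine Finset.prod_congr rfl fun j _ => ?_
  have hmp := measurePreserving_eval (fun _ : Fin n => μ) j
  have e2 := hmp.lintegral_comp (hX j)
  refine e2.trans ?_
  rw [lintegral_indicator (hs j)]
  split_ifs with hj
  · rw [withDensity_apply _ (hs j)]
  · simp

theorem map_obs_modelLaw_restrict (hπ : π₀ ∈ Icc (0 : ℝ) 1) (hf : Measurable f₁)
    (hf0 : ∀ x, 0 ≤ f₁ x) (h1 : ∫⁻ x, ENNReal.ofReal (f₁ x) = 1) (i : Fin n) :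
    ((modelLaw π₀ unifPdf f₁ n).restrict {ω | (ω i).1 = false}).map obs =
      (obsLaw π₀ unifPdf f₁ n).withDensity
        fun x => ENNReal.ofReal (lfdr π₀ unifPdf f₁ (x i)) := by
  classical
  have := isProbabilityMeasure_margLaw hπ hf hf0 h1
  have := isProbabilityMeasure_pairLaw hπ h1
  have hms := map_snd_pairLaw hπ hf hf0 h1
  have hmr := map_snd_pairLaw_restrict hπ hf hf0 h1
  have hfin : IsFiniteMeasure ((margLaw π₀ f₁).withDensity
      fun t => ENNReal.ofReal (lfdr π₀ unifPdf f₁ t)) := by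
    rw [← hmr]
    infer_instance
  have hset : {ω : Fin n → Bool × ℝ | (ω i).1 = false} =
      univ.pi fun j => if j = i then nullPairs else univ := by
    ext ω
    simp only [mem_ofPred_eq, mem_univ_pi]
    constructor
    · intro h j
      split_ifs with hj
      · exact hj ▸ h
      · trivial
    · intro h
      have := h i
      rwa [if_pos rfl] at this
  have e1 : (modelLaw π₀ unifPdf f₁ n).restrict {ω | (ω i).1 = false} =
      Measure.pi fun j => (pairLaw π₀ unifPdf f₁).restrict (if j = i then nullPairs else univ) := by
    rw [hset, modelLaw, Measure.restrict_pi_pi]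
  have hfam : ∀ j, ((pairLaw π₀ unifPdf f₁).restrict (if j = i then nullPairs else univ)).map
      Prod.snd = if j = i then (margLaw π₀ f₁).withDensity
        (fun t => ENNReal.ofReal (lfdr π₀ unifPdf f₁ t)) else margLaw π₀ f₁ := fun j => by
    split_ifs
    · exact hmr
    · rw [Measure.restrict_univ, hms]
  have e2 := Measure.pi_map_pi (μ := fun j => (pairLaw π₀ unifPdf f₁).restrict
    (if j = i then nullPairs else univ)) (f := fun _ => Prod.snd)
    fun _ => measurable_snd.aemeasurable
  rw [e1]
  refine e2.trans ?_
  simp_rw [hfam]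
  exact (withDensity_pi_eval (margLaw π₀ f₁) (measurable_lfdr hf).ennreal_ofReal i).symm

theorem integral_obs (hπ : π₀ ∈ Icc (0 : ℝ) 1) (hf : Measurable f₁)
    (hf0 : ∀ x, 0 ≤ f₁ x) (h1 : ∫⁻ x, ENNReal.ofReal (f₁ x) = 1) {q : (Fin n → ℝ) → ℝ}
    (hq : Measurable q) :
    ∫ ω, q (obs ω) ∂(modelLaw π₀ unifPdf f₁ n) = ∫ x, q x ∂(obsLaw π₀ unifPdf f₁ n) := by
  rw [← map_obs_modelLaw hπ hf hf0 h1, integral_map measurable_obs.aemeasurable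
    hq.aestronglyMeasurable]

theorem integral_obs_null (hπ : π₀ ∈ Icc (0 : ℝ) 1) (hf : Measurable f₁)
    (hf0 : ∀ x, 0 ≤ f₁ x) (h1 : ∫⁻ x, ENNReal.ofReal (f₁ x) = 1) {q : (Fin n → ℝ) → ℝ}
    (hq : Measurable q) (i : Fin n) :
    ∫ ω, q (obs ω) * (if (ω i).1 = false then 1 else 0) ∂(modelLaw π₀ unifPdf f₁ n) =
      ∫ x, q x * lfdr π₀ unifPdf f₁ (x i) ∂(obsLaw π₀ unifPdf f₁ n) := by
  have hms : MeasurableSet {ω : Fin n → Bool × ℝ | (ω i).1 = false} :=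
    (measurable_fst.comp (measurable_pi_apply i)) (measurableSet_singleton false)
  have e1 : (fun ω : Fin n → Bool × ℝ => q (obs ω) * (if (ω i).1 = false then 1 else 0)) =
      {ω : Fin n → Bool × ℝ | (ω i).1 = false}.indicator fun ω => q (obs ω) := by
    funext ω
    by_cases h : (ω i).1 = false <;> simp [h]
  rw [e1, integral_indicator hms, ← integral_map (φ := obs) measurable_obs.aemeasurable
    hq.aestronglyMeasurable, map_obs_modelLaw_restrict hπ hf hf0 h1,
    integral_withDensity_eq_integral_toReal_smul]
  · refine integral_congr_ae (Eventually.of_forall fun x => ?_)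
    simp only [smul_eq_mul]
    rw [ENNReal.toReal_ofReal (lfdr_mem hπ hf0 _).1, mul_comm]
  · exact ((measurable_lfdr hf).comp (measurable_pi_apply i)).ennreal_ofReal
  · exact Eventually.of_forall fun x => ENNReal.ofReal_lt_top

/-- For fixed decisions the proportion is linear in the null indicators, so averaging over the
labels merely replaces each indicator by the local false discovery rate. -/
theorem fdp_eq (θ d : Fin n → Bool) : fdp θ d = ∑ i,
    (if d i = true then 1 else 0) / max 1 (∑ i, if d i = true then (1 : ℝ) else 0) *
      (if θ i = false then 1 else 0) := by
  unfold fdp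
  rw [Finset.sum_div]
  refine Finset.sum_congr rfl fun i _ => ?_
  by_cases h : d i = true <;> by_cases h' : θ i = false <;> simp [h, h']

theorem fnp_eq (θ d : Fin n → Bool) : fnp θ d = ∑ i,
    (if d i = false then 1 else 0) / max 1 (∑ i, if d i = false then (1 : ℝ) else 0) *
      (1 - if θ i = false then 1 else 0) := by
  unfold fnp
  rw [Finset.sum_div]
  refine Finset.sum_congr rfl fun i _ => ?_
  by_cases h : d i = false <;> by_cases h' : θ i = false <;> simp [h, h']

theorem postFdp_eq (w : Fin n → ℝ) (d : Fin n → Bool) : postFdp w d = ∑ i,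
    (if d i = true then 1 else 0) / max 1 (∑ i, if d i = true then (1 : ℝ) else 0) * w i := by
  unfold postFdp
  rw [Finset.sum_div]
  refine Finset.sum_congr rfl fun i _ => ?_
  by_cases h : d i = true <;> simp [h, div_eq_inv_mul]

theorem postFnp_eq (w : Fin n → ℝ) (d : Fin n → Bool) : postFnp w d = ∑ i,
    (if d i = false then 1 else 0) / max 1 (∑ i, if d i = false then (1 : ℝ) else 0) *
      (1 - w i) := by
  unfold postFnp
  rw [Finset.sum_div]
  refine Finset.sum_congr rfl fun i _ => ?_
  by_cases h : d i = false <;> simp [h, div_eq_inv_mul]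

/-- Posterior integration of a linear functional of the labels. -/
theorem integral_labels (hπ : π₀ ∈ Icc (0 : ℝ) 1) (hf : Measurable f₁)
    (hf0 : ∀ x, 0 ≤ f₁ x) (h1 : ∫⁻ x, ENNReal.ofReal (f₁ x) = 1)
    (κ : Kernel (Fin n → ℝ) (Fin n → Bool)) [IsMarkovKernel κ] (a b : (Fin n → Bool) → Fin n → ℝ) :
    ∫ ω, (∫ d, ∑ i, (a d i + b d i * (if (ω i).1 = false then 1 else 0)) ∂(κ (obs ω)))
        ∂(modelLaw π₀ unifPdf f₁ n) =
      ∫ x, (∫ d, ∑ i, (a d i + b d i * lfdr π₀ unifPdf f₁ (x i)) ∂(κ x))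
        ∂(obsLaw π₀ unifPdf f₁ n) := by
  have hpm := isProbabilityMeasure_margLaw hπ hf hf0 h1
  have hpp := isProbabilityMeasure_pairLaw hπ h1
  have : IsProbabilityMeasure (modelLaw π₀ unifPdf f₁ n) := by
    unfold modelLaw
    infer_instance
  have : IsProbabilityMeasure (obsLaw π₀ unifPdf f₁ n) := by
    change IsProbabilityMeasure (Measure.pi fun _ => margLaw π₀ f₁)
    infer_instance
  have hqm : ∀ d : Fin n → Bool, Measurable fun x => (κ x).real {d} := fun d =>
    (κ.measurable_coe (measurableSet_singleton d)).ennreal_toReal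
  have hq1 : ∀ d x, ‖(κ x).real {d}‖ ≤ 1 := fun d x => by
    rw [Real.norm_eq_abs, abs_of_nonneg measureReal_nonneg]
    exact measureReal_le_one
  have hWm : ∀ i : Fin n, Measurable fun x : Fin n → ℝ => lfdr π₀ unifPdf f₁ (x i) := fun i =>
    (measurable_lfdr hf).comp (measurable_pi_apply i)
  have hθm : ∀ i : Fin n, Measurable fun ω : Fin n → Bool × ℝ =>
      if (ω i).1 = false then (1 : ℝ) else 0 := fun i =>
    Measurable.ite ((measurable_fst.comp (measurable_pi_apply i)) (measurableSet_singleton false))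
      measurable_const measurable_const
  have hsum : ∀ (x : Fin n → ℝ) (v : Fin n → ℝ), ∫ d, ∑ i, (a d i + b d i * v i) ∂(κ x) =
      ∑ d, ∑ i, (a d i * (κ x).real {d} + b d i * ((κ x).real {d} * v i)) := by
    intro x v
    rw [integral_fintype Integrable.of_finite]
    refine Finset.sum_congr rfl fun d _ => ?_
    rw [smul_eq_mul, Finset.mul_sum]
    refine Finset.sum_congr rfl fun i _ => ?_
    ring
  simp_rw [hsum]
  have i1 : ∀ d, Integrable (fun ω => (κ (obs ω)).real {d}) (modelLaw π₀ unifPdf f₁ n) := fun d =>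
    Integrable.of_bound ((hqm d).comp measurable_obs).aestronglyMeasurable 1
      (Eventually.of_forall fun ω => hq1 d _)
  have i2 : ∀ d, Integrable (fun x => (κ x).real {d}) (obsLaw π₀ unifPdf f₁ n) := fun d =>
    Integrable.of_bound (hqm d).aestronglyMeasurable 1 (Eventually.of_forall fun ω => hq1 d _)
  have i3 : ∀ d (i : Fin n), Integrable (fun ω => (κ (obs ω)).real {d} *
      (if (ω i).1 = false then (1 : ℝ) else 0)) (modelLaw π₀ unifPdf f₁ n) := fun d i =>
    Integrable.of_bound
      (((hqm d).comp measurable_obs).mul (hθm i)).aestronglyMeasurable 1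
      (Eventually.of_forall fun ω => by
        rw [norm_mul]
        refine mul_le_one₀ (hq1 d _) (norm_nonneg _) ?_
        split_ifs <;> simp)
  have i4 : ∀ d (i : Fin n), Integrable (fun x => (κ x).real {d} * lfdr π₀ unifPdf f₁ (x i))
      (obsLaw π₀ unifPdf f₁ n) := fun d i =>
    Integrable.of_bound ((hqm d).mul (hWm i)).aestronglyMeasurable 1
      (Eventually.of_forall fun x => by
        rw [norm_mul]
        refine mul_le_one₀ (hq1 d _) (norm_nonneg _) ?_
        rw [Real.norm_eq_abs, abs_of_nonneg (lfdr_mem hπ hf0 _).1]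
        exact (lfdr_mem hπ hf0 _).2)
  have L1 : ∀ d (i : Fin n), Integrable (fun ω => a d i * (κ (obs ω)).real {d} +
      b d i * ((κ (obs ω)).real {d} * (if (ω i).1 = false then (1 : ℝ) else 0)))
      (modelLaw π₀ unifPdf f₁ n) := fun d i => ((i1 d).const_mul _).add ((i3 d i).const_mul _)
  have L2 : ∀ d (i : Fin n), Integrable (fun x => a d i * (κ x).real {d} +
      b d i * ((κ x).real {d} * lfdr π₀ unifPdf f₁ (x i)))
      (obsLaw π₀ unifPdf f₁ n) := fun d i => ((i2 d).const_mul _).add ((i4 d i).const_mul _)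
  rw [integral_finsetSum _ fun d _ => integrable_finsetSum _ fun i _ => L1 d i,
    integral_finsetSum _ fun d _ => integrable_finsetSum _ fun i _ => L2 d i]
  refine Finset.sum_congr rfl fun d _ => ?_
  rw [integral_finsetSum _ fun i _ => L1 d i, integral_finsetSum _ fun i _ => L2 d i]
  refine Finset.sum_congr rfl fun i _ => ?_
  rw [integral_add ((i1 d).const_mul _) ((i3 d i).const_mul _),
    integral_add ((i2 d).const_mul _) ((i4 d i).const_mul _), integral_const_mul,
    integral_const_mul, integral_const_mul, integral_const_mul,
    integral_obs hπ hf hf0 h1 (hqm d), integral_obs_null hπ hf hf0 h1 (hqm d)]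

theorem FDR_eq (hπ : π₀ ∈ Icc (0 : ℝ) 1) (hf : Measurable f₁)
    (hf0 : ∀ x, 0 ≤ f₁ x) (h1 : ∫⁻ x, ENNReal.ofReal (f₁ x) = 1)
    (κ : Kernel (Fin n → ℝ) (Fin n → Bool)) [IsMarkovKernel κ] :
    FDR π₀ unifPdf f₁ (fun x => κ x) =
      ∫ x, (∫ d, postFdp (fun i => lfdr π₀ unifPdf f₁ (x i)) d ∂(κ x))
        ∂(obsLaw π₀ unifPdf f₁ n) := by
  have := integral_labels hπ hf hf0 h1 κ (fun _ _ => 0) (fun d i =>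
    (if d i = true then 1 else 0) / max 1 (∑ i, if d i = true then (1 : ℝ) else 0))
  simp only [zero_add] at this
  simp only [FDR, fdp_eq, postFdp_eq]
  exact this

theorem FNR_eq (hπ : π₀ ∈ Icc (0 : ℝ) 1) (hf : Measurable f₁)
    (hf0 : ∀ x, 0 ≤ f₁ x) (h1 : ∫⁻ x, ENNReal.ofReal (f₁ x) = 1)
    (κ : Kernel (Fin n → ℝ) (Fin n → Bool)) [IsMarkovKernel κ] :
    FNR π₀ unifPdf f₁ (fun x => κ x) =
      ∫ x, (∫ d, postFnp (fun i => lfdr π₀ unifPdf f₁ (x i)) d ∂(κ x))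
        ∂(obsLaw π₀ unifPdf f₁ n) := by
  have := integral_labels hπ hf hf0 h1 κ
    (fun d i => (if d i = false then 1 else 0) / max 1 (∑ i, if d i = false then (1 : ℝ) else 0))
    (fun d i =>
      -((if d i = false then 1 else 0) / max 1 (∑ i, if d i = false then (1 : ℝ) else 0)))
  simp only [FNR, fnp_eq, postFnp_eq, mul_sub, mul_one]
  simp only [sub_eq_add_neg]
  simp only [neg_mul] at this
  exact this

end Posterior

end TwoGroup

namespace TwoGroup

/-! ### Asymptotic error rates -/

theorem integral_le_add_measureReal {Ω : Type*} [MeasurableSpace Ω] {P : Measure Ω}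
    [IsProbabilityMeasure P] {f : Ω → ℝ} (hf : Integrable f P) {B : Set Ω} (hB : MeasurableSet B)
    {c M : ℝ} (hc : 0 ≤ c) (h1 : ∀ x, f x ≤ M) (h2 : ∀ᵐ x ∂P, x ∉ B → f x ≤ c) :
    ∫ x, f x ∂P ≤ c + M * P.real B := by
  have hi : Integrable (B.indicator fun _ => M) P := (integrable_const M).indicator hB
  have : ∫ x, f x ∂P ≤ ∫ x, (c + B.indicator (fun _ => M) x) ∂P := by
    refine integral_mono_ae hf ((integrable_const c).add hi) ?_
    filter_upwards [h2] with x hx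
    by_cases hxB : x ∈ B
    · rw [indicator_of_mem hxB]
      linarith [h1 x]
    · rw [indicator_of_notMem hxB, add_zero]
      exact hx hxB
  refine this.trans (le_of_eq ?_)
  rw [integral_add (integrable_const c) hi, integral_const, probReal_univ, one_smul,
    integral_indicator_const _ hB, smul_eq_mul, mul_comm]

theorem sub_measureReal_le_integral {Ω : Type*} [MeasurableSpace Ω] {P : Measure Ω}
    [IsProbabilityMeasure P] {f : Ω → ℝ} (hf : Integrable f P) {B : Set Ω} (hB : MeasurableSet B)
    {c M : ℝ} (hM : c ≤ M) (h1 : ∀ x, 0 ≤ f x) (h2 : ∀ᵐ x ∂P, x ∉ B → c ≤ f x) :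
    c - M * P.real B ≤ ∫ x, f x ∂P := by
  have hi : Integrable (B.indicator fun _ => M) P := (integrable_const M).indicator hB
  have : ∫ x, (c - B.indicator (fun _ => M) x) ∂P ≤ ∫ x, f x ∂P := by
    refine integral_mono_ae ((integrable_const c).sub hi) hf ?_
    filter_upwards [h2] with x hx
    by_cases hxB : x ∈ B
    · rw [indicator_of_mem hxB]
      linarith [h1 x]
    · rw [indicator_of_notMem hxB, sub_zero]
      exact hx hxB
  refine le_trans (le_of_eq ?_) this
  rw [integral_sub (integrable_const c) hi, integral_const, probReal_univ, one_smul,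
    integral_indicator_const _ hB, smul_eq_mul, mul_comm]

/-! ### Integrability of posterior error rates, and competing rules -/

section ErrorRates

variable {π₀ : ℝ} {f₁ : ℝ → ℝ} {n : ℕ}

theorem FDR_nonneg (δ : (Fin n → ℝ) → Measure (Fin n → Bool)) : 0 ≤ FDR π₀ unifPdf f₁ δ :=
  integral_nonneg fun _ => integral_nonneg fun _ => div_nonneg (count_nonneg _) (by positivity)

theorem FNR_nonneg (δ : (Fin n → ℝ) → Measure (Fin n → Bool)) : 0 ≤ FNR π₀ unifPdf f₁ δ :=
  integral_nonneg fun _ => integral_nonneg fun _ => div_nonneg (count_nonneg _) (by positivity)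

/-- The local false discovery rates of the observations. -/
noncomputable def lfdrs (π₀ : ℝ) (f₁ : ℝ → ℝ) (x : Fin n → ℝ) (i : Fin n) : ℝ :=
  lfdr π₀ unifPdf f₁ (x i)

theorem integral_mem_Icc {κ : Measure (Fin n → Bool)} [IsProbabilityMeasure κ]
    {f : (Fin n → Bool) → ℝ} (h : ∀ d, f d ∈ Icc (0 : ℝ) 1) : ∫ d, f d ∂κ ∈ Icc (0 : ℝ) 1 := by
  refine ⟨integral_nonneg fun d => (h d).1, ?_⟩
  have := integral_mono (μ := κ) (f := f) (g := fun _ => (1 : ℝ)) Integrable.of_finite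
    Integrable.of_finite fun d => (h d).2
  simpa using this

theorem measurable_integral_kernel (κ : Kernel (Fin n → ℝ) (Fin n → Bool)) [IsMarkovKernel κ]
    {f : (Fin n → ℝ) → (Fin n → Bool) → ℝ} (hf : ∀ d, Measurable fun x => f x d) :
    Measurable fun x => ∫ d, f x d ∂(κ x) := by
  have : (fun x => ∫ d, f x d ∂(κ x)) = fun x => ∑ d, (κ x).real {d} * f x d := by
    funext x
    rw [integral_fintype Integrable.of_finite]
    rfl
  rw [this]
  exact Finset.measurable_sum _ fun d _ =>
    (κ.measurable_coe (measurableSet_singleton d)).ennreal_toReal.mul (hf d)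

theorem measurable_postFdp (hf : Measurable f₁) (d : Fin n → Bool) :
    Measurable fun x => postFdp (lfdrs π₀ f₁ x) d := by
  refine (Finset.measurable_sum _ fun i _ => ?_).div_const _
  split_ifs
  · exact (measurable_lfdr hf).comp (measurable_pi_apply i)
  · exact measurable_const

theorem measurable_postFnp (hf : Measurable f₁) (d : Fin n → Bool) :
    Measurable fun x => postFnp (lfdrs π₀ f₁ x) d := by
  refine (Finset.measurable_sum _ fun i _ => ?_).div_const _
  split_ifs
  · exact ((measurable_lfdr hf).comp (measurable_pi_apply i)).const_sub 1
  · exact measurable_const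

theorem isProbabilityMeasure_obsLaw (hπ : π₀ ∈ Icc (0 : ℝ) 1) (hf : Measurable f₁)
    (hf0 : ∀ x, 0 ≤ f₁ x) (h1 : ∫⁻ x, ENNReal.ofReal (f₁ x) = 1) (n : ℕ) :
    IsProbabilityMeasure (obsLaw π₀ unifPdf f₁ n) := by
  have := isProbabilityMeasure_margLaw hπ hf hf0 h1
  change IsProbabilityMeasure (Measure.pi fun _ => margLaw π₀ f₁)
  infer_instance

theorem ae_obsLaw_mem (hπ : π₀ ∈ Icc (0 : ℝ) 1) (hf : Measurable f₁)
    (hf0 : ∀ x, 0 ≤ f₁ x) (h1 : ∫⁻ x, ENNReal.ofReal (f₁ x) = 1)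
    (hsupp : ∀ᵐ t ∂(margLaw π₀ f₁), t ∈ Ioo (0 : ℝ) 1) (n : ℕ) :
    ∀ᵐ x ∂(obsLaw π₀ unifPdf f₁ n), ∀ i, x i ∈ Ioo (0 : ℝ) 1 := by
  have := isProbabilityMeasure_margLaw hπ hf hf0 h1
  rw [ae_all_iff]
  exact fun i => (Measure.tendsto_eval_ae_ae (μ := fun _ : Fin n => margLaw π₀ f₁)
    (i := i)).eventually hsupp

theorem lfdrs_mem (hπ : π₀ ∈ Icc (0 : ℝ) 1) (hf0 : ∀ x, 0 ≤ f₁ x) (x : Fin n → ℝ) (i : Fin n) :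
    lfdrs π₀ f₁ x i ∈ Icc (0 : ℝ) 1 := lfdr_mem hπ hf0 (x i)

theorem integrable_post (hπ : π₀ ∈ Icc (0 : ℝ) 1) (hf : Measurable f₁) (hf0 : ∀ x, 0 ≤ f₁ x)
    (h1 : ∫⁻ x, ENNReal.ofReal (f₁ x) = 1)
    (κ : Kernel (Fin n → ℝ) (Fin n → Bool)) [IsMarkovKernel κ]
    {f : (Fin n → ℝ) → (Fin n → Bool) → ℝ} (hfm : ∀ d, Measurable fun x => f x d)
    (hfI : ∀ x d, f x d ∈ Icc (0 : ℝ) 1) :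
    Integrable (fun x => ∫ d, f x d ∂(κ x)) (obsLaw π₀ unifPdf f₁ n) := by
  have := isProbabilityMeasure_obsLaw hπ hf hf0 h1 n
  refine Integrable.of_bound (measurable_integral_kernel κ hfm).aestronglyMeasurable 1
    (Eventually.of_forall fun x => ?_)
  have := integral_mem_Icc (κ := κ x) (hfI x)
  rw [Real.norm_eq_abs, abs_of_nonneg this.1]
  exact this.2

/-- The kernel and the procedure agree when all observations lie in (0,1), hence almost surely;
measurability is then available through the kernel. -/
theorem FDR_adaptiveRule (hπ : π₀ ∈ Ioo (0 : ℝ) 1) (hf : Measurable f₁) (hf0 : ∀ x, 0 ≤ f₁ x)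
    (h1 : ∫⁻ x, ENNReal.ofReal (f₁ x) = 1)
    (hsupp : ∀ᵐ t ∂(margLaw π₀ f₁), t ∈ Ioo (0 : ℝ) 1) (α : ℝ) :
    FDR π₀ unifPdf f₁ (adaptiveRule π₀ unifPdf n α) =
        FDR π₀ unifPdf f₁ (fun x => adaptiveKernel π₀ n α hπ.1 x) ∧
      FNR π₀ unifPdf f₁ (adaptiveRule π₀ unifPdf n α) =
        FNR π₀ unifPdf f₁ (fun x => adaptiveKernel π₀ n α hπ.1 x) := by
  have hπI := Ioo_subset_Icc_self hπ
  have hae : ∀ᵐ ω ∂(modelLaw π₀ unifPdf f₁ n), ∀ i, obs ω i ∈ Ioo (0 : ℝ) 1 := by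
    have := ae_obsLaw_mem hπI hf hf0 h1 hsupp n
    rw [← map_obs_modelLaw hπI hf hf0 h1] at this
    exact ae_of_ae_map measurable_obs.aemeasurable this
  constructor
  · refine integral_congr_ae ?_
    filter_upwards [hae] with ω hω
    change _ = ∫ d, _ ∂(adaptiveKernel π₀ n α hπ.1 (obs ω))
    rw [adaptiveKernel_apply hπ.1 α hω]
    rfl
  · refine integral_congr_ae ?_
    filter_upwards [hae] with ω hω
    change _ = ∫ d, _ ∂(adaptiveKernel π₀ n α hπ.1 (obs ω))
    rw [adaptiveKernel_apply hπ.1 α hω]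
    rfl

/-- The rule that never rejects. -/
noncomputable def neverReject (n : ℕ) : Kernel (Fin n → ℝ) (Fin n → Bool) :=
  Kernel.const _ (Measure.dirac fun _ => false)

instance (n : ℕ) : IsMarkovKernel (neverReject n) := by
  unfold neverReject
  infer_instance

theorem FDR_neverReject : FDR π₀ unifPdf f₁ (fun x => neverReject n x) = 0 := by
  simp [FDR, neverReject, fdp]

theorem fnrStarN_le {κ : Kernel (Fin n → ℝ) (Fin n → Bool)} (hκ : IsMarkovKernel κ) {α : ℝ}
    (h : FDR π₀ unifPdf f₁ (fun x => κ x) ≤ α) :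
    fnrStarN π₀ unifPdf f₁ n α ≤ FNR π₀ unifPdf f₁ (fun x => κ x) := by
  refine csInf_le ⟨0, ?_⟩ ⟨κ, hκ, h, rfl⟩
  rintro r ⟨κ, -, -, rfl⟩
  exact FNR_nonneg _

theorem le_fnrStarN {α r : ℝ} (hα : 0 ≤ α)
    (h : ∀ κ : Kernel (Fin n → ℝ) (Fin n → Bool), IsMarkovKernel κ →
      FDR π₀ unifPdf f₁ (fun x => κ x) ≤ α → r ≤ FNR π₀ unifPdf f₁ (fun x => κ x)) :
    r ≤ fnrStarN π₀ unifPdf f₁ n α := by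
  refine le_csInf ⟨_, neverReject n, inferInstance, FDR_neverReject.trans_le hα, rfl⟩ ?_
  rintro s ⟨κ, hκ, hF, rfl⟩
  exact h κ hκ hF

end ErrorRates

/-! ### Limits for the procedure and for the optimal rule -/

section Asymptotics

variable {π₀ : ℝ} {f₁ F G : ℝ → ℝ}

/-- The error rates of the data-driven procedure converge, uniformly in the level. -/
theorem adaptive_error_rates (hπ : π₀ ∈ Ioo (0 : ℝ) 1) (hf : Measurable f₁) (hf0 : ∀ x, 0 ≤ f₁ x)
    (h1 : ∫⁻ x, ENNReal.ofReal (f₁ x) = 1)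
    (hsupp : ∀ᵐ t ∂(margLaw π₀ f₁), t ∈ Ioo (0 : ℝ) 1)
    (hm : IsModel π₀ (lfdr π₀ unifPdf f₁) F (lfdrPhi π₀ f₁) G) {ε : ℝ} (hε : 0 < ε) :
    ∀ᶠ n : ℕ in atTop, ∀ α ∈ Icc (0 : ℝ) 1,
      FDR π₀ unifPdf f₁ (adaptiveRule π₀ unifPdf n α) ≤ α + ε ∧
      |FNR π₀ unifPdf f₁ (adaptiveRule π₀ unifPdf n α) - curveC (lfdrPhi π₀ f₁) G α| ≤ ε := by
  have hπI := Ioo_subset_Icc_self hπ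
  obtain ⟨δ, hδ, hnear⟩ := hm.adaptive_near (half_pos hε)
  obtain ⟨B, hBm, hB0, hB⟩ := exists_bad_sets hπI hf hf0 h1 hm.toIsCurve hδ
  -- The bad event and n are fixed before the level α, which yields uniformity.
  filter_upwards [eventually_gt_atTop 0, hB0.eventually (gt_mem_nhds (half_pos hε))] with n hn hBn
    α hα
  have := isProbabilityMeasure_obsLaw hπI hf hf0 h1 n
  have hκ := isMarkovKernel_adaptiveKernel hπ.1 n hα
  have hae := ae_obsLaw_mem hπI hf hf0 h1 hsupp n
  obtain ⟨e1, e2⟩ := FDR_adaptiveRule (n := n) hπ hf hf0 h1 hsupp α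
  have hgood : ∀ᵐ x ∂(obsLaw π₀ unifPdf f₁ n), x ∉ B n →
      ∫ d, postFdp (lfdrs π₀ f₁ x) d ∂(adaptiveKernel π₀ n α hπ.1 x) ≤ α + ε / 2 ∧
      |∫ d, postFnp (lfdrs π₀ f₁ x) d ∂(adaptiveKernel π₀ n α hπ.1 x) -
        curveC (lfdrPhi π₀ f₁) G α| ≤ ε / 2 := by
    filter_upwards [hae] with x hx hxB
    rw [adaptiveKernel_apply hπ.1 α hx]
    exact hnear n x hn hx (hB n hn x hxB) α hα
  have hCI := hm.C_nonneg hα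
  have hC1 : curveC (lfdrPhi π₀ f₁) G α ≤ 1 := by
    refine (hm.toIsCurve.C_le hα).trans ?_
    have := hm.le_slope 0 1 zero_le_one
    rw [zero_add, hm.phi_zero, hm.one] at this
    linarith
  have i1 := integrable_post hπI hf hf0 h1 (adaptiveKernel π₀ n α hπ.1)
    (measurable_postFdp (π₀ := π₀) hf) fun x d => postFdp_mem (lfdrs_mem hπI hf0 x) d
  have i2 := integrable_post hπI hf hf0 h1 (adaptiveKernel π₀ n α hπ.1)
    (measurable_postFnp (π₀ := π₀) hf) fun x d => postFnp_mem (lfdrs_mem hπI hf0 x) d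
  have b1 := fun x => integral_mem_Icc (κ := adaptiveKernel π₀ n α hπ.1 x)
    (postFdp_mem (lfdrs_mem hπI hf0 x))
  have b2 := fun x => integral_mem_Icc (κ := adaptiveKernel π₀ n α hπ.1 x)
    (postFnp_mem (lfdrs_mem hπI hf0 x))
  rw [e1, e2, FDR_eq hπI hf hf0 h1, FNR_eq hπI hf hf0 h1]
  constructor
  · refine (integral_le_add_measureReal i1 (hBm n) (by linarith [hα.1] : 0 ≤ α + ε / 2)
      (fun x => (b1 x).2) (hgood.mono fun x hx hxB => (hx hxB).1)).trans ?_
    linarith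
  · have u1 := integral_le_add_measureReal i2 (hBm n) (by linarith :
      0 ≤ curveC (lfdrPhi π₀ f₁) G α + ε / 2) (fun x => (b2 x).2)
      (hgood.mono fun x hx hxB => by linarith [(abs_le.1 (hx hxB).2).2])
    have u2 := sub_measureReal_le_integral i2 (hBm n) (by linarith :
      curveC (lfdrPhi π₀ f₁) G α - ε / 2 ≤ 1) (fun x => (b2 x).1)
      (hgood.mono fun x hx hxB => by linarith [(abs_le.1 (hx hxB).2).1])
    change |∫ x, ∫ d, postFnp (lfdrs π₀ f₁ x) d ∂(adaptiveKernel π₀ n α hπ.1 x)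
      ∂(obsLaw π₀ unifPdf f₁ n) - _| ≤ ε
    rw [abs_le]
    constructor <;> linarith

/-- Asymptotic lower bound for the false non-discovery rate. -/
theorem eventually_le_fnrStarN (hπ : π₀ ∈ Ioo (0 : ℝ) 1) (hf : Measurable f₁)
    (hf0 : ∀ x, 0 ≤ f₁ x) (h1 : ∫⁻ x, ENNReal.ofReal (f₁ x) = 1)
    (hm : IsModel π₀ (lfdr π₀ unifPdf f₁) F (lfdrPhi π₀ f₁) G) {α : ℝ} (hα : α ∈ Icc (0 : ℝ) 1)
    {ε : ℝ} (hε : 0 < ε) :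
    ∀ᶠ n : ℕ in atTop,
      curveC (lfdrPhi π₀ f₁) G α - ε ≤ fnrStarN π₀ unifPdf f₁ n α := by
  have hπI := Ioo_subset_Icc_self hπ
  have hc := hm.toIsCurve
  rcases hα.2.eq_or_lt with rfl | hα1
  · refine Eventually.of_forall fun n => le_fnrStarN zero_le_one fun κ _ _ => ?_
    rw [hc.C_one]
    linarith [FNR_nonneg (π₀ := π₀) (f₁ := f₁) (fun x => κ x)]
  set C := curveC (lfdrPhi π₀ f₁) G with hC
  obtain ⟨η, hη, hmod⟩ := hc.C_modulus (ε := ε / 3) (by positivity)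
  set α' := min (α + η) 1 with hα'
  have hαα' : α < α' := lt_min (by linarith) hα1
  have hα'I : α' ∈ Icc (0 : ℝ) 1 := ⟨hα.1.trans hαα'.le, min_le_right _ _⟩
  have hCC : C α ≤ C α' + ε / 3 := hmod α hα α' hα'I (min_le_left _ _)
  have hanti := hc.anti_C hα hα'I hαα'.le
  have hd : 0 < α' - α := by linarith
  -- Lagrange multiplier: minus the slope of the chord over [α, α'], finite even where C has no
  -- useful derivative. The line with this slope through (α, C α) lies below C outside (α, α') by
  -- convexity, and inside up to ε/3.
  set l := (C α - C α') / (α' - α) with hl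
  have hl0 : 0 ≤ l := div_nonneg (by linarith) hd.le
  have hlmul : l * (α' - α) = C α - C α' := div_mul_cancel₀ _ hd.ne'
  have hline : ∀ u ∈ Icc (0 : ℝ) 1, C α + l * α - ε / 3 ≤ C u + l * u := by
    intro u hu
    rcases le_or_gt u α with h | h
    · have h3 := hc.convexOn_C.three_point hu hα'I h hαα'.le
      change (α' - u) * C α ≤ (α' - α) * C u + (α - u) * C α' at h3
      have h4 : (α' - α) * (C α + l * α) ≤ (α' - α) * (C u + l * u) := by
        have h5 : (α - u) * (l * (α' - α)) = (α - u) * (C α - C α') := by rw [hlmul]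
        linarith
      linarith [le_of_mul_le_mul_left h4 hd]
    rcases le_or_gt α' u with h' | h'
    · have h3 := hc.convexOn_C.three_point hα hu hαα'.le h'
      change (u - α) * C α' ≤ (u - α') * C α + (α' - α) * C u at h3
      have h4 : (α' - α) * (C α + l * α) ≤ (α' - α) * (C u + l * u) := by
        have h5 : (u - α) * (l * (α' - α)) = (u - α) * (C α - C α') := by rw [hlmul]
        linarith
      linarith [le_of_mul_le_mul_left h4 hd]
    · have h3 : C α' ≤ C u := hc.anti_C hu hα'I h'.le
      have h4 := mul_le_mul_of_nonneg_left h.le hl0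
      linarith
  obtain ⟨δ, hδ, hopt⟩ := hc.C_postFdp_le (ε := ε / 3) (by positivity)
  obtain ⟨B, hBm, hB0, hB⟩ := exists_bad_sets hπI hf hf0 h1 hc hδ
  have hB1 : Tendsto (fun n => (1 + l) * (obsLaw π₀ unifPdf f₁ n).real (B n)) atTop (𝓝 0) := by
    simpa using hB0.const_mul (1 + l)
  have hC1 : C α ≤ 1 := by
    refine (hc.C_le hα).trans ?_
    have := hm.le_slope 0 1 zero_le_one
    rw [zero_add, hm.phi_zero, hm.one] at this
    linarith
  filter_upwards [eventually_gt_atTop 0, hB1.eventually (gt_mem_nhds (by positivity : 0 < ε / 3))]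
    with n hn hBn
  have := isProbabilityMeasure_obsLaw hπI hf hf0 h1 n
  refine le_fnrStarN hα.1 fun κ hκ hFDR => ?_
  have i1 := integrable_post hπI hf hf0 h1 κ
    (measurable_postFdp (π₀ := π₀) hf) fun x d => postFdp_mem (lfdrs_mem hπI hf0 x) d
  have i2 := integrable_post hπI hf hf0 h1 κ
    (measurable_postFnp (π₀ := π₀) hf) fun x d => postFnp_mem (lfdrs_mem hπI hf0 x) d
  have b1 := fun x => integral_mem_Icc (κ := κ x) (postFdp_mem (lfdrs_mem hπI hf0 x))
  have b2 := fun x => integral_mem_Icc (κ := κ x) (postFnp_mem (lfdrs_mem hπI hf0 x))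
  -- The Lagrangian FNR + l · FDR is linear, so the bound for each decision vector passes through
  -- both the randomization and the expectation.
  have hgood : ∀ x, x ∉ B n → C α + l * α - ε / 3 - ε / 3 ≤
      ∫ d, postFnp (lfdrs π₀ f₁ x) d ∂(κ x) + l * ∫ d, postFdp (lfdrs π₀ f₁ x) d ∂(κ x) := by
    intro x hxB
    rw [← integral_const_mul, ← integral_add Integrable.of_finite Integrable.of_finite]
    have hconst : ∫ _d, (C α + l * α - ε / 3 - ε / 3) ∂(κ x) = C α + l * α - ε / 3 - ε / 3 := by
      simp
    rw [← hconst]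
    refine integral_mono Integrable.of_finite Integrable.of_finite fun d => ?_
    have h3 := hopt n (lfdrs π₀ f₁ x) hn (lfdrs_mem hπI hf0 x) (hB n hn x hxB) d
    have h4 := hline _ (postFdp_mem (lfdrs_mem hπI hf0 x) d)
    change C (postFdp (lfdrs π₀ f₁ x) d) ≤ _ at h3
    dsimp only
    linarith
  have hlα : l * α ≤ l := mul_le_of_le_one_right hl0 hα.2
  have key := sub_measureReal_le_integral (i2.add (i1.const_mul l)) (hBm n)
    (by linarith : C α + l * α - ε / 3 - ε / 3 ≤ 1 + l)
    (fun x => add_nonneg (b2 x).1 (mul_nonneg hl0 (b1 x).1)) (Eventually.of_forall hgood)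
  simp only [Pi.add_apply] at key
  rw [integral_add i2 (i1.const_mul l), integral_const_mul] at key
  rw [FDR_eq hπI hf hf0 h1] at hFDR
  rw [FNR_eq hπI hf hf0 h1]
  have h5 := mul_le_mul_of_nonneg_left hFDR hl0
  change l * ∫ x, ∫ d, postFdp (lfdrs π₀ f₁ x) d ∂(κ x) ∂(obsLaw π₀ unifPdf f₁ n) ≤ _ at h5
  change _ ≤ ∫ x, ∫ d, postFnp (lfdrs π₀ f₁ x) d ∂(κ x) ∂(obsLaw π₀ unifPdf f₁ n)
  linarith

/-- Asymptotic upper bound for the optimal false non-discovery rate. -/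
theorem eventually_fnrStarN_le (hπ : π₀ ∈ Ioo (0 : ℝ) 1) (hf : Measurable f₁)
    (hf0 : ∀ x, 0 ≤ f₁ x) (h1 : ∫⁻ x, ENNReal.ofReal (f₁ x) = 1)
    (hsupp : ∀ᵐ t ∂(margLaw π₀ f₁), t ∈ Ioo (0 : ℝ) 1)
    (hm : IsModel π₀ (lfdr π₀ unifPdf f₁) F (lfdrPhi π₀ f₁) G) {α : ℝ} (hα : α ∈ Icc (0 : ℝ) 1)
    {ε : ℝ} (hε : 0 < ε) :
    ∀ᶠ n : ℕ in atTop,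
      fnrStarN π₀ unifPdf f₁ n α ≤ curveC (lfdrPhi π₀ f₁) G α + ε := by
  have hπI := Ioo_subset_Icc_self hπ
  have hc := hm.toIsCurve
  rcases hα.1.eq_or_lt with rfl | hα0
  -- At level 0 there is no smaller level to use; never rejecting has FDR 0, and its FNR tends to φ
  -- 1 = C 0.
  · obtain ⟨B, hBm, hB0, hB⟩ := exists_bad_sets hπI hf hf0 h1 hc (half_pos hε)
    filter_upwards [eventually_gt_atTop 0, hB0.eventually (gt_mem_nhds (half_pos hε))] with n hn hBn
    have := isProbabilityMeasure_obsLaw hπI hf hf0 h1 n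
    refine (fnrStarN_le (κ := neverReject n) inferInstance FDR_neverReject.le).trans ?_
    have i2 := integrable_post hπI hf hf0 h1 (neverReject n)
      (measurable_postFnp (π₀ := π₀) hf) fun x d => postFnp_mem (lfdrs_mem hπI hf0 x) d
    have b2 := fun x => integral_mem_Icc (κ := neverReject n x)
      (postFnp_mem (lfdrs_mem hπI hf0 x))
    rw [FNR_eq hπI hf hf0 h1, hc.C_zero]
    refine (integral_le_add_measureReal i2 (hBm n) (c := lfdrPhi π₀ f₁ 1 + ε / 2)
      (by linarith [hc.phi_nonneg zero_le_one]) (fun x => (b2 x).2)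
      (Eventually.of_forall fun x hxB => ?_)).trans (by linarith)
    have h2 := (abs_le.1 (hB n hn x hxB 1)).2
    have h3 : ∫ d, postFnp (lfdrs π₀ f₁ x) d ∂(neverReject n x) =
        avgPos (fun i => lfdr π₀ unifPdf f₁ (x i)) 1 := by
      have hn1 : (1 : ℝ) ≤ n := by exact_mod_cast hn
      have hmax : ∀ i, max (1 - lfdr π₀ unifPdf f₁ (x i)) 0 = 1 - lfdr π₀ unifPdf f₁ (x i) :=
        fun i => max_eq_left (by linarith [(lfdr_mem hπI hf0 (x i)).2])
      rw [neverReject, Kernel.const_apply, integral_dirac]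
      simp [postFnp, avgPos, lfdrs, hmax, max_eq_right hn1]
    linarith
  -- The procedure is run at a slightly smaller level α', so that its asymptotic excess fits under α
  -- and it becomes an admissible competitor.
  · obtain ⟨η, hη, hmod⟩ := hc.C_modulus (half_pos hε)
    set α' := max (α - η) 0 with hα'
    have hα'α : α' < α := max_lt (by linarith) hα0
    have hα'I : α' ∈ Icc (0 : ℝ) 1 := ⟨le_max_right _ _, hα'α.le.trans hα.2⟩
    have hCC := hmod α' hα'I α hα (by linarith [le_max_left (α - η) 0])
    filter_upwards [adaptive_error_rates hπ hf hf0 h1 hsupp hm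
      (lt_min (sub_pos.2 hα'α) (half_pos hε))] with n hn
    obtain ⟨h2, h3⟩ := hn α' hα'I
    obtain ⟨e1, e2⟩ := FDR_adaptiveRule (n := n) hπ hf hf0 h1 hsupp α'
    rw [e1] at h2
    rw [e2] at h3
    have h4 := (abs_le.1 h3).2
    refine (fnrStarN_le (isMarkovKernel_adaptiveKernel hπ.1 n hα'I) (h2.trans ?_)).trans ?_
    · linarith [min_le_left (α - α') (ε / 2)]
    · linarith [min_le_right (α - α') (ε / 2)]

theorem tendsto_fnrStarN (hπ : π₀ ∈ Ioo (0 : ℝ) 1) (hf : Measurable f₁)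
    (hf0 : ∀ x, 0 ≤ f₁ x) (h1 : ∫⁻ x, ENNReal.ofReal (f₁ x) = 1)
    (hsupp : ∀ᵐ t ∂(margLaw π₀ f₁), t ∈ Ioo (0 : ℝ) 1)
    (hm : IsModel π₀ (lfdr π₀ unifPdf f₁) F (lfdrPhi π₀ f₁) G) {α : ℝ} (hα : α ∈ Icc (0 : ℝ) 1) :
    Tendsto (fun n : ℕ => fnrStarN π₀ unifPdf f₁ n α) atTop
      (𝓝 (curveC (lfdrPhi π₀ f₁) G α)) := by
  rw [Metric.tendsto_nhds]
  intro ε hε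
  filter_upwards [eventually_le_fnrStarN hπ hf hf0 h1 hm hα (half_pos hε),
    eventually_fnrStarN_le hπ hf hf0 h1 hsupp hm hα (half_pos hε)] with n h2 h3
  rw [Real.dist_eq, abs_lt]
  constructor <;> linarith

end Asymptotics

end TwoGroup

theorem mainTheorem6 (π₀ : ℝ) (hπ₀ : π₀ ∈ Set.Ioo (0 : ℝ) 1)
    (f₁ : ℝ → ℝ) (hf₁_meas : Measurable f₁) (hf₁_nonneg : ∀ x, 0 ≤ f₁ x)
    (hf₁_int : ∫⁻ x, ENNReal.ofReal (f₁ x) = 1)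
    (hf₁_anti : AntitoneOn f₁ (Set.Ioo 0 1)) (hf₁_cont : ContinuousOn f₁ (Set.Ioo 0 1))
    (g : ℝ → ℝ) (hg_meas : Measurable g) (hg_pos : ∀ t ∈ Set.Ioo (0 : ℝ) 1, 0 < g t)
    (hW : Measure.map (TwoGroup.lfdr π₀ TwoGroup.unifPdf f₁)
        (TwoGroup.densLaw (TwoGroup.mixPdf π₀ TwoGroup.unifPdf f₁)) =
      TwoGroup.densLaw ((Set.Ioo (0 : ℝ) 1).indicator g)) :
    -- the procedure is a decision rule (almost surely given by a Markov kernel)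
    (∀ (n : ℕ), ∀ α ∈ Set.Icc (0 : ℝ) 1,
      ∃ κ : Kernel (Fin n → ℝ) (Fin n → Bool), IsMarkovKernel κ ∧
        ∀ᵐ x ∂(TwoGroup.obsLaw π₀ TwoGroup.unifPdf f₁ n),
          κ x = TwoGroup.adaptiveRule π₀ TwoGroup.unifPdf n α x) ∧
    -- asymptotic FDR control, uniformly in the level
    limsup (fun n : ℕ => ⨆ α : Set.Icc (0 : ℝ) 1,
      (TwoGroup.FDR π₀ TwoGroup.unifPdf f₁
        (TwoGroup.adaptiveRule π₀ TwoGroup.unifPdf n (α : ℝ)) - (α : ℝ))) atTop ≤ 0 ∧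
    -- the limit that defines the optimal tradeoff exists
    (∀ α ∈ Set.Icc (0 : ℝ) 1,
      Tendsto (fun n : ℕ => TwoGroup.fnrStarN π₀ TwoGroup.unifPdf f₁ n α) atTop
        (𝓝 (TwoGroup.fnrStar π₀ TwoGroup.unifPdf f₁ α))) ∧
    -- the optimal FNR is attained asymptotically, uniformly in the level
    Tendsto (fun n : ℕ => ⨆ α : Set.Icc (0 : ℝ) 1,
      |TwoGroup.FNR π₀ TwoGroup.unifPdf f₁
          (TwoGroup.adaptiveRule π₀ TwoGroup.unifPdf n (α : ℝ)) -
        TwoGroup.fnrStar π₀ TwoGroup.unifPdf f₁ (α : ℝ)|) atTop (𝓝 0) := by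
  have hπI := Set.Ioo_subset_Icc_self hπ₀
  have hm := TwoGroup.isModel hπ₀ hf₁_meas hf₁_nonneg hf₁_int hf₁_anti hf₁_cont hg_meas hg_pos hW
  have hsupp := TwoGroup.ae_mem_Ioo hf₁_meas hW
  have hlim : ∀ α ∈ Set.Icc (0 : ℝ) 1, Tendsto
      (fun n : ℕ => TwoGroup.fnrStarN π₀ TwoGroup.unifPdf f₁ n α) atTop
      (𝓝 (TwoGroup.curveC (TwoGroup.lfdrPhi π₀ f₁) (TwoGroup.lfdrCdf π₀ f₁) α)) := fun α hα =>
    TwoGroup.tendsto_fnrStarN hπ₀ hf₁_meas hf₁_nonneg hf₁_int hsupp hm hα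
  have hstar : ∀ α ∈ Set.Icc (0 : ℝ) 1, TwoGroup.fnrStar π₀ TwoGroup.unifPdf f₁ α =
      TwoGroup.curveC (TwoGroup.lfdrPhi π₀ f₁) (TwoGroup.lfdrCdf π₀ f₁) α := fun α hα =>
    (hlim α hα).limUnder_eq
  have hrates := fun (ε : ℝ) (hε : 0 < ε) =>
    TwoGroup.adaptive_error_rates hπ₀ hf₁_meas hf₁_nonneg hf₁_int hsupp hm hε
  have : Nonempty (Set.Icc (0 : ℝ) 1) := ⟨⟨0, by simp⟩⟩
  refine ⟨fun n α hα => ⟨TwoGroup.adaptiveKernel π₀ n α hπ₀.1,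
    TwoGroup.isMarkovKernel_adaptiveKernel hπ₀.1 n hα, ?_⟩, ?_, fun α hα => ?_, ?_⟩
  · filter_upwards [TwoGroup.ae_obsLaw_mem hπI hf₁_meas hf₁_nonneg hf₁_int hsupp n] with x hx
    exact TwoGroup.adaptiveKernel_apply hπ₀.1 α hx
  -- In ℝ the bound on `limsup` requires the sequence to be bounded below; at α = 0 the difference
  -- is the FDR itself, hence nonnegative.
  · have hbdd : IsBoundedUnder (· ≥ ·) atTop (fun n : ℕ => ⨆ α : Set.Icc (0 : ℝ) 1,
        (TwoGroup.FDR π₀ TwoGroup.unifPdf f₁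
          (TwoGroup.adaptiveRule π₀ TwoGroup.unifPdf n (α : ℝ)) - (α : ℝ))) := by
      refine isBoundedUnder_of_eventually_ge (a := 0) ?_
      filter_upwards [hrates 1 one_pos] with n hn
      refine le_ciSup_of_le ⟨1, ?_⟩ ⟨0, by simp⟩ ?_
      · rintro r ⟨α, rfl⟩
        have := (hn α α.2).1
        dsimp only
        linarith
      · simpa using TwoGroup.FDR_nonneg _
    refine le_of_forall_pos_le_add fun ε hε => ?_
    rw [zero_add]
    refine limsup_le_of_le hbdd.isCoboundedUnder_le ?_
    filter_upwards [hrates ε hε] with n hn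
    exact ciSup_le fun α => by linarith [(hn α α.2).1]
  · rw [hstar α hα]
    exact hlim α hα
  · rw [Metric.tendsto_nhds]
    intro ε hε
    filter_upwards [hrates (ε / 2) (half_pos hε)] with n hn
    have h0 : 0 ≤ ⨆ α : Set.Icc (0 : ℝ) 1,
        |TwoGroup.FNR π₀ TwoGroup.unifPdf f₁
          (TwoGroup.adaptiveRule π₀ TwoGroup.unifPdf n (α : ℝ)) -
        TwoGroup.fnrStar π₀ TwoGroup.unifPdf f₁ (α : ℝ)| :=
      Real.iSup_nonneg fun _ => abs_nonneg _
    rw [Real.dist_eq, sub_zero, abs_of_nonneg h0]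
    refine lt_of_le_of_lt (ciSup_le fun α => ?_) (half_lt_self hε)
    rw [hstar α α.2]
    exact (hn α α.2).2
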